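/- Theorem 3. All categories are small. $\mathbf{Prof}$ is the symmetric monoidal (compact closed) bicategory of categories, profunctors $B^{op}\times A\to\mathbf{Set}$ and natural transformations, with composition by coends; an interpretation of a presentation in $\mathbf{Prof}$ is a choice of a category $C$ for the generating 0-morphism, of profunctors for the generating 1-morphisms, and of (invertible) natural transformations for the (invertible) generating 2-morphisms, such that the equations hold. The balanced version of the traced pseudomonoid presentation has: a multiplication $M:C\times C\to C$ and a unit $J:1\to C$, with right adjoints $M\dashv M^R$, $J\dashv J^R$ (units, counits, triangle equations); invertible associator and unitors, with pentagon and triangle equations; an invertible braiding with the hexagon equations; an invertible twist $\theta$ of the identity 1-morphism, which on $M$ equals the double braiding composed with the twists on both inputs, and on $J$ is the identity; and a 2-morphism $\mathrm{Tr}$ from the 1-morphism obtained from $M^R\circ M$ by joining the second output to the second input, in $\mathbf{Prof}$ the profunctor $(a,b)\mapsto\int^{x,c}M^R((a,x),c)\times M(c,(b,x))$, to the identity, satisfying the equations for vanishing (for the unit and for the multiplication) and superposing. The balanced traced pseudomonoid presentation $\mathcal T'$ has in addition the yanking equation: bending the identity wire, applying the unit of $M\dashv M^R$, then the braiding, then $\mathrm{Tr}$,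 gives $\theta$; and likewise with the inverses of the braiding and of $\theta$. A balanced traced monoidal category is a braided monoidal category with a natural twist $\theta_X:X\cong X$ satisfying $\theta_I=1$ and $\theta_{X\otimes Y}=c_{Y,X}\,c_{X,Y}\,(\theta_X\otimes\theta_Y)$, and a right trace $\mathrm{Tr}^X:\mathrm{Hom}(A\otimes X,B\otimes X)\to\mathrm{Hom}(A,B)$ satisfying tightening, sliding, vanishing for $I$ and for $X\otimes Y$, superposing, and yanking: $\mathrm{Tr}^X(c_{X,X})=\theta_X$ and $\mathrm{Tr}^X(c_{X,X}^{-1})=\theta_X^{-1}$. Let $F:C\to D$ be a Cauchy completion (idempotents split in $D$, $F$ is fully faithful, and every object of $D$ is a retract of some $FX$; if $C$ is Cauchy complete one may take $D=C$ and $F=\mathrm{id}$). Say that a structure on $D$ *realizes* an interpretation on $C$ if there are natural isomorphisms $M(c,(a,b))\cong D(Fc,Fa\otimes Fb)$, $J(x)\cong D(Fx,I)$, $M^R((a,b),c)\cong D(Fa\otimes Fb,Fc)$, $J^R(x)\cong D(I,Fx)$ under which the generating 2-morphisms are given by the structure morphisms and by the trace of $D$. Then: 1. every interpretation of $\mathcal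 T'$ in $\mathbf{Prof}$ with underlying category $C$ is realized by the structure of a balanced traced monoidal category on $D$, and every such structure realizes an interpretation of $\mathcal T'$ on $C$; 2. the same holds for interpretations of the balanced version of the traced pseudomonoid presentation and structures of a balanced monoidal category with a right trace (yanking being dropped on both sides); and whenever such a structure realizes such an interpretation, each of the two parts of the yanking equation holds in the interpretation if and only if it holds in $D$, and $\theta$ is the identity in the interpretation if and only if it is in $D$; 3. for given realizations, isomorphisms of interpretations (over the identity of $C$) correspond bijectively to isomorphisms of structures (over the identity functor of $D$: braided strong monoidal, preserving twist and trace); 4. a structure of a balanced traced monoidal category on $D$ has trivial twist if and only if it comes from a symmetric traced monoidal category (a symmetric monoidal category with a right trace such that $\mathrm{Tr}^X(c_{X,X})=1_X$). -/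

import Mathlib

open CategoryTheory Opposite MonoidalCategory

universe u

namespace TracedProf

/-! ## The bicategory of small categories, profunctors and natural transformations

A profunctor from `A` to `B` is Mathlib's `Profunctor A B`, that is, a functor
`A ⥤ Bᵒᵖ ⥤ Type u`.  Identities are hom-functors (`Profunctor.id`), the representation of a functor
is `Functor.toProfunctor`, 2-morphisms are natural transformations, and composition is given by
coends. -/

section Profunctors

variable {A B D : Type u} [SmallCategory A] [SmallCategory B] [SmallCategory D]
variable {A' B' : Type u} [SmallCategory A'] [SmallCategory B']

/-- The set `P(b, a)`, for `P : Bᵒᵖ × A → Set`: contravariant in the output `b`, covariant in the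
input `a`. -/
abbrev El (P : Profunctor.{u} A B) (a : A) (b : B) : Type u := (P.obj a).obj (op b)

/-- Covariant action on the input. -/
def push (P : Profunctor.{u} A B) {a a' : A} {b : B} (f : a ⟶ a') (p : El P a b) : El P a' b :=
  (P.map f).app (op b) p

/-- Contravariant action on the output. -/
def pull (P : Profunctor.{u} A B) {a : A} {b b' : B} (g : b' ⟶ b) (p : El P a b) : El P a b' :=
  (P.obj a).map g.op p

/-- The action of a 2-morphism on elements. -/
def ev {P Q : Profunctor.{u} A B} (t : P ⟶ Q) {a : A} {b : B} (p : El P a b) : El Q a b :=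
  (t.app a).app (op b) p

lemma push_id (P : Profunctor.{u} A B) {a : A} {b : B} (p : El P a b) : push P (𝟙 a) p = p := by
  simp [push]

lemma pull_id (P : Profunctor.{u} A B) {a : A} {b : B} (p : El P a b) : pull P (𝟙 b) p = p := by
  simp [pull]

lemma push_comp (P : Profunctor.{u} A B) {a a' a'' : A} {b : B} (f : a ⟶ a') (f' : a' ⟶ a'')
    (p : El P a b) : push P (f ≫ f') p = push P f' (push P f p) := by
  simp [push]

lemma pull_comp (P : Profunctor.{u} A B) {a : A} {b b' b'' : B} (g : b' ⟶ b) (g' : b'' ⟶ b')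
    (p : El P a b) : pull P (g' ≫ g) p = pull P g' (pull P g p) := by
  simp [pull]

lemma push_pull (P : Profunctor.{u} A B) {a a' : A} {b b' : B} (f : a ⟶ a') (g : b' ⟶ b)
    (p : El P a b) : push P f (pull P g p) = pull P g (push P f p) := by
  simp [push, pull]

/-- The bifunctor `(b', b) ↦ P(b', a) × Q(d, b)` whose coend is the composite profunctor. -/
@[simps]
def compDiagram (P : Profunctor.{u} A B) (Q : Profunctor.{u} B D) (a : A) (d : D) :
    Bᵒᵖ ⥤ B ⥤ Type u where
  obj b' :=
    { obj := fun b => El P a b'.unop × El Q b d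
      map := fun f => ↾(fun z => (z.1, push Q f z.2))
      map_id := fun b => by ext z <;> simp [push_id]
      map_comp := fun f g => by ext z <;> simp [push_comp] }
  map g := { app := fun b => ↾(fun z => (pull P g.unop z.1, z.2)) }
  map_id b := by ext b z <;> simp [pull_id]
  map_comp f g := by ext b z <;> simp [pull_comp]

/-- The class of the pair `(p, q)` in the composite of `P` and `Q`. -/
def compMk (P : Profunctor.{u} A B) (Q : Profunctor.{u} B D) {a : A} (b : B) {d : D}
    (p : El P a b) (q : El Q b d) : Limits.Types.coend.{u, u, u} (compDiagram P Q a d) :=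
  Quot.mk _ ⟨b, (p, q)⟩

lemma compMk_slide (P : Profunctor.{u} A B) (Q : Profunctor.{u} B D) {a : A} {b b' : B} {d : D}
    (f : b ⟶ b') (p : El P a b') (q : El Q b d) :
    compMk P Q b (pull P f p) q = compMk P Q b' p (push Q f q) :=
  Quot.sound (Limits.Types.coendRel.mk.{u, u, u} (F := compDiagram P Q a d) f (p, q))

/-- Functoriality of the composite in its two outer variables. -/
def compMap (P : Profunctor.{u} A B) (Q : Profunctor.{u} B D) {a a' : A} {d d' : D}
    (f : a ⟶ a') (g : d ⟶ d') :
    Limits.Types.coend.{u, u, u} (compDiagram P Q a d') → Limits.Types.coend.{u, u, u} (compDiagram P Q a' d) :=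
  Quot.lift (fun z => compMk P Q z.1 (push P f z.2.1) (pull Q g z.2.2)) (by
    rintro _ _ ⟨h, x⟩
    change compMk P Q _ (push P f (pull P h x.1)) (pull Q g x.2) =
      compMk P Q _ (push P f x.1) (pull Q g (push Q h x.2))
    rw [push_pull, compMk_slide, push_pull])

/-- Composition of profunctors `A ⇸ B ⇸ D`, in diagrammatic order:
`(d, a) ↦ ∫^b P(b, a) × Q(d, b)`. -/
def comp (P : Profunctor.{u} A B) (Q : Profunctor.{u} B D) : Profunctor.{u} A D :=
  .ofCore
    { obj := fun a d => Limits.Types.coend.{u, u, u} (compDiagram P Q a d)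
      map := fun f g => ↾(compMap P Q f g)
      map_id := fun a d => by
        ext z
        obtain ⟨b, p, q⟩ := z
        change compMk P Q b (push P (𝟙 a) p) (pull Q (𝟙 d) q) = compMk P Q b p q
        rw [push_id, pull_id]
      map_comp := fun f f' g g' => by
        ext z
        obtain ⟨b, p, q⟩ := z
        change compMk P Q b (push P (f ≫ f') p) (pull Q (g ≫ g') q) =
          compMk P Q b (push P f' (push P f p)) (pull Q g (pull Q g' q))
        rw [push_comp, pull_comp] }

/-- The element of the composite represented by `p` and `q`. -/
def rep (P : Profunctor.{u} A B) (Q : Profunctor.{u} B D) {a : A} {b : B} {d : D}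
    (p : El P a b) (q : El Q b d) : El (comp P Q) a d :=
  compMk P Q b p q

/-- The monoidal product of profunctors. -/
def tens (P : Profunctor.{u} A B) (Q : Profunctor.{u} A' B') : Profunctor.{u} (A × A') (B × B') :=
  .ofCore
    { obj := fun a b => El P a.1 b.1 × El Q a.2 b.2
      map := fun f g => ↾(fun z => (push P f.1 (pull P g.1 z.1), push Q f.2 (pull Q g.2 z.2)))
      map_id := fun a b => by ext z <;> simp [push_id, pull_id]
      map_comp := fun f f' g g' => by ext z <;> simp [push_comp, pull_comp, push_pull] }

/-- The bifunctor `(x', x) ↦ P((b, x'), (a, x))` whose coend closes the second wire of `P` to a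
loop. -/
@[simps]
def loopDiagram {X : Type u} [SmallCategory X] (P : Profunctor.{u} (A × X) (B × X)) (a : A)
    (b : B) : Xᵒᵖ ⥤ X ⥤ Type u where
  obj x' :=
    { obj := fun x => El P (a, x) (b, x'.unop)
      map := fun f => ↾(fun z => push P ((𝟙 a, f) : (a, _) ⟶ (a, _)) z)
      map_id := fun x => by ext z; exact push_id P z
      map_comp := fun f g => by
        ext z
        change push P _ z = push P _ (push P _ z)
        rw [← push_comp]
        simp }
  map g :=
    { app := fun x => ↾(fun z => pull P ((𝟙 b, g.unop) : (b, _) ⟶ (b, _)) z)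
      naturality := fun x y f => by
        ext z
        exact (push_pull P _ _ _).symm }
  map_id x := by ext y z; exact pull_id P z
  map_comp f g := by
    ext y z
    change pull P _ z = pull P _ (pull P _ z)
    rw [← pull_comp]
    simp

/-- The class of `p` in the profunctor obtained by closing the second wire of `P`. -/
def loopMk' {X : Type u} [SmallCategory X] (P : Profunctor.{u} (A × X) (B × X)) {a : A} {b : B}
    (x : X) (p : El P (a, x) (b, x)) : Limits.Types.coend.{u, u, u} (loopDiagram P a b) :=
  Quot.mk _ ⟨x, p⟩

lemma loopMk'_slide {X : Type u} [SmallCategory X] (P : Profunctor.{u} (A × X) (B × X)) {a : A}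
    {b : B} {x y : X} (f : x ⟶ y) (p : El P (a, x) (b, y)) :
    loopMk' P x (pull P ((𝟙 b, f) : (b, x) ⟶ (b, y)) p) =
      loopMk' P y (push P ((𝟙 a, f) : (a, x) ⟶ (a, y)) p) :=
  Quot.sound (Limits.Types.coendRel.mk.{u, u, u} (F := loopDiagram P a b) f p)

/-- The action of morphisms on the outer variables of `P`. -/
def loopAct {X : Type u} [SmallCategory X] (P : Profunctor.{u} (A × X) (B × X)) {a a' : A}
    {b b' : B} {x y : X} (f : a ⟶ a') (g : b ⟶ b') (p : El P (a, x) (b', y)) :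
    El P (a', x) (b, y) :=
  push P ((f, 𝟙 x) : (a, x) ⟶ (a', x)) (pull P ((g, 𝟙 y) : (b, y) ⟶ (b', y)) p)

lemma loopAct_id {X : Type u} [SmallCategory X] (P : Profunctor.{u} (A × X) (B × X)) {a : A}
    {b : B} {x y : X} (p : El P (a, x) (b, y)) : loopAct P (𝟙 a) (𝟙 b) p = p :=
  (push_id P _).trans (pull_id P p)

lemma loopAct_comp {X : Type u} [SmallCategory X] (P : Profunctor.{u} (A × X) (B × X))
    {a a' a'' : A} {b b' b'' : B} {x y : X} (f : a ⟶ a') (f' : a' ⟶ a'') (g : b ⟶ b')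
    (g' : b' ⟶ b'') (p : El P (a, x) (b'', y)) :
    loopAct P (f ≫ f') (g ≫ g') p = loopAct P f' g (loopAct P f g' p) := by
  unfold loopAct
  rw [← push_pull, ← push_comp, ← pull_comp]
  simp

lemma loopAct_slide {X : Type u} [SmallCategory X] (P : Profunctor.{u} (A × X) (B × X))
    {a a' : A} {b b' : B} {x y : X} (f : a ⟶ a') (g : b ⟶ b') (h : x ⟶ y)
    (p : El P (a, x) (b', y)) :
    loopMk' P x (loopAct P f g (pull P ((𝟙 b', h) : (b', x) ⟶ (b', y)) p)) =
      loopMk' P y (loopAct P f g (push P ((𝟙 a, h) : (a, x) ⟶ (a, y)) p)) := by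
  have e₁ : loopAct P f g (pull P ((𝟙 b', h) : (b', x) ⟶ (b', y)) p) =
      pull P ((𝟙 b, h) : (b, x) ⟶ (b, y)) (loopAct P f g p) := by
    unfold loopAct
    rw [← push_pull, ← pull_comp, ← pull_comp]
    simp
  have e₂ : loopAct P f g (push P ((𝟙 a, h) : (a, x) ⟶ (a, y)) p) =
      push P ((𝟙 a', h) : (a', x) ⟶ (a', y)) (loopAct P f g p) := by
    unfold loopAct
    rw [← push_pull, ← push_comp, ← push_comp]
    simp
  rw [e₁, e₂, loopMk'_slide]

/-- Functoriality of the closed-up profunctor. -/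
def loopMap {X : Type u} [SmallCategory X] (P : Profunctor.{u} (A × X) (B × X)) {a a' : A}
    {b b' : B} (f : a ⟶ a') (g : b ⟶ b') :
    Limits.Types.coend.{u, u, u} (loopDiagram P a b') →
      Limits.Types.coend.{u, u, u} (loopDiagram P a' b) :=
  Quot.lift (fun z => loopMk' P z.1 (loopAct P f g z.2)) (by
    rintro _ _ ⟨h, x⟩
    exact loopAct_slide P f g h x)

/-- The profunctor `A ⇸ B` obtained from `P : A × X ⇸ B × X` by joining the output `X` to the input
`X` with the cup and the cap of the compact closed structure: `(b, a) ↦ ∫^x P((b, x), (a, x))`. -/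
def loop {X : Type u} [SmallCategory X] (P : Profunctor.{u} (A × X) (B × X)) :
    Profunctor.{u} A B :=
  .ofCore
    { obj := fun a b => Limits.Types.coend.{u, u, u} (loopDiagram P a b)
      map := fun f g => ↾(loopMap P f g)
      map_id := fun a b => by
        ext z
        obtain ⟨x, p⟩ := z
        exact congrArg (loopMk' P x) (loopAct_id P p)
      map_comp := fun f f' g g' => by
        ext z
        obtain ⟨x, p⟩ := z
        exact congrArg (loopMk' P x) (loopAct_comp P f f' g g' p) }

/-- The element of `loop P` represented by `p`. -/
def loopMk {X : Type u} [SmallCategory X] (P : Profunctor.{u} (A × X) (B × X)) {a : A} {b : B}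
    {x : X} (p : El P (a, x) (b, x)) : El (loop P) a b :=
  loopMk' P x p

/-- An adjunction `P ⊣ R` in the bicategory of profunctors.  The triangle equations are written on
representatives of elements of the coends involved. -/
structure ProfAdj (P : Profunctor.{u} A B) (R : Profunctor.{u} B A) where
  unit : Profunctor.id (C := A) ⟶ comp P R
  counit : comp R P ⟶ Profunctor.id (C := B)
  left_triangle : ∀ {a : A} {b b' : B} (p : El P a b) (v : El P a b') (w : El R b' a),
    ev unit (show El (Profunctor.id (C := A)) a a from 𝟙 a) = rep P R v w →
      pull P (show b ⟶ b' from ev counit (rep R P w p)) v = p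
  right_triangle : ∀ {a : A} {b b' : B} (r : El R b a) (v : El P a b') (w : El R b' a),
    ev unit (show El (Profunctor.id (C := A)) a a from 𝟙 a) = rep P R v w →
      push R (show b' ⟶ b from ev counit (rep R P r v)) w = r

namespace ProfAdj

variable {P : Profunctor.{u} A B} {R : Profunctor.{u} B A} (h : ProfAdj P R)

/-- The value of the unit at the identity of `a` is represented by the pair `(v, w)`. -/
def UnitRep {a : A} {b : B} (v : El P a b) (w : El R b a) : Prop :=
  ev h.unit (show El (Profunctor.id (C := A)) a a from 𝟙 a) = rep P R v w

/-- The counit on representatives. -/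
def eval {a : A} {b b' : B} (k : El R b a) (p : El P a b') : b' ⟶ b :=
  ev h.counit (rep R P k p)

end ProfAdj

end Profunctors

/-! ## Interpretations in the bicategory of profunctors

An interpretation of a presentation is a choice of a small category for the generating 0-morphism,
of profunctors for the generating 1-morphisms, and of (invertible) natural transformations for the
(invertible) generating 2-morphisms, such that the equations hold.

The equations between composite 2-morphisms are written by letting the 2-morphisms act on
representatives: an element of a composite of profunctors (a string diagram) is represented by a
labelling of its wires with objects and of its tiles with elements, a 2-morphism rewrites a part of
such a labelled diagram, and two composites of rewrites agree when they lead to the same element of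
the target.  Every element of a coend has a representative, so that the clauses below, which are
quantified over all representatives, say precisely that the composite 2-morphisms are equal. -/

/-- The unit of the monoidal bicategory of profunctors. -/
abbrev One : Type u := Discrete PUnit.{u + 1}

/-- The object of the one-point category. -/
abbrev pt : One.{u} := ⟨PUnit.unit⟩

section Diagrams

variable {C : Type u} [SmallCategory C]

/-- The identity wire. -/
abbrev wire (C : Type u) [SmallCategory C] : Profunctor.{u} C C := Profunctor.id

variable (M : Profunctor.{u} (C × C) C)

/-- The diagram `(ab)c`: the composite `M ∘ (M × 1)`. -/
abbrev leftTree : Profunctor.{u} ((C × C) × C) C := comp (tens M (wire C)) M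

/-- The diagram `a(bc)`: the composite `M ∘ (1 × M)`. -/
abbrev rightTree : Profunctor.{u} (C × (C × C)) C := comp (tens (wire C) M) M

/-- The diagram `a(b(cd))`: the composite `M ∘ (1 × M) ∘ (1 × (1 × M))`. -/
abbrev rightTree₃ : Profunctor.{u} (C × (C × (C × C))) C :=
  comp (tens (wire C) (tens (wire C) M)) (rightTree M)

/-- An element of `leftTree M`, represented by labels of the two tiles. -/
def leftMk {a b c d x : C} (p : El M (a, b) x) (q : El M (x, c) d) :
    El (leftTree M) ((a, b), c) d :=
  rep (tens M (wire C)) M (b := (x, c)) (p, 𝟙 c) q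

/-- An element of `rightTree M`, represented by labels of the two tiles. -/
def rightMk {a b c d x : C} (p : El M (b, c) x) (q : El M (a, x) d) :
    El (rightTree M) (a, (b, c)) d :=
  rep (tens (wire C) M) M (b := (a, x)) (𝟙 a, p) q

/-- An element of `rightTree₃ M`, represented by labels of the three tiles. -/
def rightMk₃ {a b c d e x y : C} (p : El M (c, d) x) (q : El M (b, x) y) (r : El M (a, y) e) :
    El (rightTree₃ M) (a, (b, (c, d))) e :=
  rep (tens (wire C) (tens (wire C) M)) (rightTree M) (b := (a, (b, x))) (𝟙 a, (𝟙 b, p))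
    (rightMk M q r)

end Diagrams

/-- The generators of the pseudomonoid presentation, interpreted in the bicategory of profunctors. -/
structure PseudomonoidData (C : Type u) [SmallCategory C] where
  /-- The multiplication. -/
  mul : Profunctor.{u} (C × C) C
  /-- The unit. -/
  one : Profunctor.{u} One.{u} C
  /-- The associator. -/
  assoc : leftTree mul ≅
    (rightTree mul).whiskerLeft₂ (CategoryTheory.prod.associator C C C) (𝟭 C)
  /-- The left unitor. -/
  leftUnit : comp (tens one (wire C)) mul ≅ (CategoryTheory.Prod.snd One.{u} C).toProfunctor
  /-- The right unitor. -/
  rightUnit : comp (tens (wire C) one) mul ≅ (CategoryTheory.Prod.fst C One.{u}).toProfunctor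

namespace PseudomonoidData

variable {C : Type u} [SmallCategory C] (I : PseudomonoidData C)

/-- The associator rewrites the labelled tiles `(p, q)` of `(ab)c` to `(p', q')` of `a(bc)`. -/
def Assoc {a b c d x y : C} (p : El I.mul (a, b) x) (q : El I.mul (x, c) d)
    (p' : El I.mul (b, c) y) (q' : El I.mul (a, y) d) : Prop :=
  ev I.assoc.hom (a := ((a, b), c)) (leftMk I.mul p q) = rightMk I.mul p' q'

/-- The left unitor on representatives. -/
def lunit {a c x : C} (j : El I.one pt x) (p : El I.mul (x, a) c) : c ⟶ a :=
  ev I.leftUnit.hom (a := (pt, a)) (rep (tens I.one (wire C)) I.mul (b := (x, a)) (j, 𝟙 a) p)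

/-- The right unitor on representatives. -/
def runit {a c x : C} (j : El I.one pt x) (p : El I.mul (a, x) c) : c ⟶ a :=
  ev I.rightUnit.hom (a := (a, pt)) (rep (tens (wire C) I.one) I.mul (b := (a, x)) (𝟙 a, j) p)

/-- Action of a morphism on the first input of the multiplication. -/
def pushFst {a a' b c : C} (f : a ⟶ a') (p : El I.mul (a, b) c) : El I.mul (a', b) c :=
  push I.mul ((f, 𝟙 b) : (a, b) ⟶ (a', b)) p

/-- Action of a morphism on the second input of the multiplication. -/
def pushSnd {a b b' c : C} (f : b ⟶ b') (p : El I.mul (a, b) c) : El I.mul (a, b') c :=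
  push I.mul ((𝟙 a, f) : (a, b) ⟶ (a, b')) p

end PseudomonoidData

/-- Interpretations of the pseudomonoid presentation. -/
structure Pseudomonoid (C : Type u) [SmallCategory C] extends PseudomonoidData C where
  /-- The paths `((ab)c)d → (a(bc))d → a((bc)d) → a(b(cd))` (first three rewrites) and
  `((ab)c)d → (ab)(cd) → a(b(cd))` (last two rewrites) agree. -/
  pentagon : ∀ {a b c d e x y u₁ u₂ u₃ w w' : C}
    (p : El mul (a, b) x) (q : El mul (x, c) y) (r : El mul (y, d) e)
    (p₁ : El mul (b, c) u₁) (q₁ : El mul (a, u₁) y)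
    (r₁ : El mul (u₁, d) u₂) (q₂ : El mul (a, u₂) e)
    (p₂ : El mul (c, d) w) (r₂ : El mul (b, w) u₂)
    (r₃ : El mul (c, d) w') (q₃ : El mul (x, w') e)
    (p₄ : El mul (b, w') u₃) (q₄ : El mul (a, u₃) e),
    toPseudomonoidData.Assoc p q p₁ q₁ →
    toPseudomonoidData.Assoc q₁ r r₁ q₂ →
    toPseudomonoidData.Assoc p₁ r₁ p₂ r₂ →
    toPseudomonoidData.Assoc q r r₃ q₃ →
    toPseudomonoidData.Assoc p q₃ p₄ q₄ →
    rightMk₃ mul p₂ r₂ q₂ = rightMk₃ mul r₃ p₄ q₄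
  /-- The path `(a1)b → a(1b) → ab` agrees with the path `(a1)b → ab`. -/
  triangle : ∀ {a b c x y v : C} (j : El one pt x)
    (p : El mul (a, x) y) (q : El mul (y, b) c) (p' : El mul (x, b) v) (q' : El mul (a, v) c),
    toPseudomonoidData.Assoc p q p' q' →
    toPseudomonoidData.pushSnd (toPseudomonoidData.lunit j p') q' =
      toPseudomonoidData.pushFst (toPseudomonoidData.runit j p) q

/-- Interpretations of the right-adjoint pseudomonoid presentation: both generating 1-morphisms are
given right adjoints. -/
structure RAPseudomonoid (C : Type u) [SmallCategory C] extends Pseudomonoid C where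
  /-- The right adjoint of the multiplication. -/
  mulR : Profunctor.{u} C (C × C)
  /-- The right adjoint of the unit. -/
  oneR : Profunctor.{u} C One.{u}
  mulAdj : ProfAdj mul mulR
  oneAdj : ProfAdj one oneR

/-- A braiding acting on elements. -/
def swapEv {C : Type u} [SmallCategory C] {M : Profunctor.{u} (C × C) C}
    (σ : M ≅ M.whiskerLeft₂ (CategoryTheory.Prod.swap C C) (𝟭 C)) {a b c : C}
    (p : El M (a, b) c) : El M (b, a) c :=
  ev σ.hom p

/-- The inverse of a braiding acting on elements. -/
def swapInvEv {C : Type u} [SmallCategory C] {M : Profunctor.{u} (C × C) C}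
    (σ : M ≅ M.whiskerLeft₂ (CategoryTheory.Prod.swap C C) (𝟭 C)) {a b c : C}
    (p : El M (b, a) c) : El M (a, b) c :=
  ev σ.inv (a := (a, b)) p

/-- A 2-endomorphism of the identity wire acting on elements, which are morphisms. -/
def wireEv {C : Type u} [SmallCategory C] (t : wire C ⟶ wire C) {a b : C} (f : a ⟶ b) : a ⟶ b :=
  ev t (show El (wire C) b a from f)

/-- Interpretations of the right-adjoint braided pseudomonoid presentation. -/
structure BraidedRAPseudomonoid (C : Type u) [SmallCategory C] extends RAPseudomonoid C where
  /-- The braiding. -/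
  braid : mul ≅ mul.whiskerLeft₂ (CategoryTheory.Prod.swap C C) (𝟭 C)
  /-- The paths `(ab)c → a(bc) → (bc)a → b(ca)` and `(ab)c → (ba)c → b(ac) → b(ca)` agree. -/
  hexagon_forward : ∀ {a b c d x y z v : C}
    (p : El mul (a, b) x) (q : El mul (x, c) d)
    (p₁ : El mul (b, c) y) (q₁ : El mul (a, y) d)
    (p₂ : El mul (c, a) z) (q₂ : El mul (b, z) d)
    (p₃ : El mul (a, c) v) (q₃ : El mul (b, v) d),
    toPseudomonoidData.Assoc p q p₁ q₁ →
    toPseudomonoidData.Assoc p₁ (swapEv braid q₁) p₂ q₂ →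
    toPseudomonoidData.Assoc (swapEv braid p) q p₃ q₃ →
    rightMk mul p₂ q₂ = rightMk mul (swapEv braid p₃) q₃
  /-- The paths `a(bc) → (ab)c → c(ab) → (ca)b` and `a(bc) → a(cb) → (ac)b → (ca)b` agree. -/
  hexagon_reverse : ∀ {a b c d x y z v : C}
    (p : El mul (b, c) x) (q : El mul (a, x) d)
    (p₁ : El mul (a, b) y) (q₁ : El mul (y, c) d)
    (p₂ : El mul (c, a) z) (q₂ : El mul (z, b) d)
    (p₃ : El mul (a, c) v) (q₃ : El mul (v, b) d),
    toPseudomonoidData.Assoc p₁ q₁ p q →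
    toPseudomonoidData.Assoc p₂ q₂ p₁ (swapEv braid q₁) →
    toPseudomonoidData.Assoc p₃ q₃ (swapEv braid p) q →
    leftMk mul p₂ q₂ = leftMk mul (swapEv braid p₃) q₃

/-- Interpretations of the right-adjoint balanced pseudomonoid presentation. -/
structure BalancedRAPseudomonoid (C : Type u) [SmallCategory C] extends
    BraidedRAPseudomonoid C where
  /-- The twist, an invertible 2-endomorphism of the identity wire. -/
  twist : wire C ≅ wire C
  /-- The twist on the output of the multiplication is the double braiding together with the twists
  on both inputs. -/
  twist_mul : ∀ {a b c : C} (p : El mul (a, b) c),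
    pull mul (wireEv twist.hom (𝟙 c)) p =
      swapEv braid (swapEv braid
        (toPseudomonoidData.pushFst (wireEv twist.hom (𝟙 a))
          (toPseudomonoidData.pushSnd (wireEv twist.hom (𝟙 b)) p)))
  /-- The twist on the unit is trivial. -/
  twist_one : ∀ {x : C} (j : El one pt x), pull one (wireEv twist.hom (𝟙 x)) j = j

namespace RAPseudomonoid

variable {C : Type u} [SmallCategory C] (I : RAPseudomonoid C)

/-- The source of the trace: the multiplication followed by its right adjoint, with the second
input and the second output joined to a loop. -/
abbrev ring : Profunctor.{u} C C := loop (comp I.mul I.mulR)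

/-- A 2-morphism from `ring` to the identity wire, acting on the element of `ring` represented by
labels of the two tiles. -/
def ringEv (t : I.ring ⟶ wire C) {a b c x : C} (p : El I.mul (b, x) c)
    (k : El I.mulR c (a, x)) : a ⟶ b :=
  ev t (loopMk (comp I.mul I.mulR) (rep I.mul I.mulR p k))

end RAPseudomonoid

/-- Interpretations of the balanced version of the traced pseudomonoid presentation. -/
structure BalancedTracePseudomonoid (C : Type u) [SmallCategory C] extends
    BalancedRAPseudomonoid C where
  /-- The trace. -/
  trace : toRAPseudomonoid.ring ⟶ wire C
  /-- Vanishing for the unit: when the loop of `ring` is cut open and its ends are closed with the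
  unit and the right adjoint of the unit, one may either join the two ends by the counit and apply
  the trace, or apply the right unitor and its mate. -/
  vanishing_unit : ∀ {a b c x y v : C} (j : El one pt x) (p : El mul (b, x) c)
    (k : El mulR c (a, y)) (j' : El oneR y pt) (j₀ : El one pt v) (p₀ : El mul (a, v) a),
    toPseudomonoidData.runit j₀ p₀ = 𝟙 a →
    toRAPseudomonoid.ringEv trace p
      (pull mulR (show (a, x) ⟶ (a, y) from (𝟙 a, oneAdj.eval j' j)) k) =
      mulAdj.eval k (toPseudomonoidData.pushSnd (oneAdj.eval j' j₀) p₀) ≫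
        toPseudomonoidData.runit j p
  /-- Vanishing for the multiplication: for two nested loops, one may either apply the trace twice,
  or apply the associator and its mate, contract the inner bubble by the counit, and apply the trace
  once. -/
  vanishing_mul : ∀ {a b c x y z w v e s : C}
    (p : El mul (b, x) z) (q : El mul (z, y) c) (k : El mulR c (w, y)) (l : El mulR w (a, x))
    (q' : El mul (x, y) v) (p' : El mul (b, v) c)
    (g : El mul (a, v) e) (h : El mulR e (a, v)) (g₁ : El mul (a, x) s) (g₂ : El mul (s, y) e),
    toPseudomonoidData.Assoc p q q' p' →
    mulAdj.UnitRep g h →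
    toPseudomonoidData.Assoc g₁ g₂ q' g →
    toRAPseudomonoid.ringEv trace (pull mul (toRAPseudomonoid.ringEv trace q k) p) l =
      toRAPseudomonoid.ringEv trace p'
        (push mulR (mulAdj.eval k (toPseudomonoidData.pushFst (mulAdj.eval l g₁) g₂)) h)
  /-- Superposing: for a multiplication whose second input carries `ring`, one may either apply the
  trace there, or move `ring` to the output by the associator and its mate, and apply the trace
  there. -/
  superposing : ∀ {a b c d x y z v e : C}
    (m : El mul (a, y) d) (p : El mul (b, x) c) (k : El mulR c (y, x))
    (g : El mul (d, x) e) (h : El mulR e (d, x))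
    (g₁ : El mul (y, x) v) (m₁ : El mul (a, v) e)
    (m₂ : El mul (a, b) z) (g₂ : El mul (z, x) e),
    mulAdj.UnitRep g h →
    toPseudomonoidData.Assoc m g g₁ m₁ →
    toPseudomonoidData.Assoc m₂ g₂ p (toPseudomonoidData.pushSnd (mulAdj.eval k g₁) m₁) →
    pull mul (toRAPseudomonoid.ringEv trace g₂ h) m₂ =
      toPseudomonoidData.pushSnd (toRAPseudomonoid.ringEv trace p k) m

namespace BalancedTracePseudomonoid

variable {C : Type u} [SmallCategory C] (I : BalancedTracePseudomonoid C)

/-- The trace on representatives. -/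
def tr {a b c x : C} (p : El I.mul (b, x) c) (k : El I.mulR c (a, x)) : a ⟶ b :=
  I.ringEv I.trace p k

/-- The identity wire is bent to a zigzag, the unit of the adjunction creates a multiplication and
its right adjoint, the braiding is applied, and then the trace: the result is the twist. -/
def YankingPos : Prop :=
  ∀ {a b c : C} (f : a ⟶ b) (p : El I.mul (b, b) c) (k : El I.mulR c (a, b)),
    ev I.mulAdj.unit (show El (Profunctor.id (C := C × C)) (b, b) (a, b) from (f, 𝟙 b)) =
      rep I.mul I.mulR p k →
    I.tr (swapEv I.braid p) k = wireEv I.twist.hom f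

/-- The same with the inverse braiding and the inverse twist. -/
def YankingNeg : Prop :=
  ∀ {a b c : C} (f : a ⟶ b) (p : El I.mul (b, b) c) (k : El I.mulR c (a, b)),
    ev I.mulAdj.unit (show El (Profunctor.id (C := C × C)) (b, b) (a, b) from (f, 𝟙 b)) =
      rep I.mul I.mulR p k →
    I.tr (swapInvEv I.braid p) k = wireEv I.twist.inv f

end BalancedTracePseudomonoid

/-- Interpretations of the balanced traced pseudomonoid presentation: the balanced version of the
traced pseudomonoid presentation, and the yanking equation (for the braiding and its inverse). -/
structure BalancedTracedPseudomonoid (C : Type u) [SmallCategory C] extends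
    BalancedTracePseudomonoid C where
  yanking_pos : toBalancedTracePseudomonoid.YankingPos
  yanking_neg : toBalancedTracePseudomonoid.YankingNeg

/-- Isomorphisms of interpretations with the same underlying category: invertible 2-morphisms
between the generating 1-morphisms that are compatible with all generating 2-morphisms.
(Compatibility with the units of the adjunctions follows from that with the counits.) -/
structure InterpIso {C : Type u} [SmallCategory C] (I I' : BalancedTracePseudomonoid C) where
  mul : I.mul ≅ I'.mul
  one : I.one ≅ I'.one
  mulR : I.mulR ≅ I'.mulR
  oneR : I.oneR ≅ I'.oneR
  mul_counit : ∀ {a b c d : C} (k : El I.mulR c (a, b)) (p : El I.mul (a, b) d),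
    I'.mulAdj.eval (ev mulR.hom k) (ev mul.hom p) = I.mulAdj.eval k p
  one_counit : ∀ {x y : C} (j' : El I.oneR y pt) (j : El I.one pt x),
    I'.oneAdj.eval (ev oneR.hom j') (ev one.hom j) = I.oneAdj.eval j' j
  assoc : ∀ {a b c d x y : C} (p : El I.mul (a, b) x) (q : El I.mul (x, c) d)
    (p' : El I.mul (b, c) y) (q' : El I.mul (a, y) d), I.Assoc p q p' q' →
    I'.Assoc (ev mul.hom p) (ev mul.hom q) (ev mul.hom p') (ev mul.hom q')
  leftUnit : ∀ {a c x : C} (j : El I.one pt x) (p : El I.mul (x, a) c),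
    I'.lunit (ev one.hom j) (ev mul.hom p) = I.lunit j p
  rightUnit : ∀ {a c x : C} (j : El I.one pt x) (p : El I.mul (a, x) c),
    I'.runit (ev one.hom j) (ev mul.hom p) = I.runit j p
  braid : ∀ {a b c : C} (p : El I.mul (a, b) c),
    swapEv I'.braid (ev mul.hom p) = ev mul.hom (swapEv I.braid p)
  twist : I'.twist = I.twist
  trace : ∀ {a b c x : C} (p : El I.mul (b, x) c) (k : El I.mulR c (a, x)),
    I'.tr (ev mul.hom p) (ev mulR.hom k) = I.tr p k

/-! ## Balanced traced monoidal categories -/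

/-- A twist on a braided monoidal category. -/
class BalancedCategory (D : Type u) [SmallCategory D] [MonoidalCategory D]
    [BraidedCategory D] where
  twist : ∀ X : D, X ≅ X
  twist_naturality : ∀ {X Y : D} (f : X ⟶ Y), f ≫ (twist Y).hom = (twist X).hom ≫ f
  twist_unit : (twist (𝟙_ D)).hom = 𝟙 (𝟙_ D)
  twist_tensor : ∀ X Y : D, (twist (X ⊗ Y)).hom =
    ((twist X).hom ⊗ₘ (twist Y).hom) ≫ (β_ X Y).hom ≫ (β_ Y X).hom

/-- A (right) trace on a monoidal category. -/
class RightTrace (D : Type u) [SmallCategory D] [MonoidalCategory D] where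
  tr : ∀ {A B : D} (X : D), (A ⊗ X ⟶ B ⊗ X) → (A ⟶ B)
  tightening : ∀ {A A' B B' X : D} (g : A' ⟶ A) (f : A ⊗ X ⟶ B ⊗ X) (h : B ⟶ B'),
    tr X (g ▷ X ≫ f ≫ h ▷ X) = g ≫ tr X f ≫ h
  sliding : ∀ {A B X Y : D} (f : A ⊗ X ⟶ B ⊗ Y) (g : Y ⟶ X),
    tr X (f ≫ B ◁ g) = tr Y (A ◁ g ≫ f)
  vanishing_unit : ∀ {A B : D} (f : A ⊗ 𝟙_ D ⟶ B ⊗ 𝟙_ D),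
    tr (𝟙_ D) f = (ρ_ A).inv ≫ f ≫ (ρ_ B).hom
  vanishing_tensor : ∀ {A B X Y : D} (f : A ⊗ (X ⊗ Y) ⟶ B ⊗ (X ⊗ Y)),
    tr (X ⊗ Y) f = tr X (tr Y ((α_ A X Y).hom ≫ f ≫ (α_ B X Y).inv))
  superposing : ∀ {A B X : D} (W : D) (f : A ⊗ X ⟶ B ⊗ X),
    tr X ((α_ W A X).hom ≫ W ◁ f ≫ (α_ W B X).inv) = W ◁ tr X f

/-- The structure on a category `D` of a balanced monoidal category with a right trace. -/
structure BalancedTraceStruct (D : Type u) [SmallCategory D] where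
  monoidal : MonoidalCategory D
  braided : BraidedCategory D
  balanced : BalancedCategory D
  traced : RightTrace D

namespace BalancedTraceStruct

variable {D : Type u} [SmallCategory D] (S : BalancedTraceStruct D)

/-- The category `D`, as a type that remembers the structure `S` on it. -/
def On (_ : BalancedTraceStruct D) : Type u := D

instance : SmallCategory S.On := inferInstanceAs (SmallCategory D)
instance : MonoidalCategory S.On := S.monoidal
instance : BraidedCategory S.On := S.braided
instance : BalancedCategory S.On := S.balanced
instance : RightTrace S.On := S.traced

/-- The identity functor between two structures on the same category. -/
def idFunctor (S S' : BalancedTraceStruct D) : S.On ⥤ S'.On := 𝟭 D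

/-- A functor to `D`, seen as a functor to the category that carries the structure. -/
def lift {C : Type u} [SmallCategory C] (F : C ⥤ D) : C ⥤ S.On := F

/-- The yanking axiom for the braiding. -/
def YankingPos : Prop :=
  ∀ X : S.On, RightTrace.tr X (β_ X X).hom = (BalancedCategory.twist X).hom

/-- The yanking axiom for the inverse braiding. -/
def YankingNeg : Prop :=
  ∀ X : S.On, RightTrace.tr X (β_ X X).inv = (BalancedCategory.twist X).inv

/-- The twist is trivial. -/
def TrivialTwist : Prop :=
  ∀ X : S.On, BalancedCategory.twist X = Iso.refl X

end BalancedTraceStruct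

/-- The structure on a category `D` of a balanced traced monoidal category. -/
structure BalancedTraced (D : Type u) [SmallCategory D] extends BalancedTraceStruct D where
  yanking_pos : toBalancedTraceStruct.YankingPos
  yanking_neg : toBalancedTraceStruct.YankingNeg

/-- The structure on a category `D` of a symmetric traced monoidal category. -/
structure SymmetricTraced (D : Type u) [SmallCategory D] where
  monoidal : MonoidalCategory D
  symmetric : SymmetricCategory D
  traced : RightTrace D
  yanking : ∀ X : D, RightTrace.tr X (β_ X X).hom = 𝟙 X

/-- A symmetric traced monoidal category, with the trivial twist. -/
def SymmetricTraced.toBalancedTraced {D : Type u} [SmallCategory D] (T : SymmetricTraced D) :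
    BalancedTraced D :=
  letI := T.monoidal
  letI := T.symmetric
  { monoidal := T.monoidal
    braided := T.symmetric.toBraidedCategory
    balanced :=
      { twist := fun X => Iso.refl X
        twist_naturality := by intros; simp
        twist_unit := rfl
        twist_tensor := by intros; simp }
    traced := T.traced
    yanking_pos := T.yanking
    yanking_neg := fun X => by
      have h := T.yanking X
      have e : (β_ X X).inv = (β_ X X).hom := by
        rw [← cancel_epi (β_ X X).hom, Iso.hom_inv_id]
        exact (SymmetricCategory.symmetry (C := D) X X).symm
      exact (congrArg (fun t => RightTrace.tr X t) e).trans h }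

/-- Isomorphisms of structures on the same category `D`: a braided strong monoidal structure on the
identity functor that preserves the twist and the trace. -/
structure BalancedTraceIso {D : Type u} [SmallCategory D] (S S' : BalancedTraceStruct D) where
  braided : (S.idFunctor S').Braided
  twist : ∀ X : S.On, (S.idFunctor S').map (BalancedCategory.twist X).hom =
    (BalancedCategory.twist ((S.idFunctor S').obj X)).hom
  trace : ∀ {A B : S.On} (X : S.On) (f : A ⊗ X ⟶ B ⊗ X),
    (S.idFunctor S').map (RightTrace.tr X f) =
      RightTrace.tr ((S.idFunctor S').obj X)
        (Functor.LaxMonoidal.μ (S.idFunctor S') A X ≫ (S.idFunctor S').map f ≫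
          Functor.OplaxMonoidal.δ (S.idFunctor S') B X)

/-! ## The correspondence -/

section

variable {C D : Type u} [SmallCategory C] [SmallCategory D] {F : C ⥤ D}
  {S : BalancedTraceStruct D} {I : BalancedTracePseudomonoid C}

/-- The morphism `Fc ⟶ Fa ⊗ Fb` that corresponds to an element of the multiplication. -/
def onMul (t : I.mul ≅
      (tensor S.On).toProfunctor.whiskerLeft₂ ((S.lift F).prod (S.lift F)) (S.lift F))
    {a b c : C} (p : El I.mul (a, b) c) :
    (S.lift F).obj c ⟶ (S.lift F).obj a ⊗ (S.lift F).obj b :=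
  ev t.hom p

/-- The morphism `Fx ⟶ 𝟙` that corresponds to an element of the unit. -/
def onOne (t : I.one ≅
      (Functor.fromPUnit (𝟙_ S.On)).toProfunctor.whiskerLeft₂ (𝟭 _) (S.lift F))
    {x : C} (j : El I.one pt x) : (S.lift F).obj x ⟶ 𝟙_ S.On :=
  ev t.hom j

/-- The morphism `Fa ⊗ Fb ⟶ Fc` that corresponds to an element of the right adjoint of the
multiplication. -/
def onMulR (t : I.mulR ≅
      (tensor S.On).toProfunctorRev.whiskerLeft₂ (S.lift F) ((S.lift F).prod (S.lift F)))
    {a b c : C} (k : El I.mulR c (a, b)) :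
    (S.lift F).obj a ⊗ (S.lift F).obj b ⟶ (S.lift F).obj c :=
  ev t.hom k

/-- The morphism `𝟙 ⟶ Fx` that corresponds to an element of the right adjoint of the unit. -/
def onOneR (t : I.oneR ≅
      (Functor.fromPUnit (𝟙_ S.On)).toProfunctorRev.whiskerLeft₂ (S.lift F) (𝟭 _))
    {x : C} (j : El I.oneR x pt) : 𝟙_ S.On ⟶ (S.lift F).obj x :=
  ev t.hom j

end

/-- `Realizes F S I`: the interpretation `I` on `C` is the restriction, along `F : C ⥤ D`, of the
interpretation given by the balanced monoidal category with trace `S` on `D`.  The generating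
1-morphisms are identified with the representations of the tensor product and of the unit object,
their right adjoints with the corepresentations, and the generating 2-morphisms with the structure
morphisms and with the trace of `S`. -/
structure Realizes {C D : Type u} [SmallCategory C] [SmallCategory D] (F : C ⥤ D)
    (S : BalancedTraceStruct D) (I : BalancedTracePseudomonoid C) where
  mul : I.mul ≅ (tensor S.On).toProfunctor.whiskerLeft₂ ((S.lift F).prod (S.lift F)) (S.lift F)
  one : I.one ≅ (Functor.fromPUnit (𝟙_ S.On)).toProfunctor.whiskerLeft₂ (𝟭 _) (S.lift F)
  mulR : I.mulR ≅
    (tensor S.On).toProfunctorRev.whiskerLeft₂ (S.lift F) ((S.lift F).prod (S.lift F))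
  oneR : I.oneR ≅ (Functor.fromPUnit (𝟙_ S.On)).toProfunctorRev.whiskerLeft₂ (S.lift F) (𝟭 _)
  mul_counit : ∀ {a b c d : C} (k : El I.mulR c (a, b)) (p : El I.mul (a, b) d),
    (S.lift F).map (I.mulAdj.eval k p) = onMul mul p ≫ onMulR mulR k
  one_counit : ∀ {x y : C} (j' : El I.oneR y pt) (j : El I.one pt x),
    (S.lift F).map (I.oneAdj.eval j' j) = onOne one j ≫ onOneR oneR j'
  assoc : ∀ {a b c d x y : C} (p : El I.mul (a, b) x) (q : El I.mul (x, c) d)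
    (p' : El I.mul (b, c) y) (q' : El I.mul (a, y) d), I.Assoc p q p' q' →
    onMul mul q ≫ onMul mul p ▷ (S.lift F).obj c ≫ (α_ _ _ _).hom =
      onMul mul q' ≫ (S.lift F).obj a ◁ onMul mul p'
  leftUnit : ∀ {a c x : C} (j : El I.one pt x) (p : El I.mul (x, a) c),
    (S.lift F).map (I.lunit j p) = onMul mul p ≫ onOne one j ▷ (S.lift F).obj a ≫ (λ_ _).hom
  rightUnit : ∀ {a c x : C} (j : El I.one pt x) (p : El I.mul (a, x) c),
    (S.lift F).map (I.runit j p) = onMul mul p ≫ (S.lift F).obj a ◁ onOne one j ≫ (ρ_ _).hom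
  braid : ∀ {a b c : C} (p : El I.mul (a, b) c),
    onMul mul (swapEv I.braid p) = onMul mul p ≫ (β_ _ _).hom
  twist : ∀ a : C, (S.lift F).map (wireEv I.twist.hom (𝟙 a)) =
    (BalancedCategory.twist ((S.lift F).obj a)).hom
  trace : ∀ {a b c x : C} (p : El I.mul (b, x) c) (k : El I.mulR c (a, x)),
    (S.lift F).map (I.tr p k) =
      RightTrace.tr ((S.lift F).obj x) (onMulR mulR k ≫ onMul mul p)

/-- An isomorphism of interpretations and an isomorphism of structures that correspond to each
other. -/
structure Intertwines {C D : Type u} [SmallCategory C] [SmallCategory D] {F : C ⥤ D}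
    {S S' : BalancedTraceStruct D} {I I' : BalancedTracePseudomonoid C}
    (r : Realizes F S I) (r' : Realizes F S' I') (g : InterpIso I I')
    (e : BalancedTraceIso S S') : Prop where
  mul : ∀ {a b c : C} (p : El I.mul (a, b) c),
    letI := e.braided
    onMul r'.mul (ev g.mul.hom p) =
      (S.idFunctor S').map (onMul r.mul p) ≫ Functor.OplaxMonoidal.δ (S.idFunctor S') _ _
  one : ∀ {x : C} (j : El I.one pt x),
    letI := e.braided
    onOne r'.one (ev g.one.hom j) =
      (S.idFunctor S').map (onOne r.one j) ≫ Functor.OplaxMonoidal.η (S.idFunctor S')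

/-- The functor `F : C ⥤ D` exhibits `D` as the Cauchy completion of `C`: all idempotents of `D`
split, `F` is fully faithful, and every object of `D` is a retract of a value of `F`.  If `C` is
Cauchy complete, then the identity functor of `C` is an example. -/
structure IsCauchyCompletion {C D : Type u} [SmallCategory C] [SmallCategory D] (F : C ⥤ D) :
    Prop where
  cauchyComplete : IsIdempotentComplete D
  full : F.Full
  faithful : F.Faithful
  retract : ∀ Y : D, ∃ X : C, Nonempty (Retract Y (F.obj X))

end TracedProf

/-! The theorem rests on one fact: a profunctor `A ⇸ C` with a right adjoint is the same thing as a
functor from `A` to the Cauchy completion of `C`. The value of the unit at `1_a` is represented by a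
pair `(v, w)`. The triangle equations then exhibit the presheaf `P(-, a)` as a retract of a
representable one, and splitting the corresponding idempotent in `D` gives a representing object
(`exists_rep_of_adj`). The right adjoint is forced to be the corepresentation by the same functor
(`exists_rep_right`). For `M` and `J` this yields a unit object of `D` and, after extension from `C
× C` to `D × D`, a tensor product.

The rest translates 2-morphisms. Since every object of `D` is a retract of some `Fc`, the co-Yoneda
lemma collapses composites of represented profunctors (`repComp`): a labelled tree becomes a single
morphism from some `Fd` into an iterated tensor product, and two labellings are the same element
exactly when these morphisms agree. Isomorphisms of represented profunctors are natural isomorphisms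
of the representing functors (`liftIso`). Isomorphisms of functors of several variables extend from
values of `F`, and equations between natural transformations can be tested there (`extIso`,
`nat_ext_dense`). Hence associator, unitors, braiding, twist and their axioms pass in both
directions.

For the trace, the coend over `c` turns `M` followed by `M^R` into `D(Fa ⊗ Fx, Fb ⊗ Fx)`. A
2-morphism out of the remaining coend over `x` is a family of maps to `C(a, b)` that is natural in
`a` and `b`, which is tightening, and dinatural in `x`, which is sliding. Counits of adjunctions
become composites in `D` and representatives of units become factorizations of identities, so the
vanishing and superposing equations become the usual ones (`Realization.vanishing_mul`,
`Realization.superposing`). Conversely, the trace is extended to `D` by conjugation with retracts,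
and tightening and sliding carry each axiom from values of `F` to all objects
(`Realization.exists_trace`). The traced braiding is natural in its object, so yanking too is
decided on values of `F` (`Realizes.yanking_iff`).

An isomorphism between the multiplications of two interpretations is, by the same Yoneda argument,
an isomorphism of tensor products, and likewise for the units. Compatibility with the generators
says that these make the identity functor braided strong monoidal and compatible with twist and
trace. The components on the right adjoints are determined by the counits. To keep two structures on
one category apart, the comparison is made for a fully faithful functor `J` between two monoidal
categories. Finally, when the twist is trivial, its formula on tensor products says that the double
braiding is the identity, which is symmetry. -/

namespace TracedProf

/-! ### Calculus of elements of profunctors, composites and loops -/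

section Elements

variable {A B E : Type u} [SmallCategory A] [SmallCategory B] [SmallCategory E]
  {P Q : Profunctor.{u} A B}

lemma ev_push (t : P ⟶ Q) {a a' : A} {b : B} (f : a ⟶ a') (p : El P a b) :
    ev t (push P f p) = push Q f (ev t p) := by
  have h := congrArg (fun s => s.app (op b)) (t.naturality f)
  exact ConcreteCategory.congr_hom h p

lemma ev_pull (t : P ⟶ Q) {a : A} {b b' : B} (g : b' ⟶ b) (p : El P a b) :
    ev t (pull P g p) = pull Q g (ev t p) :=
  ConcreteCategory.congr_hom ((t.app a).naturality g.op) p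

/-- A 2-morphism from its action on elements. -/
def homMk (f : ∀ {a : A} {b : B}, El P a b → El Q a b)
    (hpush : ∀ {a a' : A} {b : B} (g : a ⟶ a') (p : El P a b), f (push P g p) = push Q g (f p))
    (hpull : ∀ {a : A} {b b' : B} (g : b' ⟶ b) (p : El P a b), f (pull P g p) = pull Q g (f p)) :
    P ⟶ Q where
  app a :=
    { app := fun b => ↾(fun p => f (b := b.unop) p)
      naturality := fun b b' g => by
        ext p
        exact hpull g.unop p }
  naturality a a' g := by
    ext b p
    exact hpush (b := b.unop) g p

lemma hom_ext_ev {s t : P ⟶ Q} (h : ∀ {a : A} {b : B} (p : El P a b), ev s p = ev t p) :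
    s = t := by
  ext a b p
  exact h (b := b.unop) p

lemma iso_ext_ev {s t : P ≅ Q} (h : ∀ {a : A} {b : B} (p : El P a b), ev s.hom p = ev t.hom p) :
    s = t :=
  Iso.ext (hom_ext_ev h)

lemma ev_inv_hom (t : P ≅ Q) {a : A} {b : B} (p : El P a b) : ev t.inv (ev t.hom p) = p :=
  ConcreteCategory.congr_hom
    (congrArg (fun s : P ⟶ P => (s.app a).app (op b)) t.hom_inv_id) p

lemma ev_hom_inv (t : P ≅ Q) {a : A} {b : B} (p : El Q a b) : ev t.hom (ev t.inv p) = p :=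
  ConcreteCategory.congr_hom
    (congrArg (fun s : Q ⟶ Q => (s.app a).app (op b)) t.inv_hom_id) p

lemma ev_hom_bijective (t : P ≅ Q) {a : A} {b : B} :
    Function.Bijective (fun p : El P a b => ev t.hom p) :=
  Function.bijective_iff_has_inverse.2 ⟨fun p => ev t.inv p, ev_inv_hom t, ev_hom_inv t⟩

/-- An invertible 2-morphism from a natural bijection of elements. -/
noncomputable def isoMk (f : ∀ {a : A} {b : B}, El P a b → El Q a b)
    (hf : ∀ (a : A) (b : B), Function.Bijective (f (a := a) (b := b)))
    (hpush : ∀ {a a' : A} {b : B} (g : a ⟶ a') (p : El P a b), f (push P g p) = push Q g (f p))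
    (hpull : ∀ {a : A} {b b' : B} (g : b' ⟶ b) (p : El P a b), f (pull P g p) = pull Q g (f p)) :
    P ≅ Q where
  hom := homMk f hpush hpull
  inv := homMk (fun {a b} q => (Equiv.ofBijective _ (hf a b)).symm q)
    (fun {a a' b} g q => by
      rw [Equiv.symm_apply_eq]
      exact (congrArg (push Q g)
        (Equiv.ofBijective_apply_symm_apply _ (hf a b) q)).symm.trans (hpush g _).symm)
    (fun {a b b'} g q => by
      rw [Equiv.symm_apply_eq]
      exact (congrArg (pull Q g)
        (Equiv.ofBijective_apply_symm_apply _ (hf a b) q)).symm.trans (hpull g _).symm)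
  hom_inv_id := hom_ext_ev fun {a b} p => (Equiv.ofBijective _ (hf a b)).symm_apply_apply p
  inv_hom_id := hom_ext_ev fun {a b} p => (Equiv.ofBijective _ (hf a b)).apply_symm_apply p

lemma rep_surjective (P : Profunctor.{u} A B) (Q : Profunctor.{u} B E) {a : A} {d : E}
    (z : El (comp P Q) a d) : ∃ (b : B) (p : El P a b) (q : El Q b d), z = rep P Q p q := by
  obtain ⟨b, p, q⟩ := z
  exact ⟨b, p, q, rfl⟩

lemma rep_slide (P : Profunctor.{u} A B) (Q : Profunctor.{u} B E) {a : A} {b b' : B} {d : E}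
    (f : b ⟶ b') (p : El P a b') (q : El Q b d) :
    rep P Q (pull P f p) q = rep P Q p (push Q f q) :=
  compMk_slide P Q f p q

/-- Functoriality of the composite acts on both labels at once; one of the two actions is by an
identity and disappears. -/
lemma push_comp_rep (P : Profunctor.{u} A B) (Q : Profunctor.{u} B E) {a a' : A} {b : B} {d : E}
    (f : a ⟶ a') (p : El P a b) (q : El Q b d) :
    push (comp P Q) f (rep P Q p q) = rep P Q (push P f p) q := by
  change compMk P Q b (push P f p) (pull Q (𝟙 d) q) = _
  rw [pull_id]
  rfl

lemma pull_comp_rep (P : Profunctor.{u} A B) (Q : Profunctor.{u} B E) {a : A} {b : B} {d d' : E}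
    (f : d' ⟶ d) (p : El P a b) (q : El Q b d) :
    pull (comp P Q) f (rep P Q p q) = rep P Q p (pull Q f q) := by
  change compMk P Q b (push P (𝟙 a) p) (pull Q f q) = _
  rw [push_id]
  rfl

/-- A function on a composite of profunctors from a function on representatives. -/
def compDesc {P : Profunctor.{u} A B} {Q : Profunctor.{u} B E} {a : A} {d : E} {X : Type u}
    (f : ∀ {b : B}, El P a b → El Q b d → X)
    (hf : ∀ {b b' : B} (g : b ⟶ b') (p : El P a b') (q : El Q b d),
      f (pull P g p) q = f p (push Q g q)) : El (comp P Q) a d → X :=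
  Quot.lift (fun z => f z.2.1 z.2.2) (by
    rintro _ _ ⟨g, x⟩
    exact hf g x.1 x.2)

lemma push_tens {A' B' : Type u} [SmallCategory A'] [SmallCategory B'] (P : Profunctor.{u} A B)
    (Q : Profunctor.{u} A' B') {a₁ a₂ : A × A'} {b : B × B'} (f : a₁ ⟶ a₂)
    (z : El (tens P Q) a₁ b) : push (tens P Q) f z = (push P f.1 z.1, push Q f.2 z.2) := by
  change (push P f.1 (pull P (𝟙 _) z.1), push Q f.2 (pull Q (𝟙 _) z.2)) = _
  rw [pull_id, pull_id]

lemma pull_tens {A' B' : Type u} [SmallCategory A'] [SmallCategory B'] (P : Profunctor.{u} A B)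
    (Q : Profunctor.{u} A' B') {a : A × A'} {b₁ b₂ : B × B'} (f : b₂ ⟶ b₁)
    (z : El (tens P Q) a b₁) : pull (tens P Q) f z = (pull P f.1 z.1, pull Q f.2 z.2) := by
  change (push P (𝟙 _) (pull P f.1 z.1), push Q (𝟙 _) (pull Q f.2 z.2)) = _
  rw [push_id, push_id]

/-- A function on a closed-up profunctor from a function on representatives. -/
def loopDesc {X : Type u} [SmallCategory X] {P : Profunctor.{u} (A × X) (B × X)} {a : A} {b : B}
    {Y : Type u} (f : ∀ {x : X}, El P (a, x) (b, x) → Y)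
    (hf : ∀ {x y : X} (g : x ⟶ y) (p : El P (a, x) (b, y)),
      f (pull P ((𝟙 b, g) : (b, x) ⟶ (b, y)) p) = f (push P ((𝟙 a, g) : (a, x) ⟶ (a, y)) p)) :
    El (loop P) a b → Y :=
  Quot.lift (fun z => f z.2) (by
    rintro _ _ ⟨g, x⟩
    exact hf g x)

lemma loopMk_surjective {X : Type u} [SmallCategory X] (P : Profunctor.{u} (A × X) (B × X)) {a : A}
    {b : B} (z : El (loop P) a b) : ∃ (x : X) (p : El P (a, x) (b, x)), z = loopMk P p := by
  obtain ⟨x, p⟩ := z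
  exact ⟨x, p, rfl⟩

lemma loopMk_slide {X : Type u} [SmallCategory X] (P : Profunctor.{u} (A × X) (B × X)) {a : A}
    {b : B} {x y : X} (f : x ⟶ y) (p : El P (a, x) (b, y)) :
    loopMk P (pull P ((𝟙 b, f) : (b, x) ⟶ (b, y)) p) =
      loopMk P (push P ((𝟙 a, f) : (a, x) ⟶ (a, y)) p) :=
  loopMk'_slide P f p

lemma push_loopMk {X : Type u} [SmallCategory X] (P : Profunctor.{u} (A × X) (B × X)) {a a' : A}
    {b : B} {x : X} (f : a ⟶ a') (p : El P (a, x) (b, x)) :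
    push (loop P) f (loopMk P p) = loopMk P (push P ((f, 𝟙 x) : (a, x) ⟶ (a', x)) p) := by
  change loopMk' P x (push P ((f, 𝟙 x) : (a, x) ⟶ (a', x)) (pull P (𝟙 (b, x)) p)) = _
  rw [pull_id]
  rfl

lemma pull_loopMk {X : Type u} [SmallCategory X] (P : Profunctor.{u} (A × X) (B × X)) {a : A}
    {b b' : B} {x : X} (g : b' ⟶ b) (p : El P (a, x) (b, x)) :
    pull (loop P) g (loopMk P p) = loopMk P (pull P ((g, 𝟙 x) : (b', x) ⟶ (b, x)) p) := by
  change loopMk' P x (push P (𝟙 (a, x)) (pull P ((g, 𝟙 x) : (b', x) ⟶ (b, x)) p)) = _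
  rw [push_id]
  rfl

end Elements

/-! ### Extension along functors whose values have every object as a retract -/

section Dense

variable {A B C D E : Type u} [SmallCategory A] [SmallCategory B] [SmallCategory C]
  [SmallCategory D] [SmallCategory E]

/-- Every object of the target is a retract of a value of the functor. -/
class RetractDense (F : C ⥤ D) : Prop where
  retract : ∀ Y : D, ∃ X : C, Nonempty (Retract Y (F.obj X))

/-- Retracts are formed componentwise. This is what allows transformations of several variables to
be extended from powers of `C` to powers of `D`. -/
instance (F : A ⥤ B) (G : C ⥤ D) [RetractDense F] [RetractDense G] :
    RetractDense (F.prod G) where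
  retract Y := by
    obtain ⟨X₁, ⟨r₁⟩⟩ := RetractDense.retract (F := F) Y.1
    obtain ⟨X₂, ⟨r₂⟩⟩ := RetractDense.retract (F := G) Y.2
    exact ⟨(X₁, X₂), ⟨⟨(r₁.i, r₂.i), (r₁.r, r₂.r), Prod.ext r₁.retract r₂.retract⟩⟩⟩

instance (F : A ⥤ B) (G : C ⥤ D) [F.Full] [G.Full] : (F.prod G).Full where
  map_surjective f :=
    ⟨(F.preimage f.1, G.preimage f.2), Prod.ext (F.map_preimage f.1) (G.map_preimage f.2)⟩

instance (F : A ⥤ B) (G : C ⥤ D) [F.Faithful] [G.Faithful] : (F.prod G).Faithful where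
  map_injective h := Prod.ext (F.map_injective (congrArg Prod.fst h))
    (G.map_injective (congrArg Prod.snd h))

instance : RetractDense (𝟭 B) where
  retract Y := ⟨Y, ⟨Retract.refl Y⟩⟩

variable (F : C ⥤ D) [RetractDense F]

lemma exists_retract (Y : D) : ∃ (X : C) (i : Y ⟶ F.obj X) (r : F.obj X ⟶ Y), i ≫ r = 𝟙 Y := by
  obtain ⟨X, ⟨h⟩⟩ := RetractDense.retract (F := F) Y
  exact ⟨X, h.i, h.r, h.retract⟩

/-- Since `i ≫ r = 1`, a morphism out of `Y` is recovered from its composite with the single test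
morphism `r`. -/
lemma dense_hom_ext {Y Z : D} {g h : Y ⟶ Z} (e : ∀ (c : C) (f : F.obj c ⟶ Y), f ≫ g = f ≫ h) :
    g = h := by
  obtain ⟨X, i, r, hr⟩ := exists_retract F Y
  rw [← Category.id_comp g, ← Category.id_comp h, ← hr, Category.assoc, Category.assoc, e]

lemma dense_hom_ext' {Y Z : D} {g h : Y ⟶ Z} (e : ∀ (c : C) (f : Z ⟶ F.obj c), g ≫ f = h ≫ f) :
    g = h := by
  obtain ⟨X, i, r, hr⟩ := exists_retract F Z
  rw [← Category.comp_id g, ← Category.comp_id h, ← hr, ← Category.assoc, ← Category.assoc, e]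

/-- Natural transformations out of a functor on `D` extend uniquely from the dense subcategory. -/
noncomputable def extNat {D' : Type u} [SmallCategory D'] [F.Full] {G H : D ⥤ D'}
    (α : F ⋙ G ⟶ F ⋙ H) : G ⟶ H where
  app Y := G.map (RetractDense.retract (F := F) Y).choose_spec.some.i ≫ α.app _ ≫
    H.map (RetractDense.retract (F := F) Y).choose_spec.some.r
  naturality Y Y' f := by
    generalize (RetractDense.retract (F := F) Y).choose_spec.some = s
    generalize (RetractDense.retract (F := F) Y').choose_spec.some = s'
    -- Naturality of `α` is available only along morphisms of `C`; fullness turns `f`, conjugated by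
    -- the two retracts, into one.
    have h := α.naturality (F.preimage (s.r ≫ f ≫ s'.i))
    simp only [Functor.comp_map, Functor.map_preimage] at h
    have e : f ≫ s'.i = s.i ≫ s.r ≫ f ≫ s'.i := by simp
    have e' : s.r ≫ f = (s.r ≫ f ≫ s'.i) ≫ s'.r := by simp
    rw [← G.map_comp_assoc, e, G.map_comp_assoc, reassoc_of% h, ← H.map_comp, ← e']
    simp

/-- At a value of `F` the retraction itself comes from `C`, so naturality of `α` slides it past the
component and it cancels with its section: the chosen retract does not matter. -/
lemma extNat_app_obj {D' : Type u} [SmallCategory D'] [F.Full] {G H : D ⥤ D'}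
    (α : F ⋙ G ⟶ F ⋙ H) (c : C) : (extNat F α).app (F.obj c) = α.app c := by
  change G.map _ ≫ α.app _ ≫ H.map _ = _
  generalize (RetractDense.retract (F := F) (F.obj c)).choose_spec.some = s
  have h := α.naturality (F.preimage s.r)
  simp only [Functor.comp_map, Functor.map_preimage] at h
  erw [← h]
  rw [← G.map_comp_assoc]
  simp

/-- Naturality sandwiches the component at `Y` between the section and the retraction, with the
component at `F.obj X` in the middle. -/
lemma nat_ext_dense {D' : Type u} [SmallCategory D'] {G H : D ⥤ D'} {α β : G ⟶ H}
    (h : ∀ c, α.app (F.obj c) = β.app (F.obj c)) : α = β := by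
  ext Y
  obtain ⟨X, i, r, hr⟩ := exists_retract F Y
  have e : ∀ γ : G ⟶ H, γ.app Y = G.map i ≫ γ.app (F.obj X) ≫ H.map r := fun γ => by
    rw [γ.naturality_assoc, ← H.map_comp, hr, H.map_id, Category.comp_id]
  rw [e, e, h]

/-- Natural isomorphisms extend uniquely from the dense subcategory. -/
noncomputable def extIso {D' : Type u} [SmallCategory D'] [F.Full] {G H : D ⥤ D'}
    (α : F ⋙ G ≅ F ⋙ H) : G ≅ H where
  hom := extNat F α.hom
  inv := extNat F α.inv
  hom_inv_id := nat_ext_dense F fun c => by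
    rw [NatTrans.comp_app, extNat_app_obj, extNat_app_obj]
    exact α.hom_inv_id_app c
  inv_hom_id := nat_ext_dense F fun c => by
    rw [NatTrans.comp_app, extNat_app_obj, extNat_app_obj]
    exact α.inv_hom_id_app c

lemma extIso_hom_app_obj {D' : Type u} [SmallCategory D'] [F.Full] {G H : D ⥤ D'}
    (α : F ⋙ G ≅ F ⋙ H) (c : C) : (extIso F α).hom.app (F.obj c) = α.hom.app c :=
  extNat_app_obj F α.hom c

/-- A functor with values in an idempotent complete category extends from the dense
subcategory. -/
lemma exists_extension [F.Full] [F.Faithful] {D' : Type u} [SmallCategory D'] [IsIdempotentComplete D']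
    (T : C ⥤ D') : ∃ G : D ⥤ D', Nonempty (F ⋙ G ≅ T) := by
  choose X i r hr using exists_retract F
  -- The idempotent `r Y ≫ i Y` lives on a value of `F`, hence comes from `C`. Its image under `T`
  -- splits in `D'`, and the splitting object serves as the value at `Y`.
  have hidem : ∀ Y, T.map (F.preimage (r Y ≫ i Y)) ≫ T.map (F.preimage (r Y ≫ i Y)) =
      T.map (F.preimage (r Y ≫ i Y)) := fun Y => by
    rw [← T.map_comp, ← F.preimage_comp]
    simp only [Category.assoc, reassoc_of% hr]
  choose s ι π hιπ hπι using fun Y => IsIdempotentComplete.idempotents_split _ _ (hidem Y)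
  let G : D ⥤ D' :=
    { obj := s
      map := fun {Y Y'} f => ι Y ≫ T.map (F.preimage (r Y ≫ f ≫ i Y')) ≫ π Y'
      map_id := fun Y => by
        rw [Category.id_comp, ← hπι Y]
        simp [hιπ]
      map_comp := fun {Y Y' Y''} f g => by
        simp only [Category.assoc]
        rw [reassoc_of% (hπι Y'), ← T.map_comp_assoc, ← T.map_comp_assoc, ← F.preimage_comp,
          ← F.preimage_comp]
        simp only [Category.assoc, reassoc_of% hr] }
  -- At a value of `F` the section and retraction of the chosen retract come from `C`; their images
  -- under `T` compare the splitting with `T.obj c`.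
  refine ⟨G, ⟨NatIso.ofComponents (fun c =>
    { hom := ι (F.obj c) ≫ T.map (F.preimage (r (F.obj c)))
      inv := T.map (F.preimage (i (F.obj c))) ≫ π (F.obj c)
      hom_inv_id := ?_
      inv_hom_id := ?_ }) ?_⟩⟩
  · simp only [Category.assoc]
    rw [← T.map_comp_assoc, ← F.preimage_comp, ← hπι]
    simp only [Category.assoc, hιπ, reassoc_of% hιπ]
    rfl
  · simp only [Category.assoc]
    rw [reassoc_of% hπι, ← T.map_comp, ← T.map_comp, ← F.preimage_comp, ← F.preimage_comp]
    simp [hr]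
  · intro c c' f
    simp only [Functor.comp_map, G, Category.assoc]
    rw [reassoc_of% hπι, ← T.map_comp, ← T.map_comp, ← T.map_comp, ← F.preimage_comp,
      ← F.preimage_comp]
    congr 2
    apply F.map_injective
    simp [hr]

end Dense

/-! ### Profunctors represented by functors to the completion -/

section Rep

variable {A B C D E D' : Type u} [SmallCategory A] [SmallCategory B] [SmallCategory C]
  [SmallCategory D] [SmallCategory E] [SmallCategory D']

/-- The profunctor `(c, a) ↦ D(Fc, Ta)`. -/
abbrev Rep (F : C ⥤ D) (T : A ⥤ D) : Profunctor.{u} A C :=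
  (Profunctor.id (C := D)).whiskerLeft₂ T F

section

variable {P : Profunctor.{u} A C} {F : C ⥤ D} {T : A ⥤ D} (t : P ≅ Rep F T)

/-- The morphism of `D` that corresponds to an element. -/
def rv {a : A} {c : C} (p : El P a c) : F.obj c ⟶ T.obj a := ev t.hom p

/-- The element that corresponds to a morphism of `D`. -/
def vr {a : A} {c : C} (f : F.obj c ⟶ T.obj a) : El P a c := ev t.inv (Q := P) (P := Rep F T) f

@[simp]
lemma rv_vr {a : A} {c : C} (f : F.obj c ⟶ T.obj a) : rv t (vr t f) = f := ev_hom_inv t _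

@[simp]
lemma vr_rv {a : A} {c : C} (p : El P a c) : vr t (rv t p) = p := ev_inv_hom t _

lemma rv_bijective {a : A} {c : C} : Function.Bijective (rv t (a := a) (c := c)) :=
  ev_hom_bijective t

lemma rv_injective {a : A} {c : C} : Function.Injective (rv t (a := a) (c := c)) :=
  (rv_bijective t).1

@[simp]
lemma rv_push {a a' : A} {c : C} (f : a ⟶ a') (p : El P a c) :
    rv t (push P f p) = rv t p ≫ T.map f := ev_push t.hom f p

@[simp]
lemma rv_pull {a : A} {c c' : C} (f : c' ⟶ c) (p : El P a c) :
    rv t (pull P f p) = F.map f ≫ rv t p := ev_pull t.hom f p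

end

/-- A representation of a profunctor from a natural bijection. -/
noncomputable def repMk {P : Profunctor.{u} A C} {F : C ⥤ D} {T : A ⥤ D}
    (f : ∀ {a : A} {c : C}, El P a c → (F.obj c ⟶ T.obj a))
    (hf : ∀ (a : A) (c : C), Function.Bijective (f (a := a) (c := c)))
    (hpush : ∀ {a a' : A} {c : C} (g : a ⟶ a') (p : El P a c), f (push P g p) = f p ≫ T.map g)
    (hpull : ∀ {a : A} {c c' : C} (g : c' ⟶ c) (p : El P a c), f (pull P g p) = F.map g ≫ f p) :
    P ≅ Rep F T :=
  isoMk (Q := Rep F T) f hf hpush hpull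

/-- The identity profunctor is represented by a fully faithful functor. -/
noncomputable def repWire (F : C ⥤ D) [F.Full] [F.Faithful] : wire C ≅ Rep F F :=
  repMk (P := wire C) (fun {a c} (p : c ⟶ a) => F.map p)
    (fun _ _ => ⟨F.map_injective, F.map_surjective⟩)
    (fun g p => F.map_comp _ _) (fun g p => F.map_comp _ _)

/-- Products of representations. -/
noncomputable def repTens {P : Profunctor.{u} A C} {F : C ⥤ D} {T : A ⥤ D} (t : P ≅ Rep F T)
    {Q : Profunctor.{u} B E} {G : E ⥤ D'} {U : B ⥤ D'} (s : Q ≅ Rep G U) :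
    tens P Q ≅ Rep (F.prod G) (T.prod U) :=
  repMk (P := tens P Q) (F := F.prod G) (T := T.prod U) (fun p => (rv t p.1, rv s p.2))
    (fun _ _ => (rv_bijective t).prodMap (rv_bijective s))
    (fun g p => by
      rw [push_tens, rv_push, rv_push]
      rfl)
    (fun g p => by
      rw [pull_tens, rv_pull, rv_pull]
      rfl)

section Comp

variable {P : Profunctor.{u} A B} {F : B ⥤ D} {T : A ⥤ D} (t : P ≅ Rep F T)
  {Q : Profunctor.{u} B E} {G : E ⥤ D'} {U : D ⥤ D'} (s : Q ≅ Rep G (F ⋙ U))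

/-- The morphism that corresponds to an element of a composite. -/
def compHom {a : A} {d : E} : El (comp P Q) a d → (G.obj d ⟶ U.obj (T.obj a)) :=
  compDesc (fun p q => rv s q ≫ U.map (rv t p)) (fun g p q => by
    rw [rv_pull, rv_push, U.map_comp, Category.assoc]
    rfl)

lemma compHom_rep {a : A} {b : B} {d : E} (p : El P a b) (q : El Q b d) :
    compHom t s (rep P Q p q) = rv s q ≫ U.map (rv t p) := rfl

variable [F.Full] [RetractDense F]

/-- This is the co-Yoneda lemma with `F` in place of an identity. Since `T.obj a` is a retract of
`F.obj X`, the label `p` can be slid across the coend until it becomes the retraction `r`; the other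
label then depends only on the composite morphism. -/
lemma compHom_bijective (a : A) (d : E) : Function.Bijective (compHom t s (a := a) (d := d)) := by
  obtain ⟨X, i, r, hr⟩ := exists_retract F (T.obj a)
  have hU : U.map i ≫ U.map r = 𝟙 _ := by rw [← U.map_comp, hr, U.map_id]
  have key : ∀ z : El (comp P Q) a d,
      z = rep P Q (vr t r) (vr s (compHom t s z ≫ U.map i)) := fun z => by
    obtain ⟨b, p, q, rfl⟩ := rep_surjective P Q z
    have e : p = pull P (F.preimage (rv t p ≫ i)) (vr t r) := by
      apply rv_injective t
      rw [rv_pull, rv_vr, F.map_preimage, Category.assoc, hr, Category.comp_id]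
    have e' : push Q (F.preimage (rv t p ≫ i)) q = vr s ((rv s q ≫ U.map (rv t p)) ≫ U.map i) := by
      apply rv_injective s
      rw [rv_push, rv_vr]
      simp
    rw [compHom_rep, ← e', ← rep_slide, ← e]
  refine ⟨fun z z' h => ?_, fun f => ⟨rep P Q (vr t r) (vr s (f ≫ U.map i)), ?_⟩⟩
  · rw [key z, key z', h]
  · rw [compHom_rep, rv_vr, rv_vr, Category.assoc, hU, Category.comp_id]

/-- The composite of two representations, by the co-Yoneda lemma for the dense functor `F`. -/
noncomputable def repComp : comp P Q ≅ Rep G (T ⋙ U) :=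
  repMk (compHom t s) (compHom_bijective t s)
    (fun g z => by
      obtain ⟨b, p, q, rfl⟩ := rep_surjective P Q z
      rw [push_comp_rep, compHom_rep, compHom_rep, rv_push, U.map_comp, Category.assoc]
      rfl)
    (fun g z => by
      obtain ⟨b, p, q, rfl⟩ := rep_surjective P Q z
      rw [pull_comp_rep, compHom_rep, compHom_rep, rv_pull, Category.assoc])

lemma rv_repComp {a : A} {b : B} {d : E} (p : El P a b) (q : El Q b d) :
    rv (repComp t s) (rep P Q p q) = rv s q ≫ U.map (rv t p) := rfl

end Comp

/-! ### The Yoneda lemma restricted to values of a dense functor -/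

section Lift

variable (F : C ⥤ D) [RetractDense F]

instance : (Rep F (𝟭 D)).Faithful where
  map_injective {Y Z f g} h := dense_hom_ext F fun c k =>
    ConcreteCategory.congr_hom (congrArg (fun s : (Rep F (𝟭 D)).obj Y ⟶ (Rep F (𝟭 D)).obj Z =>
      s.app (op c)) h) k

/-- As in the Yoneda lemma, a transformation is determined by its value on a generic element. Here
that is the retraction `r` onto `Y`, and `i ≫ α(r)` is the morphism inducing `α`. -/
instance [F.Full] : (Rep F (𝟭 D)).Full where
  map_surjective {Y Z} α := by
    obtain ⟨X, i, r, hr⟩ := exists_retract F Y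
    refine ⟨i ≫ α.app (op X) r, ?_⟩
    ext c k
    have h := ConcreteCategory.congr_hom
      (α.naturality (F.preimage ((show F.obj c.unop ⟶ Y from k) ≫ i)).op) r
    have e : ((Rep F (𝟭 D)).obj Y).map (F.preimage ((show F.obj c.unop ⟶ Y from k) ≫ i)).op r =
        k := by
      change F.map (F.preimage _) ≫ r = k
      rw [F.map_preimage, Category.assoc, hr]
      exact Category.comp_id _
    change k ≫ i ≫ α.app (op X) r = α.app c k
    refine Eq.trans ?_ (h.symm.trans (congrArg (α.app c) e))
    change _ = F.map (F.preimage _) ≫ α.app (op X) r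
    rw [F.map_preimage]
    exact (Category.assoc _ _ _).symm

variable [F.Full]

/-- An isomorphism of represented profunctors comes from an isomorphism of functors. -/
noncomputable def liftIso {T T' : A ⥤ D} (φ : Rep F T ≅ Rep F T') : T ≅ T' :=
  ((Functor.FullyFaithful.ofFullyFaithful (Rep F (𝟭 D))).whiskeringRight A).preimageIso
    (X := T) (Y := T') φ

lemma comp_liftIso_hom {T T' : A ⥤ D} (φ : Rep F T ≅ Rep F T') {a : A} {c : C}
    (f : F.obj c ⟶ T.obj a) : f ≫ (liftIso F φ).hom.app a = ev φ.hom (P := Rep F T) f := by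
  have h := ((Functor.FullyFaithful.ofFullyFaithful (Rep F (𝟭 D))).whiskeringRight
    A).map_preimage (X := T) (Y := T') φ.hom
  exact ConcreteCategory.congr_hom (congrArg (fun s : Rep F T ⟶ Rep F T' =>
      (s.app a).app (op c)) h) f

/-- A profunctor that is objectwise representable is represented by a functor. -/
lemma exists_rep (P : Profunctor.{u} A C) (h : ∀ a, ∃ Y : D,
    ∃ f : ∀ {c : C}, El P a c → (F.obj c ⟶ Y), (∀ c, Function.Bijective (f (c := c))) ∧
      ∀ {c c' : C} (g : c' ⟶ c) (p : El P a c), f (pull P g p) = F.map g ≫ f p) :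
    ∃ T : A ⥤ D, Nonempty (P ≅ Rep F T) := by
  have h' : ∀ a, (Rep F (𝟭 D)).essImage (P.obj a) := fun a => by
    obtain ⟨Y, f, hf, hn⟩ := h a
    refine ⟨Y, ⟨(NatIso.ofComponents (fun c => (Equiv.ofBijective f (hf c.unop)).toIso)
      (fun {c c'} g => ?_)).symm⟩⟩
    ext p
    exact hn g.unop p
  -- Full faithfulness of the restricted Yoneda embedding turns the objectwise choice of
  -- representing objects into a functor.
  exact ⟨Functor.essImage.liftFunctor P (Rep F (𝟭 D)) h',
    ⟨(Functor.essImage.liftFunctorCompIso P (Rep F (𝟭 D)) h').symm⟩⟩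

end Lift

/-! ### Representability of left adjoints and corepresentability of right adjoints -/

section Adjoint

variable {P : Profunctor.{u} A C} {R : Profunctor.{u} C A}

/-- The unit is natural, so its value at `f` is carried over from its value at an identity. -/
lemma ev_unit_push (h : ProfAdj P R) {a a' : A} (f : a ⟶ a') {c : C} (v : El P a c)
    (w : El R c a) (e : h.UnitRep v w) :
    ev h.unit (show El (Profunctor.id (C := A)) a' a from f) = rep P R (push P f v) w := by
  have e' := ev_push h.unit f (show El (Profunctor.id (C := A)) a a from 𝟙 a)
  have hf : push (Profunctor.id (C := A)) f (show El (Profunctor.id (C := A)) a a from 𝟙 a) =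
      f := Category.id_comp f
  rw [hf, e, push_comp_rep] at e'
  exact e'

lemma exists_unitRep (h : ProfAdj P R) (a : A) :
    ∃ (c : C) (v : El P a c) (w : El R c a), h.UnitRep v w :=
  rep_surjective P R _

lemma eval_pull (h : ProfAdj P R) {a : A} {b b' b'' : C} (g : b'' ⟶ b') (k : El R b a)
    (p : El P a b') : h.eval k (pull P g p) = g ≫ h.eval k p := by
  unfold ProfAdj.eval
  rw [← pull_comp_rep, ev_pull]
  rfl

lemma eval_push (h : ProfAdj P R) {a : A} {b b' b'' : C} (g : b ⟶ b'') (k : El R b a)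
    (p : El P a b') : h.eval (push R g k) p = h.eval k p ≫ g := by
  unfold ProfAdj.eval
  rw [← push_comp_rep, ev_push]
  rfl

lemma eval_slide (h : ProfAdj P R) {a a' : A} {b b' : C} (g : a ⟶ a') (k : El R b a')
    (p : El P a b') : h.eval (pull R g k) p = h.eval k (push P g p) := by
  unfold ProfAdj.eval
  rw [rep_slide]

lemma UnitRep.pull_eval {h : ProfAdj P R} {a : A} {b b' : C} {v : El P a b'} {w : El R b' a}
    (e : h.UnitRep v w) (p : El P a b) : pull P (h.eval w p) v = p :=
  h.left_triangle p v w e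

lemma UnitRep.push_eval {h : ProfAdj P R} {a : A} {b b' : C} {v : El P a b'} {w : El R b' a}
    (e : h.UnitRep v w) (r : El R b a) : push R (h.eval r v) w = r :=
  h.right_triangle r v w e

variable {F : C ⥤ D} {T : A ⥤ D} [F.Full] [RetractDense F]

/-- A profunctor with a right adjoint is represented by a functor to the Cauchy completion. -/
lemma exists_rep_of_adj (F : C ⥤ D) [F.Full] [F.Faithful] [RetractDense F]
    [IsIdempotentComplete D] (h : ProfAdj P R) : ∃ T : A ⥤ D, Nonempty (P ≅ Rep F T) := by
  apply exists_rep F P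
  intro a
  obtain ⟨b, v, w, e⟩ := exists_unitRep h a
  -- By the first triangle equation `h.eval w v` is an idempotent of `b`, and `p ↦ h.eval w p`
  -- identifies `P(-, a)` with the morphisms into `b` fixed by it. The object splitting its image in
  -- `D` therefore represents `P(-, a)`.
  have hw : ∀ {c : C} (p : El P a c), h.eval w p ≫ h.eval w v = h.eval w p := fun p => by
    rw [← eval_pull, UnitRep.pull_eval e]
  obtain ⟨Y, ι, π, h₁, h₂⟩ := IsIdempotentComplete.idempotents_split (F.obj b)
    (F.map (h.eval w v)) (by rw [← F.map_comp, hw])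
  refine ⟨Y, fun p => F.map (h.eval w p) ≫ π, fun c => ⟨fun p p' hp => ?_, fun f => ?_⟩,
    fun g p => ?_⟩
  · have hp' := congrArg (· ≫ ι) hp
    simp only [Category.assoc, h₂] at hp'
    rw [← F.map_comp, ← F.map_comp, hw, hw] at hp'
    rw [← UnitRep.pull_eval e p, ← UnitRep.pull_eval e p', F.map_injective hp']
  · refine ⟨pull P (F.preimage (f ≫ ι)) v, ?_⟩
    dsimp only
    rw [eval_pull, F.map_comp, F.map_preimage, ← h₂]
    simp [h₁]
  · dsimp only
    rw [eval_pull, F.map_comp, Category.assoc]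

variable (h : ProfAdj P R) (t : P ≅ Rep F T)

/-- Pairing with `k` is natural in `p`, so it is postcomposition with one morphism. Every `p` is a
pullback of the element given by the retraction `r`, and the value of the pairing there determines
`g`. -/
lemma exists_rep_right_hom {a : A} {b : C} (k : El R b a) :
    ∃ g : T.obj a ⟶ F.obj b, ∀ {c : C} (p : El P a c), F.map (h.eval k p) = rv t p ≫ g := by
  obtain ⟨X, i, r, hr⟩ := exists_retract F (T.obj a)
  refine ⟨i ≫ F.map (h.eval k (vr t r)), fun {c} p => ?_⟩
  have e : p = pull P (F.preimage (rv t p ≫ i)) (vr t r) := by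
    apply rv_injective t
    rw [rv_pull, rv_vr, F.map_preimage, Category.assoc, hr, Category.comp_id]
  conv_lhs => rw [e]
  rw [eval_pull, F.map_comp, F.map_preimage, Category.assoc]

/-- If a left adjoint is represented by `T`, then its right adjoint is corepresented by `T`. -/
lemma exists_rep_right [F.Faithful] :
    ∃ t' : R ≅ Rep T F, ∀ {a : A} {b c : C} (k : El R b a) (p : El P a c),
      F.map (h.eval k p) = rv t p ≫ rv t' k := by
  choose f hf using fun {a : A} {b : C} (k : El R b a) => exists_rep_right_hom h t k
  have huniq : ∀ {a : A} {b : C} {g g' : T.obj a ⟶ F.obj b},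
      (∀ {c : C} (p : El P a c), rv t p ≫ g = rv t p ≫ g') → g = g' := fun hg =>
    dense_hom_ext F fun c k => by simpa using hg (vr t k)
  refine ⟨repMk (fun k => f k) (fun b a => ?_) (fun g k => ?_) (fun g k => ?_),
    fun k p => hf k p⟩
  -- The unit labels `v` and `w` become a retraction and a section exhibiting `T.obj a` as a retract
  -- of `F.obj x`. The first triangle equation gives this identity, and injectivity and surjectivity
  -- then follow by composing with these two morphisms.
  · obtain ⟨x, v, w, e⟩ := exists_unitRep h a
    have hwv : f w ≫ rv t v = 𝟙 _ := dense_hom_ext F fun c k => by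
      have := hf w (vr t k)
      rw [rv_vr] at this
      rw [← reassoc_of% this, ← rv_pull, UnitRep.pull_eval e, rv_vr, Category.comp_id]
    refine ⟨fun k k' hk => ?_, fun g => ⟨push R (F.preimage (rv t v ≫ g)) w, huniq fun p => ?_⟩⟩
    · have : F.map (h.eval k v) = F.map (h.eval k' v) := by
        rw [hf, hf]
        exact congrArg (rv t v ≫ ·) hk
      rw [← UnitRep.push_eval e k, ← UnitRep.push_eval e k', F.map_injective this]
    · rw [← hf, eval_push, F.map_comp, F.map_preimage, hf, Category.assoc, reassoc_of% hwv]
  · refine huniq fun p => ?_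
    rw [← hf, eval_push, F.map_comp, hf, Category.assoc]
  · refine huniq fun p => ?_
    rw [← hf, eval_slide, hf, rv_push, Category.assoc]

-- Composing `P` with `R` gives `D(T-, T-)`, in which the unit is the action of `T` on morphisms.
-- Comparing representatives of the unit therefore means comparing morphisms of `D`.
variable {h t} in
lemma unit_eq_rep_iff [F.Faithful] {t' : R ≅ Rep T F}
    (ht : ∀ {a : A} {b c : C} (k : El R b a) (p : El P a c),
      F.map (h.eval k p) = rv t p ≫ rv t' k) {a a' : A} {b : C} (f : a ⟶ a') (p : El P a' b)
    (k : El R b a) :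
    ev h.unit (show El (Profunctor.id (C := A)) a' a from f) = rep P R p k ↔
      rv t' k ≫ rv t p = T.map f := by
  obtain ⟨x, v, w, e⟩ := exists_unitRep h a
  have hwv : rv t' w ≫ rv t v = 𝟙 _ := dense_hom_ext F fun c k => by
    have := ht w (vr t k)
    rw [rv_vr] at this
    rw [← reassoc_of% this, ← rv_pull, UnitRep.pull_eval e, rv_vr, Category.comp_id]
  rw [ev_unit_push h f v w e]
  have hc := (rv_injective (repComp t (U := 𝟭 D) t')).eq_iff (a := rep P R (push P f v) w)
    (b := rep P R p k)
  rw [rv_repComp, rv_repComp] at hc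
  rw [← hc]
  simp only [Functor.id_map, rv_push]
  rw [reassoc_of% hwv]
  exact eq_comm

variable {h t} in
lemma unitRep_iff [F.Faithful] {t' : R ≅ Rep T F}
    (ht : ∀ {a : A} {b c : C} (k : El R b a) (p : El P a c),
      F.map (h.eval k p) = rv t p ≫ rv t' k) {a : A} {b : C} (p : El P a b)
    (k : El R b a) : h.UnitRep p k ↔ rv t' k ≫ rv t p = 𝟙 _ := by
  rw [← T.map_id]
  exact unit_eq_rep_iff ht (𝟙 a) p k

/-- The counit of the adjunction between a representation and a corepresentation. -/
noncomputable def repCounit [F.Faithful] (t : P ≅ Rep F T) (t' : R ≅ Rep T F) :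
    comp R P ⟶ Profunctor.id (C := C) :=
  homMk (Q := Profunctor.id (C := C))
    (fun {b c} => compDesc (X := (c ⟶ b)) (fun k p => F.preimage (rv t p ≫ rv t' k))
      (fun g k p => by simp))
    (fun g z => by
      obtain ⟨b, p, q, rfl⟩ := rep_surjective _ _ z
      apply F.map_injective
      rw [push_comp_rep]
      change F.map (F.preimage _) = F.map (F.preimage _ ≫ g)
      simp)
    (fun g z => by
      obtain ⟨b, p, q, rfl⟩ := rep_surjective _ _ z
      apply F.map_injective
      rw [pull_comp_rep]
      change F.map (F.preimage _) = F.map (g ≫ F.preimage _)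
      simp)

omit [RetractDense F] in
lemma map_repCounit [F.Faithful] (t : P ≅ Rep F T) (t' : R ≅ Rep T F) {a : A} {b c : C}
    (k : El R b a) (p : El P a c) :
    F.map (show c ⟶ b from ev (repCounit t t') (rep R P k p)) = rv t p ≫ rv t' k :=
  F.map_preimage _

/-- The unit of the adjunction between a representation and a corepresentation. -/
noncomputable def repUnit (t : P ≅ Rep F T) (t' : R ≅ Rep T F) :
    Profunctor.id (C := A) ⟶ comp P R :=
  homMk (P := Profunctor.id (C := A))
    (fun {a b} f => vr (repComp t (U := 𝟭 D) t') (T.map (show b ⟶ a from f)))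
    (fun g p => by
      apply rv_injective (repComp t (U := 𝟭 D) t')
      rw [rv_push, rv_vr, rv_vr]
      exact T.map_comp _ _)
    (fun g p => by
      apply rv_injective (repComp t (U := 𝟭 D) t')
      rw [rv_pull, rv_vr, rv_vr]
      exact T.map_comp _ _)

/-- The adjunction between a representation and a corepresentation. -/
noncomputable def repAdj [F.Faithful] (t : P ≅ Rep F T) (t' : R ≅ Rep T F) : ProfAdj P R :=
  -- The unit is the identity of `T.obj a` seen as an element of the composite; both triangle
  -- equations reduce to this factorization of it.
  have key : ∀ {a : A} {b : C} (v : El P a b) (w : El R b a),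
      ev (repUnit t t') (show El (Profunctor.id (C := A)) a a from 𝟙 a) = rep P R v w →
        rv t' w ≫ rv t v = 𝟙 _ := fun {a b} v w hvw => by
    have := congrArg (rv (repComp t (U := 𝟭 D) t')) hvw
    rw [rv_repComp] at this
    refine this.symm.trans ((rv_vr _ _).trans (T.map_id a))
  { unit := repUnit t t'
    counit := repCounit t t'
    left_triangle := fun p v w hvw => by
      apply rv_injective t
      rw [rv_pull, map_repCounit, Category.assoc, key v w hvw, Category.comp_id]
    right_triangle := fun r v w hvw => by
      apply rv_injective t'
      rw [rv_push, map_repCounit, ← Category.assoc, key v w hvw, Category.id_comp] }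

lemma map_eval_repAdj [F.Faithful] (t : P ≅ Rep F T) (t' : R ≅ Rep T F) {a : A} {b c : C}
    (k : El R b a) (p : El P a c) : F.map ((repAdj t t').eval k p) = rv t p ≫ rv t' k :=
  F.map_preimage _

end Adjoint

end Rep

/-! ### Labelled trees as morphisms of `D` -/

section Trees

variable {C D : Type u} [SmallCategory C] [SmallCategory D] {M : Profunctor.{u} (C × C) C}
  {F : C ⥤ D} [F.Full] [F.Faithful] [RetractDense F] {T : D × D ⥤ D}
  (t : M ≅ Rep F (F.prod F ⋙ T))

/-- The diagram `(ab)c` is represented by `(Fa ⊗ Fb) ⊗ Fc`. -/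
noncomputable def repLeftTree : leftTree M ≅ Rep F (((F.prod F).prod F) ⋙ (T.prod (𝟭 D)) ⋙ T) :=
  repComp (T := ((F.prod F).prod F) ⋙ (T.prod (𝟭 D))) (repTens t (repWire F)) t

lemma rv_leftMk {a b c d x : C} (p : El M (a, b) x) (q : El M (x, c) d) :
    rv (repLeftTree t) (leftMk M p q) =
      rv t q ≫ T.map ((rv t p, 𝟙 _) :
        (F.obj x, F.obj c) ⟶ (T.obj (F.obj a, F.obj b), F.obj c)) := by
  rw [← F.map_id]
  rfl

/-- In a general representative the identity wire carries some morphism `g`. The coend relation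
absorbs it into the other tile, leaving an identity label. -/
lemma exists_leftMk {a b c d : C} (z : El (leftTree M) ((a, b), c) d) :
    ∃ (x : C) (p : El M (a, b) x) (q : El M (x, c) d), z = leftMk M p q := by
  obtain ⟨⟨x, c'⟩, p, q, rfl⟩ := rep_surjective _ _ z
  obtain ⟨p, (g : c' ⟶ c)⟩ := p
  refine ⟨x, p, push M ((𝟙 x, g) : (x, c') ⟶ (x, c)) q, ?_⟩
  refine Eq.trans ?_ (rep_slide (tens M (wire C)) M (a := ((a, b), c))
    ((𝟙 x, g) : (x, c') ⟶ (x, c)) (p, 𝟙 c) q)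
  exact congrArg (fun w => rep (tens M (wire C)) M w q)
    ((pull_tens M (wire C) _ _).trans (Prod.ext (pull_id M p)
      (by exact Category.comp_id g))).symm

/-- The diagram `a(bc)` is represented by `Fa ⊗ (Fb ⊗ Fc)`. -/
noncomputable def repRightTree :
    rightTree M ≅ Rep F ((F.prod (F.prod F)) ⋙ ((𝟭 D).prod T) ⋙ T) :=
  repComp (T := (F.prod (F.prod F)) ⋙ ((𝟭 D).prod T)) (repTens (repWire F) t) t

lemma rv_rightMk {a b c d x : C} (p : El M (b, c) x) (q : El M (a, x) d) :
    rv (repRightTree t) (rightMk M p q) =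
      rv t q ≫ T.map ((𝟙 _, rv t p) :
        (F.obj a, F.obj x) ⟶ (F.obj a, T.obj (F.obj b, F.obj c))) := by
  rw [← F.map_id]
  rfl

lemma exists_rightMk {a b c d : C} (z : El (rightTree M) (a, (b, c)) d) :
    ∃ (x : C) (p : El M (b, c) x) (q : El M (a, x) d), z = rightMk M p q := by
  obtain ⟨⟨a', x⟩, p, q, rfl⟩ := rep_surjective _ _ z
  obtain ⟨(g : a' ⟶ a), p⟩ := p
  refine ⟨x, p, push M ((g, 𝟙 x) : (a', x) ⟶ (a, x)) q, ?_⟩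
  refine Eq.trans ?_ (rep_slide (tens (wire C) M) M (a := (a, (b, c)))
    ((g, 𝟙 x) : (a', x) ⟶ (a, x)) (𝟙 a, p) q)
  exact congrArg (fun w => rep (tens (wire C) M) M w q)
    ((pull_tens (wire C) M _ _).trans (Prod.ext (by exact Category.comp_id g)
      (pull_id M p))).symm

/-- The diagram `a(b(cd))` is represented by `Fa ⊗ (Fb ⊗ (Fc ⊗ Fd))`. -/
noncomputable def repRightTree₃ : rightTree₃ M ≅
    Rep F ((F.prod (F.prod (F.prod F))) ⋙ ((𝟭 D).prod ((𝟭 D).prod T)) ⋙ ((𝟭 D).prod T) ⋙ T) :=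
  repComp (T := (F.prod (F.prod (F.prod F))) ⋙ ((𝟭 D).prod ((𝟭 D).prod T)))
    (repTens (repWire F) (repTens (repWire F) t)) (repRightTree t)

lemma rv_rightMk₃ {a b c d e x y : C} (p : El M (c, d) x) (q : El M (b, x) y)
    (r : El M (a, y) e) :
    rv (repRightTree₃ t) (rightMk₃ M p q r) = rv t r ≫
      T.map ((𝟙 _, rv t q) : (F.obj a, F.obj y) ⟶ (F.obj a, T.obj (F.obj b, F.obj x))) ≫
        T.map ((𝟙 _, T.map ((𝟙 _, rv t p) : (F.obj b, F.obj x) ⟶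
          (F.obj b, T.obj (F.obj c, F.obj d)))) :
          (F.obj a, T.obj (F.obj b, F.obj x)) ⟶
            (F.obj a, T.obj (F.obj b, T.obj (F.obj c, F.obj d)))) := by
  have h : rv (repRightTree₃ t) (rightMk₃ M p q r) = rv (repRightTree t) (rightMk M q r) ≫
    T.map ((F.map (𝟙 a), T.map ((F.map (𝟙 b), rv t p) : (F.obj b, F.obj x) ⟶
          (F.obj b, T.obj (F.obj c, F.obj d)))) :
          (F.obj a, T.obj (F.obj b, F.obj x)) ⟶
            (F.obj a, T.obj (F.obj b, T.obj (F.obj c, F.obj d)))) := rfl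
  rw [h, rv_rightMk, F.map_id, F.map_id, Category.assoc]

variable {J : Profunctor.{u} One.{u} C} {U : D} (s : J ≅ Rep F (Functor.fromPUnit U))

/-- The source of the left unitor is represented by `U ⊗ Fa`. -/
noncomputable def repLeftUnit : comp (tens J (wire C)) M ≅
    Rep F (((Functor.fromPUnit U).prod F) ⋙ T) :=
  repComp (T := (Functor.fromPUnit U).prod F) (repTens s (repWire F)) t

lemma rv_leftUnit {a c x : C} (j : El J pt x) (p : El M (x, a) c) :
    rv (repLeftUnit t s) (rep (a := (pt, a)) (tens J (wire C)) M (b := (x, a)) (j, 𝟙 a) p) =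
      rv t p ≫ T.map ((rv s j, 𝟙 _) : (F.obj x, F.obj a) ⟶ (U, F.obj a)) := by
  rw [← F.map_id]
  rfl

/-- The source of the right unitor is represented by `Fa ⊗ U`. -/
noncomputable def repRightUnit : comp (tens (wire C) J) M ≅
    Rep F ((F.prod (Functor.fromPUnit U)) ⋙ T) :=
  repComp (T := F.prod (Functor.fromPUnit U)) (repTens (repWire F) s) t

lemma rv_rightUnit {a c x : C} (j : El J pt x) (p : El M (a, x) c) :
    rv (repRightUnit t s) (rep (a := (a, pt)) (tens (wire C) J) M (b := (a, x)) (𝟙 a, j) p) =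
      rv t p ≫ T.map ((𝟙 _, rv s j) : (F.obj a, F.obj x) ⟶ (F.obj a, U)) := by
  rw [← F.map_id]
  rfl

variable {R : Profunctor.{u} C (C × C)} (t' : R ≅ Rep (F.prod F ⋙ T) F)

/-- The composite of the multiplication and its right adjoint. -/
noncomputable def repRing : comp M R ≅ Rep (F.prod F ⋙ T) (F.prod F ⋙ T) :=
  repComp t (U := 𝟭 D) t'

end Trees

/-! ### Elements as morphisms of a monoidal category -/

section Monoidal

variable {C D : Type u} [SmallCategory C] [SmallCategory D] [MonoidalCategory D]
  {F : C ⥤ D} {M : Profunctor.{u} (C × C) C} (t : M ≅ Rep F (F.prod F ⋙ tensor D))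

/-- The morphism `Fc ⟶ Fa ⊗ Fb` that corresponds to an element of the multiplication. -/
def mulV {a b c : C} (p : El M (a, b) c) : F.obj c ⟶ F.obj a ⊗ F.obj b := rv t p

lemma mulV_bijective {a b c : C} : Function.Bijective (mulV t (a := a) (b := b) (c := c)) :=
  rv_bijective t

lemma mulV_injective {a b c : C} : Function.Injective (mulV t (a := a) (b := b) (c := c)) :=
  rv_injective t

@[simp]
lemma mulV_push {a a' b b' c : C} (f : a ⟶ a') (g : b ⟶ b') (p : El M (a, b) c) :
    mulV t (push M ((f, g) : (a, b) ⟶ (a', b')) p) = mulV t p ≫ (F.map f ⊗ₘ F.map g) :=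
  rv_push t _ p

@[simp]
lemma mulV_pull {a b c c' : C} (f : c' ⟶ c) (p : El M (a, b) c) :
    mulV t (pull M f p) = F.map f ≫ mulV t p :=
  rv_pull t _ p

@[simp]
lemma mulV_pushSnd {I : PseudomonoidData C} (t : I.mul ≅ Rep F (F.prod F ⋙ tensor D))
    {a b b' c : C} (g : b ⟶ b') (p : El I.mul (a, b) c) :
    mulV t (I.pushSnd g p) = mulV t p ≫ F.obj a ◁ F.map g := by
  rw [← id_tensorHom, ← F.map_id]
  exact mulV_push t _ _ p

@[simp]
lemma mulV_pushFst {I : PseudomonoidData C} (t : I.mul ≅ Rep F (F.prod F ⋙ tensor D))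
    {a a' b c : C} (g : a ⟶ a') (p : El I.mul (a, b) c) :
    mulV t (I.pushFst g p) = mulV t p ≫ F.map g ▷ F.obj b := by
  rw [← tensorHom_id, ← F.map_id]
  exact mulV_push t _ _ p

section

variable [F.Full] [F.Faithful] [RetractDense F]

/-- The representation of the tree is injective. Equations between labelled trees are thereby
converted into equations between morphisms of `D`, and conversely. -/
lemma leftMk_eq_iff {a b c d x y : C} (p : El M (a, b) x) (q : El M (x, c) d)
    (p' : El M (a, b) y) (q' : El M (y, c) d) : leftMk M p q = leftMk M p' q' ↔
      mulV t q ≫ mulV t p ▷ F.obj c = mulV t q' ≫ mulV t p' ▷ F.obj c := by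
  rw [← (rv_injective (repLeftTree t)).eq_iff, rv_leftMk, rv_leftMk]
  simp only [← tensorHom_id]
  rfl

/-- The representation of the tree is surjective, so a test morphism used to check an axiom in `D`
can be replaced by labels to which the presentation applies. -/
lemma exists_left {a b c d : C} (f : F.obj d ⟶ (F.obj a ⊗ F.obj b) ⊗ F.obj c) :
    ∃ (x : C) (p : El M (a, b) x) (q : El M (x, c) d), mulV t q ≫ mulV t p ▷ F.obj c = f := by
  obtain ⟨x, p, q, h⟩ := exists_leftMk (M := M) (vr (repLeftTree t) (a := ((a, b), c)) f)
  refine ⟨x, p, q, ?_⟩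
  have h' := congrArg (rv (repLeftTree t)) h
  rw [rv_vr, rv_leftMk] at h'
  rw [h', ← tensorHom_id]
  rfl

lemma rightMk_eq_iff {a b c d x y : C} (p : El M (b, c) x) (q : El M (a, x) d)
    (p' : El M (b, c) y) (q' : El M (a, y) d) : rightMk M p q = rightMk M p' q' ↔
      mulV t q ≫ F.obj a ◁ mulV t p = mulV t q' ≫ F.obj a ◁ mulV t p' := by
  rw [← (rv_injective (repRightTree t)).eq_iff, rv_rightMk, rv_rightMk]
  simp only [← id_tensorHom]
  rfl

lemma exists_right {a b c d : C} (f : F.obj d ⟶ F.obj a ⊗ (F.obj b ⊗ F.obj c)) :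
    ∃ (x : C) (p : El M (b, c) x) (q : El M (a, x) d), mulV t q ≫ F.obj a ◁ mulV t p = f := by
  obtain ⟨x, p, q, h⟩ := exists_rightMk (M := M) (vr (repRightTree t) (a := (a, (b, c))) f)
  refine ⟨x, p, q, ?_⟩
  have h' := congrArg (rv (repRightTree t)) h
  rw [rv_vr, rv_rightMk] at h'
  rw [h', ← id_tensorHom]
  rfl

lemma rightMk₃_eq_iff {a b c d e x y x' y' : C} (p : El M (c, d) x) (q : El M (b, x) y)
    (r : El M (a, y) e) (p' : El M (c, d) x') (q' : El M (b, x') y') (r' : El M (a, y') e) :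
    rightMk₃ M p q r = rightMk₃ M p' q' r' ↔
      mulV t r ≫ F.obj a ◁ mulV t q ≫ F.obj a ◁ F.obj b ◁ mulV t p =
        mulV t r' ≫ F.obj a ◁ mulV t q' ≫ F.obj a ◁ F.obj b ◁ mulV t p' := by
  rw [← (rv_injective (repRightTree₃ t)).eq_iff, rv_rightMk₃, rv_rightMk₃]
  simp only [← id_tensorHom]
  rfl

end

/-- The morphism `Fa ⊗ Fb ⟶ Fc` that corresponds to an element of the right adjoint of the
multiplication. -/
def mulRV {R : Profunctor.{u} C (C × C)} (t' : R ≅ Rep (F.prod F ⋙ tensor D) F)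
    {a b c : C} (k : El R c (a, b)) : F.obj a ⊗ F.obj b ⟶ F.obj c := rv t' k

section

variable {R : Profunctor.{u} C (C × C)} (t' : R ≅ Rep (F.prod F ⋙ tensor D) F)

lemma mulRV_bijective {a b c : C} : Function.Bijective (mulRV t' (a := a) (b := b) (c := c)) :=
  rv_bijective t'

@[simp]
lemma mulRV_push {a b c c' : C} (f : c ⟶ c') (k : El R c (a, b)) :
    mulRV t' (push R f k) = mulRV t' k ≫ F.map f :=
  rv_push t' _ k

@[simp]
lemma mulRV_pull {a a' b b' c : C} (f : a' ⟶ a) (g : b' ⟶ b) (k : El R c (a, b)) :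
    mulRV t' (pull R ((f, g) : (a', b') ⟶ (a, b)) k) = (F.map f ⊗ₘ F.map g) ≫ mulRV t' k :=
  rv_pull t' _ k

/-- The morphism that corresponds to an element of the source of the trace. -/
noncomputable def ringV [F.Full] [RetractDense F] {a b : C × C} (z : El (comp M R) b a) :
    F.obj a.1 ⊗ F.obj a.2 ⟶ F.obj b.1 ⊗ F.obj b.2 := rv (repRing t t') z

lemma ringV_rep [F.Full] [RetractDense F] {a b : C × C} {c : C} (p : El M b c) (k : El R c a) :
    ringV t t' (rep M R p k) = mulRV t' k ≫ mulV t p := rfl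

/-- The coend over `c` imposes no restriction: since the objects `Fc` are dense up to retracts,
every such morphism factors through one of them. -/
lemma exists_ring [F.Full] [RetractDense F] {a b a' b' : C}
    (f : F.obj a ⊗ F.obj b ⟶ F.obj a' ⊗ F.obj b') :
    ∃ (c : C) (p : El M (a', b') c) (k : El R c (a, b)), mulRV t' k ≫ mulV t p = f := by
  obtain ⟨c, p, k, h⟩ := rep_surjective _ _ (vr (repRing t t') (a := (a', b')) (c := (a, b)) f)
  refine ⟨c, p, k, ?_⟩
  rw [← ringV_rep, ← h]
  exact rv_vr _ _

@[simp]
lemma ringV_push [F.Full] [RetractDense F] {a a' b b' : C} {y : C × C} (f : a ⟶ a') (g : b ⟶ b')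
    (z : El (comp M R) (a, b) y) : ringV t t' (push (comp M R) ((f, g) : (a, b) ⟶ (a', b')) z) =
      ringV t t' z ≫ (F.map f ⊗ₘ F.map g) :=
  rv_push (repRing t t') _ z

@[simp]
lemma ringV_pull [F.Full] [RetractDense F] {a a' b b' : C} {y : C × C} (f : a' ⟶ a) (g : b' ⟶ b)
    (z : El (comp M R) y (a, b)) : ringV t t' (pull (comp M R) ((f, g) : (a', b') ⟶ (a, b)) z) =
      (F.map f ⊗ₘ F.map g) ≫ ringV t t' z :=
  rv_pull (repRing t t') _ z

end

/-- The morphism `Fx ⟶ 𝟙` that corresponds to an element of the unit. -/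
def oneV {J : Profunctor.{u} One.{u} C} (s : J ≅ Rep F (Functor.fromPUnit (𝟙_ D))) {x : C}
    (j : El J pt x) : F.obj x ⟶ 𝟙_ D := rv s j

lemma oneV_bijective {J : Profunctor.{u} One.{u} C} (s : J ≅ Rep F (Functor.fromPUnit (𝟙_ D)))
    {x : C} : Function.Bijective (oneV s (x := x)) := rv_bijective s

@[simp]
lemma oneV_pull {J : Profunctor.{u} One.{u} C} (s : J ≅ Rep F (Functor.fromPUnit (𝟙_ D)))
    {x y : C} (f : y ⟶ x) (j : El J pt x) : oneV s (pull J f j) = F.map f ≫ oneV s j :=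
  rv_pull s _ _

/-- The morphism `𝟙 ⟶ Fx` that corresponds to an element of the right adjoint of the unit. -/
def oneRV {R : Profunctor.{u} C One.{u}} (s' : R ≅ Rep (Functor.fromPUnit (𝟙_ D)) F) {x : C}
    (j : El R x pt) : 𝟙_ D ⟶ F.obj x := rv s' j

lemma oneRV_bijective {R : Profunctor.{u} C One.{u}}
    (s' : R ≅ Rep (Functor.fromPUnit (𝟙_ D)) F) {x : C} :
    Function.Bijective (oneRV s' (x := x)) := rv_bijective s'

end Monoidal

/-! ### The interpretation given by a balanced monoidal category with a trace -/

section Interpretation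

variable {C D : Type u} [SmallCategory C] [SmallCategory D] [MonoidalCategory D] (F : C ⥤ D)

/-- The multiplication given by the tensor product. -/
abbrev mulRep : Profunctor.{u} (C × C) C := Rep F (F.prod F ⋙ tensor D)

/-- The unit given by the unit object. -/
abbrev oneRep : Profunctor.{u} One.{u} C := Rep F (Functor.fromPUnit (𝟙_ D))

/-- The right adjoint of the multiplication. -/
abbrev mulRRep : Profunctor.{u} C (C × C) := Rep (F.prod F ⋙ tensor D) F

/-- The right adjoint of the unit. -/
abbrev oneRRep : Profunctor.{u} C One.{u} := Rep (Functor.fromPUnit (𝟙_ D)) F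

variable [F.Full] [F.Faithful] [RetractDense F]

/-- The associator of the interpretation. -/
noncomputable def assocRep : leftTree (mulRep F) ≅
    (rightTree (mulRep F)).whiskerLeft₂ (CategoryTheory.prod.associator C C C) (𝟭 C) :=
  isoMk (Q := (rightTree (mulRep F)).whiskerLeft₂ (CategoryTheory.prod.associator C C C) (𝟭 C))
    (fun {a d} z => vr (repRightTree (Iso.refl (mulRep F))) (a := (a.1.1, (a.1.2, a.2))) (c := d)
      (rv (repLeftTree (Iso.refl (mulRep F))) z ≫
        (α_ (F.obj a.1.1) (F.obj a.1.2) (F.obj a.2)).hom))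
    (fun a d => by
      have h₁ := (ev_hom_bijective (repRightTree (Iso.refl (mulRep F))).symm
        (a := (a.1.1, (a.1.2, a.2))) (b := d))
      have h₂ := rv_bijective (repLeftTree (Iso.refl (mulRep F))) (a := a) (c := d)
      have h₃ : Function.Bijective (fun f : F.obj d ⟶ (F.obj a.1.1 ⊗ F.obj a.1.2) ⊗ F.obj a.2 =>
          f ≫ (α_ (F.obj a.1.1) (F.obj a.1.2) (F.obj a.2)).hom) :=
        (Iso.homToEquiv (α_ (F.obj a.1.1) (F.obj a.1.2) (F.obj a.2))).bijective
      exact h₁.comp (h₃.comp h₂))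
    (fun {a a' d} g z => by
      apply rv_injective (repRightTree (Iso.refl (mulRep F)))
      refine (rv_vr _ _).trans ?_
      refine Eq.trans ?_ (rv_push (repRightTree (Iso.refl (mulRep F)))
        (a := (a.1.1, (a.1.2, a.2))) (a' := (a'.1.1, (a'.1.2, a'.2))) (g.1.1, (g.1.2, g.2)) _).symm
      rw [rv_vr, rv_push, Category.assoc, Category.assoc]
      exact congrArg (rv (repLeftTree (Iso.refl (mulRep F))) z ≫ ·)
        (associator_naturality (F.map g.1.1) (F.map g.1.2) (F.map g.2)))
    (fun {a d d'} g z => by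
      apply rv_injective (repRightTree (Iso.refl (mulRep F)))
      refine (rv_vr _ _).trans ?_
      refine Eq.trans ?_ (rv_pull (repRightTree (Iso.refl (mulRep F))) g _).symm
      rw [rv_vr, rv_pull, Category.assoc])

/-- The left unitor of the interpretation. -/
noncomputable def leftUnitRep : comp (tens (oneRep F) (wire C)) (mulRep F) ≅
    (CategoryTheory.Prod.snd One.{u} C).toProfunctor :=
  isoMk (Q := (CategoryTheory.Prod.snd One.{u} C).toProfunctor)
    (fun {a d} z => F.preimage (Y := a.2)
      (rv (repLeftUnit (Iso.refl (mulRep F)) (Iso.refl (oneRep F))) z ≫ (λ_ (F.obj a.2)).hom))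
    (fun a d => by
      have h₁ : Function.Bijective (fun f : F.obj d ⟶ F.obj a.2 => F.preimage f) :=
        (Functor.FullyFaithful.ofFullyFaithful F).homEquiv.symm.bijective
      have h₂ := rv_bijective (repLeftUnit (Iso.refl (mulRep F)) (Iso.refl (oneRep F)))
        (a := a) (c := d)
      have h₃ : Function.Bijective (fun f : F.obj d ⟶ 𝟙_ D ⊗ F.obj a.2 =>
          f ≫ (λ_ (F.obj a.2)).hom) := (Iso.homToEquiv (λ_ (F.obj a.2))).bijective
      exact h₁.comp (h₃.comp h₂))
    (fun {a a' d} g z => by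
      apply F.map_injective
      refine (F.map_preimage _).trans ?_
      change _ = F.map (F.preimage _ ≫ g.2)
      rw [F.map_comp, F.map_preimage, rv_push, Category.assoc, Category.assoc]
      refine congrArg (rv (repLeftUnit (Iso.refl (mulRep F)) (Iso.refl (oneRep F))) z ≫ ·) ?_
      refine Eq.trans ?_ (leftUnitor_naturality (F.map g.2))
      rw [← id_tensorHom]
      rfl)
    (fun {a d d'} g z => by
      apply F.map_injective
      refine (F.map_preimage _).trans ?_
      change _ = F.map (g ≫ F.preimage _)
      rw [F.map_comp, F.map_preimage, rv_pull, Category.assoc])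

/-- The right unitor of the interpretation. -/
noncomputable def rightUnitRep : comp (tens (wire C) (oneRep F)) (mulRep F) ≅
    (CategoryTheory.Prod.fst C One.{u}).toProfunctor :=
  isoMk (Q := (CategoryTheory.Prod.fst C One.{u}).toProfunctor)
    (fun {a d} z => F.preimage (Y := a.1)
      (rv (repRightUnit (Iso.refl (mulRep F)) (Iso.refl (oneRep F))) z ≫ (ρ_ (F.obj a.1)).hom))
    (fun a d => by
      have h₁ : Function.Bijective (fun f : F.obj d ⟶ F.obj a.1 => F.preimage f) :=
        (Functor.FullyFaithful.ofFullyFaithful F).homEquiv.symm.bijective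
      have h₂ := rv_bijective (repRightUnit (Iso.refl (mulRep F)) (Iso.refl (oneRep F)))
        (a := a) (c := d)
      have h₃ : Function.Bijective (fun f : F.obj d ⟶ F.obj a.1 ⊗ 𝟙_ D =>
          f ≫ (ρ_ (F.obj a.1)).hom) := (Iso.homToEquiv (ρ_ (F.obj a.1))).bijective
      exact h₁.comp (h₃.comp h₂))
    (fun {a a' d} g z => by
      apply F.map_injective
      refine (F.map_preimage _).trans ?_
      change _ = F.map (F.preimage _ ≫ g.1)
      rw [F.map_comp, F.map_preimage, rv_push, Category.assoc, Category.assoc]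
      refine congrArg (rv (repRightUnit (Iso.refl (mulRep F)) (Iso.refl (oneRep F))) z ≫ ·) ?_
      refine Eq.trans ?_ (rightUnitor_naturality (F.map g.1))
      rw [← tensorHom_id]
      rfl)
    (fun {a d d'} g z => by
      apply F.map_injective
      refine (F.map_preimage _).trans ?_
      change _ = F.map (g ≫ F.preimage _)
      rw [F.map_comp, F.map_preimage, rv_pull, Category.assoc])

/-- The generators of the pseudomonoid presentation. -/
noncomputable def dataRep : PseudomonoidData C where
  mul := mulRep F
  one := oneRep F
  assoc := assocRep F
  leftUnit := leftUnitRep F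
  rightUnit := rightUnitRep F

/-- An element of the multiplication as a morphism. -/
abbrev mulE {a b c : C} (p : El (dataRep F).mul (a, b) c) : F.obj c ⟶ F.obj a ⊗ F.obj b :=
  mulV (Iso.refl (mulRep F)) p

/-- An element of the unit as a morphism. -/
abbrev oneE {x : C} (j : El (dataRep F).one pt x) : F.obj x ⟶ 𝟙_ D :=
  oneV (Iso.refl (oneRep F)) j

/-- The representation of `a(bc)` is injective and turns the rewriting of labels into composition
with the associator of `D`. -/
lemma assoc_dataRep_iff {a b c d x y : C} (p : El (dataRep F).mul (a, b) x)
    (q : El (dataRep F).mul (x, c) d) (p' : El (dataRep F).mul (b, c) y)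
    (q' : El (dataRep F).mul (a, y) d) : (dataRep F).Assoc p q p' q' ↔
      mulE F q ≫ mulE F p ▷ F.obj c ≫ (α_ _ _ _).hom = mulE F q' ≫ F.obj a ◁ mulE F p' := by
  have h : rv (repRightTree (Iso.refl (mulRep F)))
      (ev (dataRep F).assoc.hom (a := ((a, b), c)) (leftMk (dataRep F).mul p q)) =
      rv (repLeftTree (Iso.refl (mulRep F))) (leftMk (mulRep F) p q) ≫ (α_ _ _ _).hom :=
    rv_vr _ _
  unfold PseudomonoidData.Assoc
  refine (rv_injective (repRightTree (Iso.refl (mulRep F)))).eq_iff.symm.trans ?_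
  rw [h]
  have h₁ := rv_leftMk (Iso.refl (mulRep F)) p q
  have h₂ := rv_rightMk (Iso.refl (mulRep F)) p' q'
  refine Eq.congr ?_ ?_
  · refine (congrArg (· ≫ (α_ _ _ _).hom) h₁).trans ?_
    rw [← tensorHom_id]
    exact Category.assoc _ _ _
  · refine h₂.trans ?_
    rw [← id_tensorHom]
    rfl

lemma map_lunit_dataRep {a c x : C} (j : El (dataRep F).one pt x)
    (p : El (dataRep F).mul (x, a) c) :
    F.map ((dataRep F).lunit j p) = mulE F p ≫ oneE F j ▷ F.obj a ≫ (λ_ _).hom := by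
  refine (F.map_preimage _).trans ?_
  refine (congrArg (· ≫ (λ_ _).hom)
    (rv_leftUnit (Iso.refl (mulRep F)) (Iso.refl (oneRep F)) j p)).trans ?_
  rw [← tensorHom_id]
  exact Category.assoc _ _ _

lemma map_runit_dataRep {a c x : C} (j : El (dataRep F).one pt x)
    (p : El (dataRep F).mul (a, x) c) :
    F.map ((dataRep F).runit j p) = mulE F p ≫ F.obj a ◁ oneE F j ≫ (ρ_ _).hom := by
  refine (F.map_preimage _).trans ?_
  refine (congrArg (· ≫ (ρ_ _).hom)
    (rv_rightUnit (Iso.refl (mulRep F)) (Iso.refl (oneRep F)) j p)).trans ?_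
  rw [← id_tensorHom]
  exact Category.assoc _ _ _

/-- The interpretation of the pseudomonoid presentation. -/
noncomputable def pseudomonoidRep : Pseudomonoid C where
  toPseudomonoidData := dataRep F
  pentagon p q r p₁ q₁ r₁ q₂ p₂ r₂ r₃ q₃ p₄ q₄ h₁ h₂ h₃ h₄ h₅ := by
    rw [assoc_dataRep_iff] at h₁ h₂ h₃ h₄ h₅
    refine (rightMk₃_eq_iff (Iso.refl (mulRep F)) _ _ _ _ _ _).2 ?_
    change mulE F q₂ ≫ _ ◁ mulE F r₂ ≫ _ ◁ _ ◁ mulE F p₂ =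
      mulE F q₄ ≫ _ ◁ mulE F p₄ ≫ _ ◁ _ ◁ mulE F r₃
    -- Each hypothesis moves one pair of tiles across an associator. Undoing all five brings both
    -- sides to the original labels, followed by the two sides of the pentagon in `D`.
    rw [← MonoidalCategory.whiskerLeft_comp, ← h₃, ← reassoc_of% h₅,
      ← associator_naturality_right]
    rw [← whisker_exchange_assoc, ← reassoc_of% h₄]
    simp only [MonoidalCategory.whiskerLeft_comp]
    rw [← reassoc_of% h₂, ← associator_naturality_middle_assoc, ← comp_whiskerRight_assoc,
      ← h₁]
    simp
  triangle j p q p' q' h := by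
    rw [assoc_dataRep_iff] at h
    apply mulV_injective (Iso.refl (mulRep F))
    refine (mulV_pushSnd (I := dataRep F) (Iso.refl (mulRep F)) _ _).trans
      (Eq.trans ?_ (mulV_pushFst (I := dataRep F) (Iso.refl (mulRep F)) _ _).symm)
    rw [map_lunit_dataRep, map_runit_dataRep]
    simp only [MonoidalCategory.whiskerLeft_comp, comp_whiskerRight]
    change mulE F q' ≫ _ = mulE F q ≫ _
    rw [← reassoc_of% h]
    simp

/-- The interpretation of the right-adjoint pseudomonoid presentation. -/
noncomputable def raRep : RAPseudomonoid C where
  toPseudomonoid := pseudomonoidRep F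
  mulR := mulRRep F
  oneR := oneRRep F
  mulAdj := repAdj (Iso.refl (mulRep F)) (Iso.refl (mulRRep F))
  oneAdj := repAdj (Iso.refl (oneRep F)) (Iso.refl (oneRRep F))

end Interpretation

/-- The generating 1-morphisms of an interpretation are given by the tensor product and the unit
object, and the generating 2-morphisms by the structure morphisms of a monoidal category. -/
structure Realization {C D : Type u} [SmallCategory C] [SmallCategory D] [MonoidalCategory D]
    (F : C ⥤ D) (I : RAPseudomonoid C) where
  mul : I.mul ≅ Rep F (F.prod F ⋙ tensor D)
  one : I.one ≅ Rep F (Functor.fromPUnit (𝟙_ D))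
  mulR : I.mulR ≅ Rep (F.prod F ⋙ tensor D) F
  oneR : I.oneR ≅ Rep (Functor.fromPUnit (𝟙_ D)) F
  mul_counit : ∀ {a b c d : C} (k : El I.mulR c (a, b)) (p : El I.mul (a, b) d),
    F.map (I.mulAdj.eval k p) = mulV mul p ≫ mulRV mulR k
  one_counit : ∀ {x y : C} (j' : El I.oneR y pt) (j : El I.one pt x),
    F.map (I.oneAdj.eval j' j) = oneV one j ≫ oneRV oneR j'
  assoc : ∀ {a b c d x y : C} (p : El I.mul (a, b) x) (q : El I.mul (x, c) d)
    (p' : El I.mul (b, c) y) (q' : El I.mul (a, y) d), I.Assoc p q p' q' ↔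
    mulV mul q ≫ mulV mul p ▷ F.obj c ≫ (α_ _ _ _).hom = mulV mul q' ≫ F.obj a ◁ mulV mul p'
  leftUnit : ∀ {a c x : C} (j : El I.one pt x) (p : El I.mul (x, a) c),
    F.map (I.lunit j p) = mulV mul p ≫ oneV one j ▷ F.obj a ≫ (λ_ _).hom
  rightUnit : ∀ {a c x : C} (j : El I.one pt x) (p : El I.mul (a, x) c),
    F.map (I.runit j p) = mulV mul p ≫ F.obj a ◁ oneV one j ≫ (ρ_ _).hom

/-! ### From axioms in `D` to the equations of the presentation -/

namespace Realization

variable {C D : Type u} [SmallCategory C] [SmallCategory D] [MonoidalCategory D]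
  {F : C ⥤ D} [F.Full] [F.Faithful] [RetractDense F] {I : RAPseudomonoid C}
  (r : Realization F I)

attribute [simp] mul_counit one_counit leftUnit rightUnit

lemma unitRep_iff {a b c : C} (p : El I.mul (a, b) c) (k : El I.mulR c (a, b)) :
    I.mulAdj.UnitRep p k ↔ mulRV r.mulR k ≫ mulV r.mul p = 𝟙 _ :=
  TracedProf.unitRep_iff (h := I.mulAdj) (t := r.mul) (t' := r.mulR)
    (fun k p => r.mul_counit k p) p k

lemma unit_eq_rep_iff {a a' b b' c : C} (f : a' ⟶ a) (g : b' ⟶ b) (p : El I.mul (a, b) c)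
    (k : El I.mulR c (a', b')) :
    ev I.mulAdj.unit (show El (Profunctor.id (C := C × C)) (a, b) (a', b') from (f, g)) =
      rep I.mul I.mulR p k ↔ mulRV r.mulR k ≫ mulV r.mul p = F.map f ⊗ₘ F.map g :=
  TracedProf.unit_eq_rep_iff (h := I.mulAdj) (t := r.mul) (t' := r.mulR)
    (fun k p => r.mul_counit k p) (a := (a', b')) (a' := (a, b)) (f, g) p k

section Braided

variable [BraidedCategory D] {σ : I.mul ≅ I.mul.whiskerLeft₂ (CategoryTheory.Prod.swap C C) (𝟭 C)}
  (hσ : ∀ {a b c : C} (p : El I.mul (a, b) c),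
    mulV r.mul (swapEv σ p) = mulV r.mul p ≫ (β_ _ _).hom)

include hσ

/-- Naturality of the braiding moves `p₁` past it, after which both paths are the labels `p, q`
followed by the two sides of the hexagon of `D`. -/
lemma hexagon_forward {a b c d x y z v : C}
    (p : El I.mul (a, b) x) (q : El I.mul (x, c) d)
    (p₁ : El I.mul (b, c) y) (q₁ : El I.mul (a, y) d)
    (p₂ : El I.mul (c, a) z) (q₂ : El I.mul (b, z) d)
    (p₃ : El I.mul (a, c) v) (q₃ : El I.mul (b, v) d)
    (h₁ : I.Assoc p q p₁ q₁) (h₂ : I.Assoc p₁ (swapEv σ q₁) p₂ q₂)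
    (h₃ : I.Assoc (swapEv σ p) q p₃ q₃) :
    rightMk I.mul p₂ q₂ = rightMk I.mul (swapEv σ p₃) q₃ := by
  rw [r.assoc] at h₁ h₂ h₃
  rw [rightMk_eq_iff r.mul]
  rw [hσ] at h₂ h₃ ⊢
  rw [← h₂, MonoidalCategory.whiskerLeft_comp, ← reassoc_of% h₃]
  simp only [Category.assoc, comp_whiskerRight]
  rw [← BraidedCategory.braiding_naturality_right_assoc, ← reassoc_of% h₁]
  simp

/-- The second hexagon is phrased with inverse associators, whereas the hypotheses use the forward
one. Both are therefore moved to the other side before naturality of the braiding reduces the claim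
to the hexagon of `D`. -/
lemma hexagon_reverse {a b c d x y z v : C}
    (p : El I.mul (b, c) x) (q : El I.mul (a, x) d)
    (p₁ : El I.mul (a, b) y) (q₁ : El I.mul (y, c) d)
    (p₂ : El I.mul (c, a) z) (q₂ : El I.mul (z, b) d)
    (p₃ : El I.mul (a, c) v) (q₃ : El I.mul (v, b) d)
    (h₁ : I.Assoc p₁ q₁ p q) (h₂ : I.Assoc p₂ q₂ p₁ (swapEv σ q₁))
    (h₃ : I.Assoc p₃ q₃ (swapEv σ p) q) :
    leftMk I.mul p₂ q₂ = leftMk I.mul (swapEv σ p₃) q₃ := by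
  rw [r.assoc] at h₁ h₂ h₃
  rw [leftMk_eq_iff r.mul]
  rw [hσ] at h₂ h₃ ⊢
  rw [comp_whiskerRight, ← cancel_mono (α_ _ _ _).hom]
  simp only [Category.assoc]
  rw [h₂]
  simp only [Category.assoc]
  rw [← BraidedCategory.braiding_naturality_left]
  have h₃' := congrArg (· ≫ (α_ _ _ _).inv) h₃
  have h₁' := congrArg (· ≫ (α_ _ _ _).inv) h₁
  simp only [Category.assoc, Iso.hom_inv_id, Category.comp_id,
    MonoidalCategory.whiskerLeft_comp] at h₃' h₁'
  rw [reassoc_of% h₁', reassoc_of% h₃', ← BraidedCategory.hexagon_reverse_assoc]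
  simp

variable [BalancedCategory D] {θ : wire C ≅ wire C}
  (hθ : ∀ a : C, F.map (wireEv θ.hom (𝟙 a)) = (BalancedCategory.twist (F.obj a)).hom)

include hθ

-- By naturality, the twist on `Fc` before a label equals the twist on `Fa ⊗ Fb` after it; the
-- formula for the twist of a tensor product does the rest.
omit [F.Full] [F.Faithful] [RetractDense F] in
lemma twist_mul {a b c : C} (p : El I.mul (a, b) c) :
    pull I.mul (wireEv θ.hom (𝟙 c)) p =
      swapEv σ (swapEv σ (I.pushFst (wireEv θ.hom (𝟙 a)) (I.pushSnd (wireEv θ.hom (𝟙 b)) p))) := by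
  apply mulV_injective r.mul
  rw [hσ, hσ]
  simp [hθ, ← BalancedCategory.twist_naturality, BalancedCategory.twist_tensor, tensorHom_def']

omit [F.Full] [F.Faithful] [RetractDense F] in
include r in
omit hσ in
lemma twist_one {x : C} (j : El I.one pt x) : pull I.one (wireEv θ.hom (𝟙 x)) j = j := by
  apply (oneV_bijective r.one).1
  simp [hθ, ← BalancedCategory.twist_naturality, BalancedCategory.twist_unit]

end Braided

section Trace

variable [RightTrace D] {τ : I.ring ⟶ wire C}
  (hτ : ∀ {a b c x : C} (p : El I.mul (b, x) c) (k : El I.mulR c (a, x)),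
    F.map (I.ringEv τ p k) = RightTrace.tr (F.obj x) (mulRV r.mulR k ≫ mulV r.mul p))

include hτ

-- The counit joining the ends is a morphism `Fx ⟶ 𝟙 ⟶ Fy`. Sliding its first half around the loop
-- makes the trace one over the unit object. The condition on `j₀` and `p₀` says that together they
-- are the inverse right unitor.
omit [F.Full] [RetractDense F] in
lemma vanishing_unit {a b c x y v : C} (j : El I.one pt x) (p : El I.mul (b, x) c)
    (k : El I.mulR c (a, y)) (j' : El I.oneR y pt) (j₀ : El I.one pt v) (p₀ : El I.mul (a, v) a)
    (h : I.runit j₀ p₀ = 𝟙 a) :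
    I.ringEv τ p (pull I.mulR (show (a, x) ⟶ (a, y) from (𝟙 a, I.oneAdj.eval j' j)) k) =
      I.mulAdj.eval k (I.pushSnd (I.oneAdj.eval j' j₀) p₀) ≫ I.runit j p := by
  apply F.map_injective
  have h' := congrArg F.map h
  rw [r.rightUnit, F.map_id, ← Category.assoc, ← Iso.eq_comp_inv, Category.id_comp] at h'
  have e := mulRV_pull r.mulR (𝟙 a) (I.oneAdj.eval j' j) k
  rw [hτ, e]
  simp only [F.map_comp, F.map_id, r.mul_counit, r.one_counit, r.rightUnit, mulV_pushSnd,
    MonoidalCategory.whiskerLeft_comp, id_tensorHom, Category.assoc]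
  rw [reassoc_of% h', ← RightTrace.sliding, RightTrace.vanishing_unit]
  simp only [Category.assoc]

/-- The labels `h, g` compose to an identity, so the bubble contracts. Sliding `q' : Fv ⟶ Fx ⊗ Fy`
around the loop replaces the trace over `Fv` by one over `Fx ⊗ Fy`, and tightening puts the outer
labels of the nested traces inside. -/
lemma vanishing_mul {a b c x y z w v e s : C}
    (p : El I.mul (b, x) z) (q : El I.mul (z, y) c) (k : El I.mulR c (w, y))
    (l : El I.mulR w (a, x))
    (q' : El I.mul (x, y) v) (p' : El I.mul (b, v) c)
    (g : El I.mul (a, v) e) (h : El I.mulR e (a, v)) (g₁ : El I.mul (a, x) s)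
    (g₂ : El I.mul (s, y) e)
    (h₁ : I.Assoc p q q' p') (h₂ : I.mulAdj.UnitRep g h) (h₃ : I.Assoc g₁ g₂ q' g) :
    I.ringEv τ (pull I.mul (I.ringEv τ q k) p) l =
      I.ringEv τ p' (push I.mulR (I.mulAdj.eval k (I.pushFst (I.mulAdj.eval l g₁) g₂)) h) := by
  apply F.map_injective
  rw [r.assoc] at h₁ h₃
  rw [r.unitRep_iff] at h₂
  have h₃' := congrArg (· ≫ (α_ _ _ _).inv) h₃
  simp only [Category.assoc, Iso.hom_inv_id, Category.comp_id] at h₃'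
  simp only [hτ, mulV_pull, mulRV_push, r.mul_counit, mulV_pushFst, Category.assoc,
    comp_whiskerRight]
  rw [← RightTrace.tightening, reassoc_of% h₃', reassoc_of% h₂, ← RightTrace.sliding]
  simp only [Category.assoc]
  rw [← h₁, RightTrace.vanishing_tensor]
  simp

/-- Tightening puts `m₂` inside the trace. The hypotheses then rewrite the traced morphism as `m`
followed by the whiskered one, since `h` and `g` cancel, and tightening takes `m` out again. -/
lemma superposing {a b c d x y z v e : C}
    (m : El I.mul (a, y) d) (p : El I.mul (b, x) c) (k : El I.mulR c (y, x))
    (g : El I.mul (d, x) e) (h : El I.mulR e (d, x))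
    (g₁ : El I.mul (y, x) v) (m₁ : El I.mul (a, v) e)
    (m₂ : El I.mul (a, b) z) (g₂ : El I.mul (z, x) e)
    (h₁ : I.mulAdj.UnitRep g h) (h₂ : I.Assoc m g g₁ m₁)
    (h₃ : I.Assoc m₂ g₂ p (I.pushSnd (I.mulAdj.eval k g₁) m₁)) :
    pull I.mul (I.ringEv τ g₂ h) m₂ = I.pushSnd (I.ringEv τ p k) m := by
  apply mulV_injective r.mul
  rw [r.assoc] at h₂ h₃
  rw [r.unitRep_iff] at h₁
  have h₃' := congrArg (· ≫ (α_ _ _ _).inv) h₃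
  simp only [Category.assoc, Iso.hom_inv_id, Category.comp_id, mulV_pushSnd, r.mul_counit,
    MonoidalCategory.whiskerLeft_comp] at h₃'
  rw [← reassoc_of% h₂] at h₃'
  simp only [mulV_pull, hτ, mulV_pushSnd]
  have e₁ := RightTrace.tightening (𝟙 _) (mulRV r.mulR h ≫ mulV r.mul g₂) (mulV r.mul m₂)
  rw [id_whiskerRight, Category.id_comp, Category.id_comp, Category.assoc, h₃',
    reassoc_of% h₁] at e₁
  rw [← e₁, ← RightTrace.superposing]
  have e₂ := RightTrace.tightening (mulV r.mul m) ((α_ (F.obj a) (F.obj y) (F.obj x)).hom ≫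
    F.obj a ◁ (mulRV r.mulR k ≫ mulV r.mul p) ≫ (α_ _ _ _).inv) (𝟙 _)
  rw [id_whiskerRight, Category.comp_id, Category.comp_id] at e₂
  rw [← e₂]
  simp

end Trace

end Realization

/-! ### Braiding, twist and trace of the interpretation -/

section Interpretation

variable {C D : Type u} [SmallCategory C] [SmallCategory D] [MonoidalCategory D] (F : C ⥤ D)
  [F.Full] [F.Faithful] [RetractDense F]

/-- The interpretation is realized by the monoidal category it comes from. -/
noncomputable def realizationRep : Realization F (raRep F) where
  mul := Iso.refl (mulRep F)
  one := Iso.refl (oneRep F)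
  mulR := Iso.refl (mulRRep F)
  oneR := Iso.refl (oneRRep F)
  mul_counit := map_eval_repAdj (Iso.refl (mulRep F)) (Iso.refl (mulRRep F))
  one_counit := map_eval_repAdj (Iso.refl (oneRep F)) (Iso.refl (oneRRep F))
  assoc := assoc_dataRep_iff F
  leftUnit := map_lunit_dataRep F
  rightUnit := map_runit_dataRep F

section Braided

variable [BraidedCategory D]

/-- The braiding of the interpretation. -/
noncomputable def braidRep : (raRep F).mul ≅
    (raRep F).mul.whiskerLeft₂ (CategoryTheory.Prod.swap C C) (𝟭 C) :=
  isoMk (P := mulRep F) (Q := (mulRep F).whiskerLeft₂ (CategoryTheory.Prod.swap C C) (𝟭 C))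
    (fun {a d} (z : F.obj d ⟶ F.obj a.1 ⊗ F.obj a.2) => z ≫ (β_ (F.obj a.1) (F.obj a.2)).hom)
    (fun a d => (Iso.homToEquiv (β_ (F.obj a.1) (F.obj a.2))).bijective)
    (fun {a a' d} g (z : F.obj d ⟶ F.obj a.1 ⊗ F.obj a.2) => by
      change (z ≫ (F.map g.1 ⊗ₘ F.map g.2)) ≫ _ = (z ≫ _) ≫ (F.map g.2 ⊗ₘ F.map g.1)
      simp)
    (fun {a d d'} g (z : F.obj d ⟶ F.obj a.1 ⊗ F.obj a.2) => Category.assoc _ _ _)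

lemma mulV_swapEv_braidRep {a b c : C} (p : El (raRep F).mul (a, b) c) :
    mulV (realizationRep F).mul (swapEv (braidRep F) p) =
      mulV (realizationRep F).mul p ≫ (β_ _ _).hom := rfl

end Braided

/-- The twist of the interpretation. -/
noncomputable def twistRep [BraidedCategory D] [BalancedCategory D] : wire C ≅ wire C :=
  isoMk (P := wire C) (Q := wire C)
    (fun {a b} (f : b ⟶ a) =>
      show b ⟶ a from f ≫ F.preimage (BalancedCategory.twist (F.obj a)).hom)
    (fun a b => (Iso.homToEquiv
      ((Functor.FullyFaithful.ofFullyFaithful F).preimageIso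
        (BalancedCategory.twist (F.obj a)))).bijective)
    (fun {a a' b} g (f : b ⟶ a) => by
      apply F.map_injective
      change F.map ((f ≫ g) ≫ F.preimage _) = F.map ((f ≫ F.preimage _) ≫ g)
      simp [BalancedCategory.twist_naturality])
    (fun {a b b'} g (f : b ⟶ a) => Category.assoc _ _ _)

omit [RetractDense F] in
lemma map_wireEv_twistRep [BraidedCategory D] [BalancedCategory D] (a : C) :
    F.map (wireEv (twistRep F).hom (𝟙 a)) = (BalancedCategory.twist (F.obj a)).hom := by
  change F.map (𝟙 a ≫ F.preimage _) = _
  simp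

section Trace

variable [RightTrace D]

/-- The trace on elements of the source of the trace. -/
noncomputable def trV {I : RAPseudomonoid C} (r : Realization F I) {a b x : C}
    (z : El (comp I.mul I.mulR) (a, x) (b, x)) : b ⟶ a :=
  F.preimage (RightTrace.tr (F.obj x) (ringV r.mul r.mulR z))

variable {F} in
/-- The trace of the interpretation. -/
noncomputable def traceRep {I : RAPseudomonoid C} (r : Realization F I) : I.ring ⟶ wire C :=
  homMk (Q := wire C)
    (fun {a b} => loopDesc (Y := b ⟶ a) (fun {x} z => trV F r z)
      -- Compatibility with the coend that closes the loop is sliding. The two naturality conditions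
      -- below are tightening on either side.
      (fun {x y} g z => by
        unfold trV
        rw [ringV_pull, ringV_push (y := (b, y)), F.map_id, F.map_id, id_tensorHom, id_tensorHom,
          RightTrace.sliding]))
    (fun {a a' b} g z => by
      obtain ⟨x, z, rfl⟩ := loopMk_surjective _ z
      apply F.map_injective
      rw [push_loopMk]
      change F.map (trV F r _) = F.map (trV F r _ ≫ g)
      unfold trV
      have h := RightTrace.tightening (𝟙 (F.obj b)) (B := F.obj a)
        (ringV r.mul r.mulR z) (F.map g)
      rw [id_whiskerRight, Category.id_comp, Category.id_comp] at h
      rw [F.map_comp, F.map_preimage, F.map_preimage, ringV_push (y := (b, x)), F.map_id,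
        tensorHom_id, h])
    (fun {a b b'} g z => by
      obtain ⟨x, z, rfl⟩ := loopMk_surjective _ z
      apply F.map_injective
      rw [pull_loopMk]
      change F.map (trV F r _) = F.map (g ≫ trV F r _)
      unfold trV
      have h := RightTrace.tightening (F.map g) (B := F.obj a)
        (ringV r.mul r.mulR z) (𝟙 (F.obj a))
      rw [id_whiskerRight, Category.comp_id, Category.comp_id] at h
      rw [F.map_comp, F.map_preimage, F.map_preimage, ringV_pull (y := (a, x)), F.map_id,
        tensorHom_id, h])

lemma map_ringEv_traceRep {I : RAPseudomonoid C} (r : Realization F I) {a b c x : C}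
    (p : El I.mul (b, x) c) (k : El I.mulR c (a, x)) :
    F.map (I.ringEv (traceRep r) p k) =
      RightTrace.tr (F.obj x) (mulRV r.mulR k ≫ mulV r.mul p) :=
  F.map_preimage _

end Trace

/-- The interpretation given by a balanced monoidal category with a trace. -/
noncomputable def interpRep [BraidedCategory D] [BalancedCategory D] [RightTrace D] :
    BalancedTracePseudomonoid C where
  toRAPseudomonoid := raRep F
  braid := braidRep F
  hexagon_forward := (realizationRep F).hexagon_forward (mulV_swapEv_braidRep F)
  hexagon_reverse := (realizationRep F).hexagon_reverse (mulV_swapEv_braidRep F)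
  twist := twistRep F
  twist_mul := (realizationRep F).twist_mul (mulV_swapEv_braidRep F) (map_wireEv_twistRep F)
  twist_one := (realizationRep F).twist_one (map_wireEv_twistRep F)
  trace := traceRep (realizationRep F)
  vanishing_unit := (realizationRep F).vanishing_unit (map_ringEv_traceRep F (realizationRep F))
  vanishing_mul := (realizationRep F).vanishing_mul (map_ringEv_traceRep F (realizationRep F))
  superposing := (realizationRep F).superposing (map_ringEv_traceRep F (realizationRep F))

end Interpretation

/-! ### The monoidal category given by an interpretation -/

section Extension

variable {A C D : Type u} [SmallCategory A] [SmallCategory C] [SmallCategory D]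

/-- Isomorphic functors represent isomorphic profunctors. -/
def repMap (F : C ⥤ D) {T T' : A ⥤ D} (e : T ≅ T') : Rep F T ≅ Rep F T' where
  hom := homMk (P := Rep F T) (Q := Rep F T') (fun {a c} (f : F.obj c ⟶ T.obj a) => f ≫ e.hom.app a)
    (fun {a a' c} g (f : F.obj c ⟶ T.obj a) => by
      change (f ≫ T.map g) ≫ _ = (f ≫ _) ≫ T'.map g
      simp)
    (fun {a c c'} g (f : F.obj c ⟶ T.obj a) => Category.assoc _ _ _)
  inv := homMk (P := Rep F T') (Q := Rep F T) (fun {a c} (f : F.obj c ⟶ T'.obj a) => f ≫ e.inv.app a)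
    (fun {a a' c} g (f : F.obj c ⟶ T'.obj a) => by
      change (f ≫ T'.map g) ≫ _ = (f ≫ _) ≫ T.map g
      simp)
    (fun {a c c'} g (f : F.obj c ⟶ T'.obj a) => Category.assoc _ _ _)
  hom_inv_id := hom_ext_ev fun {a c} (f : F.obj c ⟶ T.obj a) => by
    change (f ≫ e.hom.app a) ≫ e.inv.app a = f
    simp
  inv_hom_id := hom_ext_ev fun {a c} (f : F.obj c ⟶ T'.obj a) => by
    change (f ≫ e.inv.app a) ≫ e.hom.app a = f
    simp

variable (F : C ⥤ D) [F.Full] [F.Faithful] [RetractDense F] [IsIdempotentComplete D]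

/-- The representing functor is first obtained on `C × C` only. As idempotents split in `D`, it
extends to `D × D`, and its restriction still represents the multiplication. -/
lemma exists_tensor {M : Profunctor.{u} (C × C) C} {R : Profunctor.{u} C (C × C)}
    (h : ProfAdj M R) : ∃ T : D × D ⥤ D, Nonempty (M ≅ Rep F (F.prod F ⋙ T)) := by
  obtain ⟨T₀, ⟨t₀⟩⟩ := exists_rep_of_adj F h
  obtain ⟨T, ⟨e⟩⟩ := exists_extension (F.prod F) T₀
  exact ⟨T, ⟨t₀ ≪≫ repMap F e.symm⟩⟩

lemma exists_unit {J : Profunctor.{u} One.{u} C} {R : Profunctor.{u} C One.{u}}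
    (h : ProfAdj J R) : ∃ U : D, Nonempty (J ≅ Rep F (Functor.fromPUnit U)) := by
  obtain ⟨T₀, ⟨t₀⟩⟩ := exists_rep_of_adj F h
  exact ⟨T₀.obj pt, ⟨t₀ ≪≫ repMap F (Discrete.natIso fun _ => Iso.refl _)⟩⟩

end Extension

/-! ### Coherence laws as equations of natural transformations -/

section Laws

variable {D : Type u} [SmallCategory D]

/-- The action of a functor of two variables on morphisms. -/
def tmap (T : D × D ⥤ D) {X X' Y Y' : D} (f : X ⟶ X') (g : Y ⟶ Y') :
    T.obj (X, Y) ⟶ T.obj (X', Y') :=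
  T.map ((f, g) : (X, Y) ⟶ (X', Y'))

lemma tmap_comp (T : D × D ⥤ D) {X Y Z X' Y' Z' : D} (f : X ⟶ Y) (g : Y ⟶ Z) (f' : X' ⟶ Y')
    (g' : Y' ⟶ Z') : tmap T f f' ≫ tmap T g g' = tmap T (f ≫ g) (f' ≫ g') :=
  (T.map_comp _ _).symm

@[simp]
lemma tmap_id (T : D × D ⥤ D) (X Y : D) : tmap T (𝟙 X) (𝟙 Y) = 𝟙 _ :=
  T.map_id _

variable {T : D × D ⥤ D}
  (α : (T.prod (𝟭 D)) ⋙ T ≅ CategoryTheory.prod.associator D D D ⋙ ((𝟭 D).prod T) ⋙ T)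

/-- A component of the associator. -/
def assocAt (X Y Z : D) : T.obj (T.obj (X, Y), Z) ⟶ T.obj (X, T.obj (Y, Z)) :=
  α.hom.app ((X, Y), Z)

lemma assocAt_naturality {X Y Z X' Y' Z' : D} (f : X ⟶ X') (g : Y ⟶ Y') (h : Z ⟶ Z') :
    tmap T (tmap T f g) h ≫ assocAt α X' Y' Z' = assocAt α X Y Z ≫ tmap T f (tmap T g h) :=
  α.hom.naturality (((f, g), h) : ((X, Y), Z) ⟶ ((X', Y'), Z'))

/-- Naturality of each side of the pentagon in all four variables makes it enough to compare the
sides on values of `F`. -/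
lemma pentagonLeft_naturality {W X Y Z W' X' Y' Z' : D} (w : W ⟶ W') (x : X ⟶ X') (y : Y ⟶ Y')
    (z : Z ⟶ Z') :
    tmap T (tmap T (tmap T w x) y) z ≫ tmap T (assocAt α W' X' Y') (𝟙 Z') ≫
      assocAt α W' (T.obj (X', Y')) Z' ≫ tmap T (𝟙 W') (assocAt α X' Y' Z') =
    (tmap T (assocAt α W X Y) (𝟙 Z) ≫ assocAt α W (T.obj (X, Y)) Z ≫
      tmap T (𝟙 W) (assocAt α X Y Z)) ≫ tmap T w (tmap T x (tmap T y z)) := by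
  have e₁ : tmap T (tmap T (tmap T w x) y) z ≫ tmap T (assocAt α W' X' Y') (𝟙 Z') =
      tmap T (assocAt α W X Y) (𝟙 Z) ≫ tmap T (tmap T w (tmap T x y)) z := by
    rw [tmap_comp, tmap_comp, assocAt_naturality, Category.comp_id, Category.id_comp]
  have e₂ : tmap T w (tmap T (tmap T x y) z) ≫ tmap T (𝟙 W') (assocAt α X' Y' Z') =
      tmap T (𝟙 W) (assocAt α X Y Z) ≫ tmap T w (tmap T x (tmap T y z)) := by
    rw [tmap_comp, tmap_comp, assocAt_naturality, Category.comp_id, Category.id_comp]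
  rw [reassoc_of% e₁, reassoc_of% (assocAt_naturality α), e₂]
  simp only [Category.assoc]

lemma pentagonRight_naturality {W X Y Z W' X' Y' Z' : D} (w : W ⟶ W') (x : X ⟶ X') (y : Y ⟶ Y')
    (z : Z ⟶ Z') :
    tmap T (tmap T (tmap T w x) y) z ≫ assocAt α (T.obj (W', X')) Y' Z' ≫
      assocAt α W' X' (T.obj (Y', Z')) =
    (assocAt α (T.obj (W, X)) Y Z ≫ assocAt α W X (T.obj (Y, Z))) ≫
      tmap T w (tmap T x (tmap T y z)) := by
  rw [reassoc_of% (assocAt_naturality α), assocAt_naturality, Category.assoc]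

/-- The composite of three associators. -/
def pentagonLeft : (((T.prod (𝟭 D)) ⋙ T).prod (𝟭 D)) ⋙ T ⟶
    CategoryTheory.prod.associator (D × D) D D ⋙ CategoryTheory.prod.associator D D (D × D) ⋙
      (𝟭 D).prod ((𝟭 D).prod T) ⋙ (𝟭 D).prod T ⋙ T where
  app X := tmap T (assocAt α X.1.1.1 X.1.1.2 X.1.2) (𝟙 X.2) ≫
    assocAt α X.1.1.1 (T.obj (X.1.1.2, X.1.2)) X.2 ≫
      tmap T (𝟙 X.1.1.1) (assocAt α X.1.1.2 X.1.2 X.2)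
  naturality X Y f := pentagonLeft_naturality α f.1.1.1 f.1.1.2 f.1.2 f.2

/-- The composite of two associators. -/
def pentagonRight : (((T.prod (𝟭 D)) ⋙ T).prod (𝟭 D)) ⋙ T ⟶
    CategoryTheory.prod.associator (D × D) D D ⋙ CategoryTheory.prod.associator D D (D × D) ⋙
      (𝟭 D).prod ((𝟭 D).prod T) ⋙ (𝟭 D).prod T ⋙ T where
  app X := assocAt α (T.obj (X.1.1.1, X.1.1.2)) X.1.2 X.2 ≫
    assocAt α X.1.1.1 X.1.1.2 (T.obj (X.1.2, X.2))
  naturality X Y f := pentagonRight_naturality α f.1.1.1 f.1.1.2 f.1.2 f.2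

variable {U : D} (ρ : ((𝟭 D).prod (Functor.fromPUnit U)) ⋙ T ≅ CategoryTheory.Prod.fst D One.{u})
  (l : ((Functor.fromPUnit U).prod (𝟭 D)) ⋙ T ≅ CategoryTheory.Prod.snd One.{u} D)

/-- A component of the right unitor. -/
def runitAt (X : D) : T.obj (X, U) ⟶ X := ρ.hom.app (X, pt)

/-- A component of the left unitor. -/
def lunitAt (X : D) : T.obj (U, X) ⟶ X := l.hom.app (pt, X)

lemma runitAt_naturality {X Y : D} (f : X ⟶ Y) :
    tmap T f (𝟙 U) ≫ runitAt ρ Y = runitAt ρ X ≫ f :=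
  ρ.hom.naturality ((f, 𝟙 pt) : (X, pt) ⟶ (Y, pt))

lemma lunitAt_naturality {X Y : D} (f : X ⟶ Y) :
    tmap T (𝟙 U) f ≫ lunitAt l Y = lunitAt l X ≫ f :=
  l.hom.naturality ((𝟙 pt, f) : (pt, X) ⟶ (pt, Y))

/-- The left-hand side of the triangle equation. -/
def triangleLeft : (((𝟭 D).prod (Functor.fromPUnit U) ⋙ T).prod (𝟭 D)) ⋙ T ⟶
    ((CategoryTheory.Prod.fst D One.{u}).prod (𝟭 D)) ⋙ T where
  app X := assocAt α X.1.1 U X.2 ≫ tmap T (𝟙 X.1.1) (lunitAt l X.2)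
  naturality X Y f := by
    have h : tmap T (tmap T f.1.1 (𝟙 U)) f.2 ≫ assocAt α Y.1.1 U Y.2 ≫
        tmap T (𝟙 Y.1.1) (lunitAt l Y.2) = (assocAt α X.1.1 U X.2 ≫
          tmap T (𝟙 X.1.1) (lunitAt l X.2)) ≫ tmap T f.1.1 f.2 := by
      rw [reassoc_of% (assocAt_naturality α), tmap_comp, lunitAt_naturality, Category.assoc, tmap_comp,
        Category.id_comp, Category.comp_id]
    exact h

/-- The right-hand side of the triangle equation. -/
def triangleRight : (((𝟭 D).prod (Functor.fromPUnit U) ⋙ T).prod (𝟭 D)) ⋙ T ⟶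
    ((CategoryTheory.Prod.fst D One.{u}).prod (𝟭 D)) ⋙ T where
  app X := tmap T (runitAt ρ X.1.1) (𝟙 X.2)
  naturality X Y f := by
    have h : tmap T (tmap T f.1.1 (𝟙 U)) f.2 ≫ tmap T (runitAt ρ Y.1.1) (𝟙 Y.2) =
        tmap T (runitAt ρ X.1.1) (𝟙 X.2) ≫ tmap T f.1.1 f.2 := by
      rw [tmap_comp, tmap_comp, runitAt_naturality, Category.id_comp, Category.comp_id]
    exact h

end Laws

/-! ### Associator and unitors on the completion -/

section Structure

variable {C D : Type u} [SmallCategory C] [SmallCategory D] {F : C ⥤ D} [F.Full] [F.Faithful]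
  [RetractDense F] {I : Pseudomonoid C} {T : D × D ⥤ D} {U : D}
  (t : I.mul ≅ Rep F (F.prod F ⋙ T)) (s : I.one ≅ Rep F (Functor.fromPUnit U))

/-- The diagram `a(bc)` with its inputs bracketed to the left. -/
noncomputable def repRightTreeAssoc {M : Profunctor.{u} (C × C) C}
    (t : M ≅ Rep F (F.prod F ⋙ T)) :
    (rightTree M).whiskerLeft₂ (CategoryTheory.prod.associator C C C) (𝟭 C) ≅
      Rep F (((F.prod F).prod F) ⋙ CategoryTheory.prod.associator D D D ⋙
        ((𝟭 D).prod T) ⋙ T) :=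
  repMk (P := (rightTree M).whiskerLeft₂ (CategoryTheory.prod.associator C C C) (𝟭 C))
    (fun {a c} z => rv (repRightTree t) (a := (a.1.1, (a.1.2, a.2))) (c := c) z)
    (fun a c => rv_bijective (repRightTree t))
    (fun {a a' c} g z => rv_push (repRightTree t)
      (a := (a.1.1, (a.1.2, a.2))) (a' := (a'.1.1, (a'.1.2, a'.2))) (g.1.1, (g.1.2, g.2)) z)
    (fun {a c c'} g z => rv_pull (repRightTree t) g z)

/-- The morphism `Fc ⟶ T(Fa, Fb)` that corresponds to an element of the multiplication. -/
def mv {M : Profunctor.{u} (C × C) C} (t : M ≅ Rep F (F.prod F ⋙ T)) {a b c : C}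
    (p : El M (a, b) c) : F.obj c ⟶ T.obj (F.obj a, F.obj b) := rv t p

/-- The morphism `Fx ⟶ U` that corresponds to an element of the unit. -/
def uv {J : Profunctor.{u} One.{u} C} (s : J ≅ Rep F (Functor.fromPUnit U)) {x : C}
    (j : El J pt x) : F.obj x ⟶ U := rv s j

/-- The associator on `D`. -/
noncomputable def assocD : (T.prod (𝟭 D)) ⋙ T ≅
    CategoryTheory.prod.associator D D D ⋙ ((𝟭 D).prod T) ⋙ T :=
  extIso ((F.prod F).prod F)
    (liftIso F ((repLeftTree t).symm ≪≫ I.assoc ≪≫ repRightTreeAssoc t))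

/-- At values of `F` the extended associator is the lifted one, which acts on test morphisms as the
associator of the interpretation acts on labels. The equivalence uses that `a(bc)` is represented
injectively. -/
lemma assocD_spec {a b c d x y : C} (p : El I.mul (a, b) x) (q : El I.mul (x, c) d)
    (p' : El I.mul (b, c) y) (q' : El I.mul (a, y) d) : I.Assoc p q p' q' ↔
      mv t q ≫ tmap T (mv t p) (𝟙 (F.obj c)) ≫ assocAt (assocD t) (F.obj a) (F.obj b) (F.obj c) =
      mv t q' ≫ tmap T (𝟙 (F.obj a)) (mv t p') := by
  have h : (assocD t).hom.app ((F.obj a, F.obj b), F.obj c) = (liftIso F ((repLeftTree t).symm ≪≫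
      I.assoc ≪≫ repRightTreeAssoc t)).hom.app ((a, b), c) :=
    extIso_hom_app_obj ((F.prod F).prod F) _ ((a, b), c)
  have h₂ : rv (repLeftTree t) (leftMk I.mul p q) ≫
      (assocD t).hom.app ((F.obj a, F.obj b), F.obj c) =
        rv (repRightTree t) (a := (a, (b, c)))
          (ev I.assoc.hom (a := ((a, b), c)) (leftMk I.mul p q)) := by
    rw [h]
    refine (comp_liftIso_hom F _ _).trans ?_
    change rv (repRightTree t) (a := (a, (b, c))) (ev I.assoc.hom (a := ((a, b), c))
      (vr (repLeftTree t) (rv (repLeftTree t) (leftMk I.mul p q)))) = _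
    rw [vr_rv]
  refine (rv_injective (repRightTree t) (a := (a, (b, c)))).eq_iff.symm.trans ?_
  rw [← h₂, rv_leftMk]
  exact Eq.congr (Category.assoc _ _ _) (rv_rightMk t p' q')

/-- The target of the left unitor. -/
noncomputable def repSnd : (CategoryTheory.Prod.snd One.{u} C).toProfunctor ≅
    Rep F (((𝟭 One.{u}).prod F) ⋙ CategoryTheory.Prod.snd One.{u} D) :=
  repMk (P := (CategoryTheory.Prod.snd One.{u} C).toProfunctor)
    (fun {a c} (f : c ⟶ a.2) => F.map f)
    (fun _ _ => ⟨F.map_injective, F.map_surjective⟩)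
    (fun _ _ => F.map_comp _ _) (fun _ _ => F.map_comp _ _)

/-- The target of the right unitor. -/
noncomputable def repFst : (CategoryTheory.Prod.fst C One.{u}).toProfunctor ≅
    Rep F ((F.prod (𝟭 One.{u})) ⋙ CategoryTheory.Prod.fst D One.{u}) :=
  repMk (P := (CategoryTheory.Prod.fst C One.{u}).toProfunctor)
    (fun {a c} (f : c ⟶ a.1) => F.map f)
    (fun _ _ => ⟨F.map_injective, F.map_surjective⟩)
    (fun _ _ => F.map_comp _ _) (fun _ _ => F.map_comp _ _)

/-- The left unitor on `D`. -/
noncomputable def leftUnitD : ((Functor.fromPUnit U).prod (𝟭 D)) ⋙ T ≅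
    CategoryTheory.Prod.snd One.{u} D :=
  extIso ((𝟭 One.{u}).prod F)
    (liftIso F ((repLeftUnit t s).symm ≪≫ I.leftUnit ≪≫ repSnd))

lemma leftUnitD_spec {a c x : C} (j : El I.one pt x) (p : El I.mul (x, a) c) :
    F.map (I.lunit j p) = mv t p ≫ tmap T (uv s j) (𝟙 (F.obj a)) ≫
      lunitAt (leftUnitD t s) (F.obj a) := by
  have h : lunitAt (leftUnitD t s) (F.obj a) = (liftIso F ((repLeftUnit t s).symm ≪≫
      I.leftUnit ≪≫ repSnd)).hom.app (pt, a) :=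
    extIso_hom_app_obj ((𝟭 One.{u}).prod F) _ (pt, a)
  have h₁ : (rv (repLeftUnit t s) (rep (a := (pt, a)) (tens I.one (wire C)) I.mul (b := (x, a)) (j, 𝟙 a) p)) ≫
      lunitAt (leftUnitD t s) (F.obj a) = F.map (I.lunit j p) := by
    rw [h]
    refine (comp_liftIso_hom F _ _).trans ?_
    change F.map (ev I.leftUnit.hom (a := (pt, a)) (vr (repLeftUnit t s) (rv (repLeftUnit t s) _))) = _
    rw [vr_rv]
    rfl
  rw [← h₁, rv_leftUnit]
  exact Category.assoc _ _ _

/-- The right unitor on `D`. -/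
noncomputable def rightUnitD : ((𝟭 D).prod (Functor.fromPUnit U)) ⋙ T ≅
    CategoryTheory.Prod.fst D One.{u} :=
  extIso (F.prod (𝟭 One.{u}))
    (liftIso F ((repRightUnit t s).symm ≪≫ I.rightUnit ≪≫ repFst))

lemma rightUnitD_spec {a c x : C} (j : El I.one pt x) (p : El I.mul (a, x) c) :
    F.map (I.runit j p) = mv t p ≫ tmap T (𝟙 (F.obj a)) (uv s j) ≫
      runitAt (rightUnitD t s) (F.obj a) := by
  have h : runitAt (rightUnitD t s) (F.obj a) = (liftIso F ((repRightUnit t s).symm ≪≫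
      I.rightUnit ≪≫ repFst)).hom.app (a, pt) :=
    extIso_hom_app_obj (F.prod (𝟭 One.{u})) _ (a, pt)
  have h₁ : (rv (repRightUnit t s) (rep (a := (a, pt)) (tens (wire C) I.one) I.mul (b := (a, x)) (𝟙 a, j) p)) ≫
      runitAt (rightUnitD t s) (F.obj a) = F.map (I.runit j p) := by
    rw [h]
    refine (comp_liftIso_hom F _ _).trans ?_
    change F.map (ev I.rightUnit.hom (a := (a, pt)) (vr (repRightUnit t s) (rv (repRightUnit t s) _))) = _
    rw [vr_rv]
    rfl
  rw [← h₁, rv_rightUnit]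
  exact Category.assoc _ _ _

end Structure

/-! ### Pentagon and triangle on the completion -/

section Pentagon

variable {C D : Type u} [SmallCategory C] [SmallCategory D] {F : C ⥤ D}
  [RetractDense F] {I : Pseudomonoid C} {T : D × D ⥤ D} {U : D}
  (t : I.mul ≅ Rep F (F.prod F ⋙ T)) (s : I.one ≅ Rep F (Functor.fromPUnit U))

lemma exists_assoc {a b c d x : C} (p : El I.mul (a, b) x) (q : El I.mul (x, c) d) :
    ∃ (y : C) (p' : El I.mul (b, c) y) (q' : El I.mul (a, y) d), I.Assoc p q p' q' :=
  exists_rightMk (M := I.mul) (a := a) (b := b) (c := c) (d := d)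
    (ev I.assoc.hom (a := ((a, b), c)) (leftMk I.mul p q))

omit [RetractDense F] in
lemma mv_bijective {a b c : C} : Function.Bijective (mv t (a := a) (b := b) (c := c)) :=
  rv_bijective t

/-- The section of a retract of `Y` goes into the label and the retraction remains. Iterating this
splits a morphism into a nested tensor product into single tiles. -/
lemma exists_comp_tmap_left {Y : D} {a d : C} (f : F.obj d ⟶ T.obj (Y, F.obj a)) :
    ∃ (x : C) (g : F.obj x ⟶ Y) (q : El I.mul (x, a) d), f = mv t q ≫ tmap T g (𝟙 (F.obj a)) := by
  obtain ⟨x, i, r, hr⟩ := exists_retract F Y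
  obtain ⟨q, hq⟩ := (mv_bijective t (a := x)).2 (f ≫ tmap T i (𝟙 (F.obj a)))
  refine ⟨x, r, q, ?_⟩
  rw [hq, Category.assoc, tmap_comp, hr, Category.id_comp, tmap_id, Category.comp_id]

lemma exists_comp_tmap_right {Y : D} {a d : C} (f : F.obj d ⟶ T.obj (F.obj a, Y)) :
    ∃ (x : C) (g : F.obj x ⟶ Y) (q : El I.mul (a, x) d), f = mv t q ≫ tmap T (𝟙 (F.obj a)) g := by
  obtain ⟨x, i, r, hr⟩ := exists_retract F Y
  obtain ⟨q, hq⟩ := (mv_bijective t (b := x)).2 (f ≫ tmap T (𝟙 (F.obj a)) i)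
  refine ⟨x, r, q, ?_⟩
  rw [hq, Category.assoc, tmap_comp, hr, Category.id_comp, tmap_id, Category.comp_id]

variable [F.Full] [F.Faithful]

/-- A test morphism into `((Fa ⊗ Fb) ⊗ Fc) ⊗ Fd` is split into three tiles. On tiles the five
associators are the five rewrites of the presentation, whose pentagon compares the results. -/
lemma pentagon_obj (a b c d : C) :
    tmap T (assocAt (assocD t) (F.obj a) (F.obj b) (F.obj c)) (𝟙 (F.obj d)) ≫
      assocAt (assocD t) (F.obj a) (T.obj (F.obj b, F.obj c)) (F.obj d) ≫
        tmap T (𝟙 (F.obj a)) (assocAt (assocD t) (F.obj b) (F.obj c) (F.obj d)) =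
      assocAt (assocD t) (T.obj (F.obj a, F.obj b)) (F.obj c) (F.obj d) ≫
        assocAt (assocD t) (F.obj a) (F.obj b) (T.obj (F.obj c, F.obj d)) := by
  refine dense_hom_ext F fun e f => ?_
  obtain ⟨y, g, r, rfl⟩ := exists_comp_tmap_left t f
  obtain ⟨x, g, q, rfl⟩ := exists_comp_tmap_left t g
  obtain ⟨p, rfl⟩ := (mv_bijective t).2 g
  obtain ⟨u₁, p₁, q₁, h₁⟩ := exists_assoc p q
  obtain ⟨u₂, r₁, q₂, h₂⟩ := exists_assoc q₁ r
  obtain ⟨w, p₂, r₂, h₃⟩ := exists_assoc p₁ r₁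
  obtain ⟨w', r₃, q₃, h₄⟩ := exists_assoc q r
  obtain ⟨u₃, p₄, q₄, h₅⟩ := exists_assoc p q₃
  have h := congrArg (rv (repRightTree₃ t))
    (I.pentagon p q r p₁ q₁ r₁ q₂ p₂ r₂ r₃ q₃ p₄ q₄ h₁ h₂ h₃ h₄ h₅)
  rw [rv_rightMk₃, rv_rightMk₃] at h
  replace h : mv t q₂ ≫ tmap T (𝟙 (F.obj a)) (mv t r₂) ≫
      tmap T (𝟙 (F.obj a)) (tmap T (𝟙 (F.obj b)) (mv t p₂)) =
    mv t q₄ ≫ tmap T (𝟙 (F.obj a)) (mv t p₄) ≫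
      tmap T (𝟙 (F.obj a)) (tmap T (𝟙 (F.obj b)) (mv t r₃)) := h
  rw [assocD_spec t] at h₁ h₂ h₃ h₄ h₅
  simp only [Category.assoc]
  -- The first three steps follow the path through `a(bc)`; the presentation's pentagon `h` then
  -- switches to the other path, and the rewrites `h₅` and `h₄` are undone to return to the original
  -- tiles.
  calc _ = mv t r ≫ tmap T (mv t q₁) (𝟙 _) ≫ tmap T (tmap T (𝟙 _) (mv t p₁)) (𝟙 _) ≫
        assocAt (assocD t) (F.obj a) (T.obj (F.obj b, F.obj c)) (F.obj d) ≫
          tmap T (𝟙 (F.obj a)) (assocAt (assocD t) (F.obj b) (F.obj c) (F.obj d)) := by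
        rw [reassoc_of% (tmap_comp T), reassoc_of% (tmap_comp T), Category.assoc, h₁]
    _ = mv t q₂ ≫ tmap T (𝟙 _) (mv t r₁) ≫ tmap T (𝟙 _) (tmap T (mv t p₁) (𝟙 _)) ≫
          tmap T (𝟙 (F.obj a)) (assocAt (assocD t) (F.obj b) (F.obj c) (F.obj d)) := by
        rw [reassoc_of% (assocAt_naturality (assocD t)), reassoc_of% h₂]
    _ = mv t q₂ ≫ tmap T (𝟙 (F.obj a)) (mv t r₂) ≫
          tmap T (𝟙 (F.obj a)) (tmap T (𝟙 (F.obj b)) (mv t p₂)) := by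
        simp only [tmap_comp, h₃, Category.comp_id]
    _ = mv t q₃ ≫ tmap T (𝟙 (F.obj x)) (mv t r₃) ≫ tmap T (mv t p) (𝟙 _) ≫
          assocAt (assocD t) (F.obj a) (F.obj b) (T.obj (F.obj c, F.obj d)) := by
        rw [h, ← reassoc_of% h₅, ← assocAt_naturality, reassoc_of% (tmap_comp T),
          reassoc_of% (tmap_comp T)]
        simp only [Category.comp_id, Category.id_comp, tmap_id]
    _ = mv t r ≫ tmap T (mv t q) (𝟙 (F.obj d)) ≫ tmap T (tmap T (mv t p) (𝟙 _)) (𝟙 (F.obj d)) ≫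
          assocAt (assocD t) (T.obj (F.obj a, F.obj b)) (F.obj c) (F.obj d) ≫
            assocAt (assocD t) (F.obj a) (F.obj b) (T.obj (F.obj c, F.obj d)) := by
        rw [← reassoc_of% h₄, reassoc_of% (assocAt_naturality (assocD t)), tmap_id]
    _ = _ := by
        rw [reassoc_of% (tmap_comp T), Category.comp_id]

/-- The middle object is the unit, which need not be a value of `F`. The test morphism is therefore
first routed through a retract, whose retraction supplies the unit label `j`. -/
lemma triangle_obj (a b : C) :
    assocAt (assocD t) (F.obj a) U (F.obj b) ≫
      tmap T (𝟙 (F.obj a)) (lunitAt (leftUnitD t s) (F.obj b)) =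
    tmap T (runitAt (rightUnitD t s) (F.obj a)) (𝟙 (F.obj b)) := by
  refine dense_hom_ext F fun e f => ?_
  obtain ⟨y, g, q, rfl⟩ := exists_comp_tmap_left t f
  obtain ⟨x, j, p, rfl⟩ := exists_comp_tmap_right t g
  obtain ⟨j, rfl⟩ : ∃ j', uv s j' = j := (rv_bijective s (a := pt)).2 j
  obtain ⟨v, p', q', h⟩ := exists_assoc p q
  have h' := congrArg (mv t) (I.triangle j p q p' q' h)
  have e₁ : ∀ {y y' : C} (g : y ⟶ y') (q : El I.mul (a, y) e), mv t (I.pushSnd g q) =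
      mv t q ≫ tmap T (𝟙 _) (F.map g) := fun g q => by
    rw [← F.map_id]
    exact rv_push t _ _
  have e₂ : ∀ {y y' : C} (g : y ⟶ y') (q : El I.mul (y, b) e), mv t (I.pushFst g q) =
      mv t q ≫ tmap T (F.map g) (𝟙 _) := fun g q => by
    rw [← F.map_id]
    exact rv_push t _ _
  rw [e₁, e₂, leftUnitD_spec t s, rightUnitD_spec t s] at h'
  rw [assocD_spec t] at h
  simp only [Category.assoc]
  calc _ = mv t q ≫ tmap T (mv t p) (𝟙 (F.obj b)) ≫
        tmap T (tmap T (𝟙 (F.obj a)) (uv s j)) (𝟙 (F.obj b)) ≫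
          assocAt (assocD t) (F.obj a) U (F.obj b) ≫
            tmap T (𝟙 (F.obj a)) (lunitAt (leftUnitD t s) (F.obj b)) := by
        rw [reassoc_of% (tmap_comp T), Category.comp_id]
    _ = mv t q' ≫ tmap T (𝟙 (F.obj a)) (mv t p' ≫ tmap T (uv s j) (𝟙 (F.obj b)) ≫
          lunitAt (leftUnitD t s) (F.obj b)) := by
        rw [reassoc_of% (assocAt_naturality (assocD t)), reassoc_of% h]
        simp only [tmap_comp, Category.comp_id]
    _ = _ := by
        refine h'.trans ?_
        rw [tmap_comp, Category.comp_id, Category.assoc]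

lemma pentagonLeft_eq : pentagonLeft (assocD t) = pentagonRight (assocD t) :=
  nat_ext_dense (((F.prod F).prod F).prod F) fun c => pentagon_obj t c.1.1.1 c.1.1.2 c.1.2 c.2

lemma triangleLeft_eq : triangleLeft (assocD t) (leftUnitD t s) = triangleRight (rightUnitD t s) :=
  nat_ext_dense ((F.prod (𝟭 One.{u})).prod F) fun c => triangle_obj t s c.1.1 c.2

end Pentagon

/-- The monoidal category given by a tensor product, a unit, an associator and unitors. -/
@[reducible]
def monoidalOf {D : Type u} [SmallCategory D] (T : D × D ⥤ D) (U : D)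
    (α : (T.prod (𝟭 D)) ⋙ T ≅ CategoryTheory.prod.associator D D D ⋙ ((𝟭 D).prod T) ⋙ T)
    (l : ((Functor.fromPUnit U).prod (𝟭 D)) ⋙ T ≅ CategoryTheory.Prod.snd One.{u} D)
    (ρ : ((𝟭 D).prod (Functor.fromPUnit U)) ⋙ T ≅ CategoryTheory.Prod.fst D One.{u})
    (h : pentagonLeft α = pentagonRight α) (h' : triangleLeft α l = triangleRight ρ) :
    MonoidalCategory D where
  tensorObj X Y := T.obj (X, Y)
  tensorHom f g := tmap T f g
  whiskerLeft X _ _ f := tmap T (𝟙 X) f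
  whiskerRight f X := tmap T f (𝟙 X)
  tensorUnit := U
  associator X Y Z := α.app ((X, Y), Z)
  leftUnitor X := l.app (pt, X)
  rightUnitor X := ρ.app (X, pt)
  tensorHom_def f g := by
    refine Eq.trans ?_ (tmap_comp T f (𝟙 _) (𝟙 _) g).symm
    rw [Category.id_comp, Category.comp_id]
  id_tensorHom_id X Y := tmap_id T X Y
  tensorHom_comp_tensorHom f g f' g' := tmap_comp T _ _ _ _
  whiskerLeft_id X Y := tmap_id T X Y
  id_whiskerRight X Y := tmap_id T X Y
  associator_naturality f g k := assocAt_naturality α f g k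
  leftUnitor_naturality f := lunitAt_naturality l f
  rightUnitor_naturality f := runitAt_naturality ρ f
  pentagon W X Y Z := NatTrans.congr_app h (((W, X), Y), Z)
  triangle X Y := NatTrans.congr_app h' ((X, pt), Y)

/-- The monoidal category on the Cauchy completion given by an interpretation. -/
lemma exists_realization {C D : Type u} [SmallCategory C] [SmallCategory D] (F : C ⥤ D) [F.Full]
    [F.Faithful] [RetractDense F] [IsIdempotentComplete D] (I : RAPseudomonoid C) :
    ∃ _ : MonoidalCategory D, Nonempty (Realization F I) := by
  obtain ⟨T, ⟨t⟩⟩ := exists_tensor F I.mulAdj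
  obtain ⟨U, ⟨s⟩⟩ := exists_unit F I.oneAdj
  obtain ⟨t', ht'⟩ := exists_rep_right I.mulAdj t
  obtain ⟨s', hs'⟩ := exists_rep_right I.oneAdj s
  -- The tensor functor of this structure unfolds to `T` and its unit object to `U`, so the
  -- representations already chosen serve unchanged.
  let _ : MonoidalCategory D := monoidalOf T U (assocD t) (leftUnitD t s) (rightUnitD t s)
    (pentagonLeft_eq t) (triangleLeft_eq t s)
  exact ⟨inferInstance, ⟨
    { mul := t
      one := s
      mulR := t'
      oneR := s'
      mul_counit := fun k p => ht' k p
      one_counit := fun k p => hs' k p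
      assoc := assocD_spec t
      leftUnit := leftUnitD_spec t s
      rightUnit := rightUnitD_spec t s }⟩⟩

/-! ### Testing equations on tensor products of values of `F` -/

section

variable {C D : Type u} [SmallCategory C] [SmallCategory D] [MonoidalCategory D]
  (F : C ⥤ D) [RetractDense F]

/-- Tensor products of retracts are retracts, so both factors may be tested independently. -/
lemma dense_hom_ext_tensor {X Y W : D} {f g : X ⊗ Y ⟶ W}
    (h : ∀ (a b : C) (x : F.obj a ⟶ X) (y : F.obj b ⟶ Y), (x ⊗ₘ y) ≫ f = (x ⊗ₘ y) ≫ g) :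
    f = g := by
  obtain ⟨a, i, p, hp⟩ := exists_retract F X
  obtain ⟨b, j, q, hq⟩ := exists_retract F Y
  have e := congrArg ((i ⊗ₘ j) ≫ ·) (h a b p q)
  simpa [hp, hq] using e

lemma dense_hom_ext_left {X Y Z W : D} {f g : (X ⊗ Y) ⊗ Z ⟶ W}
    (h : ∀ (a b c : C) (x : F.obj a ⟶ X) (y : F.obj b ⟶ Y) (z : F.obj c ⟶ Z),
      ((x ⊗ₘ y) ⊗ₘ z) ≫ f = ((x ⊗ₘ y) ⊗ₘ z) ≫ g) : f = g := by
  obtain ⟨a, i, p, hp⟩ := exists_retract F X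
  obtain ⟨b, j, q, hq⟩ := exists_retract F Y
  obtain ⟨c, k, r, hr⟩ := exists_retract F Z
  have e := congrArg (((i ⊗ₘ j) ⊗ₘ k) ≫ ·) (h a b c p q r)
  simpa [hp, hq, hr] using e

lemma dense_hom_ext_right {X Y Z W : D} {f g : X ⊗ (Y ⊗ Z) ⟶ W}
    (h : ∀ (a b c : C) (x : F.obj a ⟶ X) (y : F.obj b ⟶ Y) (z : F.obj c ⟶ Z),
      (x ⊗ₘ (y ⊗ₘ z)) ≫ f = (x ⊗ₘ (y ⊗ₘ z)) ≫ g) : f = g := by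
  obtain ⟨a, i, p, hp⟩ := exists_retract F X
  obtain ⟨b, j, q, hq⟩ := exists_retract F Y
  obtain ⟨c, k, r, hr⟩ := exists_retract F Z
  have e := congrArg ((i ⊗ₘ (j ⊗ₘ k)) ≫ ·) (h a b c p q r)
  simpa [hp, hq, hr] using e

end

namespace Realization

variable {C D : Type u} [SmallCategory C] [SmallCategory D] [MonoidalCategory D]
  {F : C ⥤ D} [F.Full] [F.Faithful] [RetractDense F] {I : RAPseudomonoid C}
  (r : Realization F I)

/-! ### The braiding on the completion -/

section Braiding

variable (σ : I.mul ≅ I.mul.whiskerLeft₂ (CategoryTheory.Prod.swap C C) (𝟭 C))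

/-- The multiplication with its inputs interchanged. -/
noncomputable def repSwap : I.mul.whiskerLeft₂ (CategoryTheory.Prod.swap C C) (𝟭 C) ≅
    Rep F (F.prod F ⋙ CategoryTheory.Prod.swap D D ⋙ tensor D) :=
  repMk (P := I.mul.whiskerLeft₂ (CategoryTheory.Prod.swap C C) (𝟭 C))
    (fun {a c} z => rv r.mul (a := (a.2, a.1)) (c := c) z)
    (fun _ _ => rv_bijective r.mul)
    (fun {a a' c} g z => rv_push r.mul (a := (a.2, a.1)) (a' := (a'.2, a'.1)) (g.2, g.1) z)
    (fun {a c c'} g z => rv_pull r.mul g z)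

/-- The braiding on `D`. -/
noncomputable def braidD : tensor D ≅ CategoryTheory.Prod.swap D D ⋙ tensor D :=
  extIso (F.prod F) (liftIso F (r.mul.symm ≪≫ σ ≪≫ r.repSwap))

/-- A component of the braiding. -/
noncomputable def braidAt (X Y : D) : X ⊗ Y ≅ Y ⊗ X := (r.braidD σ).app (X, Y)

omit [F.Faithful] in
lemma braidAt_naturality {X Y X' Y' : D} (f : X ⟶ X') (g : Y ⟶ Y') :
    (f ⊗ₘ g) ≫ (r.braidAt σ X' Y').hom = (r.braidAt σ X Y).hom ≫ (g ⊗ₘ f) :=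
  (r.braidD σ).hom.naturality ((f, g) : (X, Y) ⟶ (X', Y'))

omit [F.Faithful] in
lemma mulV_swapEv {a b c : C} (p : El I.mul (a, b) c) :
    mulV r.mul (swapEv σ p) = mulV r.mul p ≫ (r.braidAt σ (F.obj a) (F.obj b)).hom := by
  have h : (r.braidAt σ (F.obj a) (F.obj b)).hom =
      (liftIso F (r.mul.symm ≪≫ σ ≪≫ r.repSwap)).hom.app (a, b) :=
    extIso_hom_app_obj (F.prod F) _ (a, b)
  rw [h]
  refine Eq.trans ?_ (comp_liftIso_hom F (T := F.prod F ⋙ tensor D)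
    (T' := F.prod F ⋙ CategoryTheory.Prod.swap D D ⋙ tensor D) (r.mul.symm ≪≫ σ ≪≫ r.repSwap)
    (a := (a, b)) (mulV r.mul p)).symm
  change rv r.mul (a := (b, a)) (swapEv σ p) =
    rv r.mul (a := (b, a)) (ev σ.hom (vr r.mul (rv r.mul p)))
  rw [vr_rv]
  rfl

-- The associator read backwards: surjectivity of the representation of `(ab)c` provides labels of
-- the composite with the inverse associator.
include r in
lemma exists_assoc_inv {a b c d y : C} (p' : El I.mul (b, c) y) (q' : El I.mul (a, y) d) :
    ∃ (x : C) (p : El I.mul (a, b) x) (q : El I.mul (x, c) d), I.Assoc p q p' q' := by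
  obtain ⟨x, p, q, h⟩ := exists_left r.mul
    (mulV r.mul q' ≫ F.obj a ◁ mulV r.mul p' ≫ (α_ _ _ _).inv)
  refine ⟨x, p, q, (r.assoc _ _ _ _).2 ?_⟩
  rw [reassoc_of% h]
  simp

/-- Precomposing with morphisms from values of `F` and moving them to the end by naturality leaves
each hexagon at objects `Fa, Fb, Fc`. There the test morphism is given by labels, and the hexagon of
the presentation applies. -/
lemma exists_braided
    (hf : ∀ {a b c d x y z v : C}
      (p : El I.mul (a, b) x) (q : El I.mul (x, c) d)
      (p₁ : El I.mul (b, c) y) (q₁ : El I.mul (a, y) d)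
      (p₂ : El I.mul (c, a) z) (q₂ : El I.mul (b, z) d)
      (p₃ : El I.mul (a, c) v) (q₃ : El I.mul (b, v) d),
      I.Assoc p q p₁ q₁ → I.Assoc p₁ (swapEv σ q₁) p₂ q₂ → I.Assoc (swapEv σ p) q p₃ q₃ →
      rightMk I.mul p₂ q₂ = rightMk I.mul (swapEv σ p₃) q₃)
    (hr : ∀ {a b c d x y z v : C}
      (p : El I.mul (b, c) x) (q : El I.mul (a, x) d)
      (p₁ : El I.mul (a, b) y) (q₁ : El I.mul (y, c) d)
      (p₂ : El I.mul (c, a) z) (q₂ : El I.mul (z, b) d)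
      (p₃ : El I.mul (a, c) v) (q₃ : El I.mul (v, b) d),
      I.Assoc p₁ q₁ p q → I.Assoc p₂ q₂ p₁ (swapEv σ q₁) → I.Assoc p₃ q₃ (swapEv σ p) q →
      leftMk I.mul p₂ q₂ = leftMk I.mul (swapEv σ p₃) q₃) :
    ∃ _ : BraidedCategory D, ∀ {a b c : C} (p : El I.mul (a, b) c),
      mulV r.mul (swapEv σ p) = mulV r.mul p ≫ (β_ (F.obj a) (F.obj b)).hom := by
  refine ⟨
    { braiding := r.braidAt σ
      braiding_naturality_right := fun X Y Z f => by
        rw [← id_tensorHom, braidAt_naturality, tensorHom_id]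
      braiding_naturality_left := fun f Z => by
        rw [← tensorHom_id, braidAt_naturality, id_tensorHom]
      hexagon_forward := fun X Y Z => ?_
      hexagon_reverse := fun X Y Z => ?_ }, r.mulV_swapEv σ⟩
  · refine dense_hom_ext_left F fun a b c x y z => ?_
    rw [associator_naturality_assoc, reassoc_of% (r.braidAt_naturality σ), associator_naturality]
    rw [← tensorHom_id, tensorHom_comp_tensorHom_assoc, braidAt_naturality, Category.comp_id,
      ← Category.id_comp z, ← tensorHom_comp_tensorHom_assoc, associator_naturality_assoc,
      ← id_tensorHom, tensorHom_comp_tensorHom, Category.id_comp, braidAt_naturality,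
      Category.comp_id]
    have key : (α_ (F.obj a) (F.obj b) (F.obj c)).hom ≫
        (r.braidAt σ (F.obj a) (F.obj b ⊗ F.obj c)).hom ≫
          (α_ (F.obj b) (F.obj c) (F.obj a)).hom =
        (r.braidAt σ (F.obj a) (F.obj b)).hom ▷ F.obj c ≫
          (α_ (F.obj b) (F.obj a) (F.obj c)).hom ≫
            F.obj b ◁ (r.braidAt σ (F.obj a) (F.obj c)).hom := by
      refine dense_hom_ext F fun d f => ?_
      obtain ⟨w, p, q, rfl⟩ := exists_left r.mul f
      obtain ⟨y, p₁, q₁, h₁⟩ := exists_assoc p q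
      obtain ⟨z, p₂, q₂, h₂⟩ := exists_assoc p₁ (swapEv σ q₁)
      obtain ⟨v, p₃, q₃, h₃⟩ := exists_assoc (swapEv σ p) q
      have h := hf p q p₁ q₁ p₂ q₂ p₃ q₃ h₁ h₂ h₃
      rw [rightMk_eq_iff r.mul, mulV_swapEv, MonoidalCategory.whiskerLeft_comp] at h
      rw [r.assoc] at h₁ h₂ h₃
      rw [mulV_swapEv] at h₂ h₃
      simp only [Category.assoc, comp_whiskerRight] at h₁ h₂ h₃ ⊢
      have e := r.braidAt_naturality σ (𝟙 (F.obj a)) (mulV r.mul p₁)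
      rw [id_tensorHom, tensorHom_id] at e
      rw [reassoc_of% h₁, reassoc_of% e, h₂, h, reassoc_of% h₃]
    have key' := congrArg (· ≫ (y ⊗ₘ z ⊗ₘ x)) key
    simp only [Category.assoc] at key'
    rw [key', ← tensorHom_id, ← id_tensorHom, tensorHom_comp_tensorHom, Category.id_comp]
  · refine dense_hom_ext_right F fun a b c x y z => ?_
    rw [associator_inv_naturality_assoc, reassoc_of% (r.braidAt_naturality σ), associator_inv_naturality]
    rw [← id_tensorHom, tensorHom_comp_tensorHom_assoc, braidAt_naturality, Category.comp_id,
      ← Category.id_comp x, ← tensorHom_comp_tensorHom_assoc, associator_inv_naturality_assoc,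
      ← tensorHom_id, tensorHom_comp_tensorHom, Category.id_comp, braidAt_naturality,
      Category.comp_id]
    have key : (α_ (F.obj a) (F.obj b) (F.obj c)).inv ≫
        (r.braidAt σ (F.obj a ⊗ F.obj b) (F.obj c)).hom ≫
          (α_ (F.obj c) (F.obj a) (F.obj b)).inv =
        F.obj a ◁ (r.braidAt σ (F.obj b) (F.obj c)).hom ≫
          (α_ (F.obj a) (F.obj c) (F.obj b)).inv ≫
            (r.braidAt σ (F.obj a) (F.obj c)).hom ▷ F.obj b := by
      refine dense_hom_ext F fun d f => ?_
      obtain ⟨w, p, q, rfl⟩ := exists_right r.mul f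
      obtain ⟨y, p₁, q₁, h₁⟩ := r.exists_assoc_inv p q
      obtain ⟨z, p₂, q₂, h₂⟩ := r.exists_assoc_inv p₁ (swapEv σ q₁)
      obtain ⟨v, p₃, q₃, h₃⟩ := r.exists_assoc_inv (swapEv σ p) q
      have h := hr p q p₁ q₁ p₂ q₂ p₃ q₃ h₁ h₂ h₃
      rw [leftMk_eq_iff r.mul, mulV_swapEv, comp_whiskerRight] at h
      rw [r.assoc] at h₁ h₂ h₃
      rw [mulV_swapEv] at h₂ h₃
      have h₁' := congrArg (· ≫ (α_ _ _ _).inv) h₁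
      have h₂' := congrArg (· ≫ (α_ _ _ _).inv) h₂
      have h₃' := congrArg (· ≫ (α_ _ _ _).inv) h₃
      simp only [Category.assoc, MonoidalCategory.whiskerLeft_comp, Iso.hom_inv_id,
        Category.comp_id] at h₁' h₂' h₃' ⊢
      have e := r.braidAt_naturality σ (mulV r.mul p₁) (𝟙 (F.obj c))
      rw [id_tensorHom, tensorHom_id] at e
      rw [← reassoc_of% h₁', reassoc_of% e, ← h₂', h, reassoc_of% h₃']
    have key' := congrArg (· ≫ ((z ⊗ₘ x) ⊗ₘ y)) key
    simp only [Category.assoc] at key'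
    rw [key', ← tensorHom_id, ← id_tensorHom, tensorHom_comp_tensorHom, Category.id_comp]

end Braiding

/-! ### The twist on the completion -/

section Twist

variable [BraidedCategory D]

/-- The identity wire is represented by `F`, so its automorphism becomes one of `F` and extends to
an automorphism of the identity functor of `D`. The two axioms are tested on labels. -/
lemma exists_balanced {σ : I.mul ≅ I.mul.whiskerLeft₂ (CategoryTheory.Prod.swap C C) (𝟭 C)}
    (hσ : ∀ {a b c : C} (p : El I.mul (a, b) c),
      mulV r.mul (swapEv σ p) = mulV r.mul p ≫ (β_ (F.obj a) (F.obj b)).hom)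
    (θ : wire C ≅ wire C)
    (hmul : ∀ {a b c : C} (p : El I.mul (a, b) c), pull I.mul (wireEv θ.hom (𝟙 c)) p =
      swapEv σ (swapEv σ (I.pushFst (wireEv θ.hom (𝟙 a)) (I.pushSnd (wireEv θ.hom (𝟙 b)) p))))
    (hone : ∀ {x : C} (j : El I.one pt x), pull I.one (wireEv θ.hom (𝟙 x)) j = j) :
    ∃ _ : BalancedCategory D, ∀ a : C,
      F.map (wireEv θ.hom (𝟙 a)) = (BalancedCategory.twist (F.obj a)).hom := by
  obtain ⟨τ, hnat, hτ⟩ : ∃ τ : ∀ X : D, X ≅ X,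
      (∀ {X Y : D} (f : X ⟶ Y), f ≫ (τ Y).hom = (τ X).hom ≫ f) ∧
        ∀ a : C, F.map (wireEv θ.hom (𝟙 a)) = (τ (F.obj a)).hom := by
    let φ : 𝟭 D ≅ 𝟭 D := extIso F (G := 𝟭 D) (H := 𝟭 D)
      (liftIso F (T := F) (T' := F) ((repWire F).symm ≪≫ θ ≪≫ repWire F))
    refine ⟨fun X => φ.app X, fun f => φ.hom.naturality f, fun a => ?_⟩
    have h : φ.hom.app (F.obj a) = (liftIso F (T := F) (T' := F)
      ((repWire F).symm ≪≫ θ ≪≫ repWire F)).hom.app a := extIso_hom_app_obj F _ a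
    change _ = φ.hom.app (F.obj a)
    rw [h, ← Category.id_comp ((liftIso F _).hom.app a)]
    refine Eq.trans ?_ (comp_liftIso_hom F (T := F) (T' := F)
      ((repWire F).symm ≪≫ θ ≪≫ repWire F) (a := a) (𝟙 (F.obj a))).symm
    change _ = F.map (ev θ.hom (vr (repWire F) (𝟙 (F.obj a))))
    -- The component of the lifted automorphism is read off by applying it to the identity of `F.obj
    -- a`, which is the label `𝟙 a` of the wire.
    have e : vr (repWire F) (𝟙 (F.obj a)) = 𝟙 a := by
      rw [← F.map_id]
      exact vr_rv (repWire F) _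
    rw [e]
    rfl
  refine ⟨
    { twist := τ
      twist_naturality := hnat
      twist_unit := dense_hom_ext F fun x j => ?_
      twist_tensor := fun X Y => dense_hom_ext_tensor F fun a b x y => ?_ }, hτ⟩
  -- Naturality replaces the twist of the unit object by the twist on a value of `F`, where the
  -- presentation removes it.
  · obtain ⟨j, rfl⟩ := (oneV_bijective r.one).2 j
    rw [hnat, ← hτ, ← oneV_pull, hone, Category.comp_id]
  · have key : (τ (F.obj a ⊗ F.obj b)).hom =
        ((τ (F.obj a)).hom ⊗ₘ (τ (F.obj b)).hom) ≫ (β_ _ _).hom ≫ (β_ _ _).hom := by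
      refine dense_hom_ext F fun c f => ?_
      obtain ⟨p, rfl⟩ := (mulV_bijective r.mul).2 f
      have h := congrArg (mulV r.mul) (hmul p)
      rw [mulV_pull, hσ, hσ, mulV_pushFst, mulV_pushSnd, hτ, hτ, hτ] at h
      rw [hnat, h, tensorHom_def']
      simp only [Category.assoc]
    rw [hnat, key, tensorHom_comp_tensorHom_assoc, hnat, hnat, ← tensorHom_comp_tensorHom_assoc]
    simp only [Category.assoc, BraidedCategory.braiding_naturality,
      BraidedCategory.braiding_naturality_assoc]

end Twist

/-! ### The trace on the completion -/

section Trace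

variable (τ : I.ring ⟶ wire C)

/-- The trace of a morphism between tensor products of objects of `C`. -/
noncomputable def trF {a b x : C} (f : F.obj a ⊗ F.obj x ⟶ F.obj b ⊗ F.obj x) :
    F.obj a ⟶ F.obj b :=
  F.map (show a ⟶ b from ev τ (loopMk (comp I.mul I.mulR) (a := b) (b := a) (x := x)
    (vr (repRing r.mul r.mulR) f)))

omit [F.Faithful] in
lemma trF_rep {a b c x : C} (p : El I.mul (b, x) c) (k : El I.mulR c (a, x)) :
    r.trF τ (mulRV r.mulR k ≫ mulV r.mul p) = F.map (I.ringEv τ p k) := by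
  have h : vr (repRing r.mul r.mulR) (mulRV r.mulR k ≫ mulV r.mul p) = rep I.mul I.mulR p k :=
    vr_rv (repRing r.mul r.mulR) (rep I.mul I.mulR p k)
  unfold trF
  rw [h]
  rfl

omit [F.Faithful] in
lemma elt_push {a b b' x y z : C} (g : b ⟶ b') (h : y ⟶ z)
    (f : F.obj a ⊗ F.obj x ⟶ F.obj b ⊗ F.obj y) :
    push (comp I.mul I.mulR) ((g, h) : (b, y) ⟶ (b', z))
      (vr (repRing r.mul r.mulR) (a := (b, y)) (c := (a, x)) f) =
    vr (repRing r.mul r.mulR) (a := (b', z)) (c := (a, x)) (f ≫ (F.map g ⊗ₘ F.map h)) := by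
  apply rv_injective (repRing r.mul r.mulR)
  rw [rv_push, rv_vr, rv_vr]
  rfl

omit [F.Faithful] in
lemma elt_pull {a a' b x y z : C} (g : a' ⟶ a) (h : z ⟶ x)
    (f : F.obj a ⊗ F.obj x ⟶ F.obj b ⊗ F.obj y) :
    pull (comp I.mul I.mulR) ((g, h) : (a', z) ⟶ (a, x))
      (vr (repRing r.mul r.mulR) (a := (b, y)) (c := (a, x)) f) =
    vr (repRing r.mul r.mulR) (a := (b, y)) (c := (a', z)) ((F.map g ⊗ₘ F.map h) ≫ f) := by
  apply rv_injective (repRing r.mul r.mulR)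
  rw [rv_pull, rv_vr, rv_vr]
  rfl

-- By fullness `g` comes from `C`, so this is naturality of `τ` in its covariant variable;
-- tightening on the left is naturality in the other one.
omit [F.Faithful] in
lemma trF_tightening_right {a b b' x : C} (f : F.obj a ⊗ F.obj x ⟶ F.obj b ⊗ F.obj x)
    (g : F.obj b ⟶ F.obj b') : r.trF τ (f ≫ g ▷ F.obj x) = r.trF τ f ≫ g := by
  obtain ⟨g, rfl⟩ := F.map_surjective g
  unfold trF
  rw [← tensorHom_id, ← F.map_id, ← elt_push, ← push_loopMk, ev_push]
  exact F.map_comp _ _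

omit [F.Faithful] in
lemma trF_tightening_left {a a' b x : C} (f : F.obj a ⊗ F.obj x ⟶ F.obj b ⊗ F.obj x)
    (g : F.obj a' ⟶ F.obj a) : r.trF τ (g ▷ F.obj x ≫ f) = g ≫ r.trF τ f := by
  obtain ⟨g, rfl⟩ := F.map_surjective g
  unfold trF
  rw [← tensorHom_id, ← F.map_id, ← elt_pull, ← pull_loopMk, ev_pull]
  exact F.map_comp _ _

-- Sliding is the coend relation that closes the loop, for a morphism that comes from `C` by
-- fullness.
omit [F.Faithful] in
lemma trF_sliding {a b x y : C} (f : F.obj a ⊗ F.obj x ⟶ F.obj b ⊗ F.obj y)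
    (g : F.obj y ⟶ F.obj x) : r.trF τ (f ≫ F.obj b ◁ g) = r.trF τ (F.obj a ◁ g ≫ f) := by
  obtain ⟨g, rfl⟩ := F.map_surjective g
  unfold trF
  rw [← id_tensorHom, ← id_tensorHom, ← F.map_id, ← F.map_id, ← elt_pull, ← elt_push, loopMk_slide]

/-- Tightening and sliding hold before the extension and survive conjugation with retracts.
Vanishing and superposing are derived from the presentation when all objects are values of `F`.
Sliding then frees the traced object, and tightening the source and target. -/
lemma exists_trace
    (hunit : ∀ {a b c x y v : C} (j : El I.one pt x) (p : El I.mul (b, x) c)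
      (k : El I.mulR c (a, y)) (j' : El I.oneR y pt) (j₀ : El I.one pt v)
      (p₀ : El I.mul (a, v) a), I.runit j₀ p₀ = 𝟙 a →
      I.ringEv τ p (pull I.mulR (show (a, x) ⟶ (a, y) from (𝟙 a, I.oneAdj.eval j' j)) k) =
        I.mulAdj.eval k (I.pushSnd (I.oneAdj.eval j' j₀) p₀) ≫ I.runit j p)
    (hmul : ∀ {a b c x y z w v e s : C}
      (p : El I.mul (b, x) z) (q : El I.mul (z, y) c) (k : El I.mulR c (w, y))
      (l : El I.mulR w (a, x)) (q' : El I.mul (x, y) v) (p' : El I.mul (b, v) c)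
      (g : El I.mul (a, v) e) (h : El I.mulR e (a, v)) (g₁ : El I.mul (a, x) s)
      (g₂ : El I.mul (s, y) e), I.Assoc p q q' p' → I.mulAdj.UnitRep g h → I.Assoc g₁ g₂ q' g →
      I.ringEv τ (pull I.mul (I.ringEv τ q k) p) l =
        I.ringEv τ p' (push I.mulR (I.mulAdj.eval k (I.pushFst (I.mulAdj.eval l g₁) g₂)) h))
    (hsup : ∀ {a b c d x y z v e : C}
      (m : El I.mul (a, y) d) (p : El I.mul (b, x) c) (k : El I.mulR c (y, x))
      (g : El I.mul (d, x) e) (h : El I.mulR e (d, x))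
      (g₁ : El I.mul (y, x) v) (m₁ : El I.mul (a, v) e)
      (m₂ : El I.mul (a, b) z) (g₂ : El I.mul (z, x) e),
      I.mulAdj.UnitRep g h → I.Assoc m g g₁ m₁ →
      I.Assoc m₂ g₂ p (I.pushSnd (I.mulAdj.eval k g₁) m₁) →
      pull I.mul (I.ringEv τ g₂ h) m₂ = I.pushSnd (I.ringEv τ p k) m) :
    ∃ _ : RightTrace D, ∀ {a b c x : C} (p : El I.mul (b, x) c) (k : El I.mulR c (a, x)),
      F.map (I.ringEv τ p k) = RightTrace.tr (F.obj x) (mulRV r.mulR k ≫ mulV r.mul p) := by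
  obtain ⟨tr, tight, slide, htr⟩ : ∃ tr : ∀ {A B : D} (X : D), (A ⊗ X ⟶ B ⊗ X) → (A ⟶ B),
      (∀ {A A' B B' X : D} (g : A' ⟶ A) (f : A ⊗ X ⟶ B ⊗ X) (h : B ⟶ B'),
        tr X (g ▷ X ≫ f ≫ h ▷ X) = g ≫ tr X f ≫ h) ∧
      (∀ {A B X Y : D} (f : A ⊗ X ⟶ B ⊗ Y) (g : Y ⟶ X),
        tr X (f ≫ B ◁ g) = tr Y (A ◁ g ≫ f)) ∧
      ∀ {a b c x : C} (p : El I.mul (b, x) c) (k : El I.mulR c (a, x)),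
        F.map (I.ringEv τ p k) = tr (F.obj x) (mulRV r.mulR k ≫ mulV r.mul p) := by
    choose X i π hπ using exists_retract F
    -- The value is forced: tightening determines the dependence on `A` and `B`, and sliding that on
    -- `Z`.
    refine ⟨fun {A B} Z f => i A ≫ r.trF τ ((π A ⊗ₘ π Z) ≫ f ≫ (i B ⊗ₘ i Z)) ≫ π B,
      fun {A A' B B' Z} g f h => ?_, fun {A B Z Y} f g => ?_, fun {a b c x} p k => ?_⟩
    · have e : (π A' ⊗ₘ π Z) ≫ (g ▷ Z ≫ f ≫ h ▷ Z) ≫ (i B' ⊗ₘ i Z) =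
          (π A' ≫ g ≫ i A) ▷ F.obj (X Z) ≫ ((π A ⊗ₘ π Z) ≫ f ≫ (i B ⊗ₘ i Z)) ≫
            (π B ≫ h ≫ i B') ▷ F.obj (X Z) := by
        simp only [← tensorHom_id, Category.assoc, tensorHom_comp_tensorHom,
          tensorHom_comp_tensorHom_assoc, Category.id_comp, Category.comp_id, reassoc_of% hπ, hπ]
      dsimp only
      rw [e, trF_tightening_left, trF_tightening_right]
      simp only [Category.assoc, reassoc_of% hπ, hπ, Category.comp_id]
    · have e₁ : (π A ⊗ₘ π Z) ≫ (f ≫ B ◁ g) ≫ (i B ⊗ₘ i Z) =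
          ((π A ⊗ₘ π Z) ≫ f ≫ (i B ⊗ₘ i Y)) ≫ F.obj (X B) ◁ (π Y ≫ g ≫ i Z) := by
        simp only [← id_tensorHom, Category.assoc, tensorHom_comp_tensorHom,
          Category.id_comp, Category.comp_id, reassoc_of% hπ]
      have e₂ : (π A ⊗ₘ π Y) ≫ (A ◁ g ≫ f) ≫ (i B ⊗ₘ i Y) =
          F.obj (X A) ◁ (π Y ≫ g ≫ i Z) ≫ (π A ⊗ₘ π Z) ≫ f ≫ (i B ⊗ₘ i Y) := by
        simp only [← id_tensorHom, Category.assoc, tensorHom_comp_tensorHom_assoc,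
          Category.id_comp, Category.comp_id, hπ]
      dsimp only
      rw [e₁, e₂, trF_sliding]
    · dsimp only
      rw [← trF_rep]
      generalize mulRV r.mulR k ≫ mulV r.mul p = f
      -- The retract chosen for a value of `F` need not be trivial. Tightening removes the choices
      -- for `a` and `b`, and sliding that for `x`.
      rw [← trF_tightening_right, ← trF_tightening_left]
      have e : i (F.obj a) ▷ F.obj (X (F.obj x)) ≫ ((π (F.obj a) ⊗ₘ π (F.obj x)) ≫ f ≫
          (i (F.obj b) ⊗ₘ i (F.obj x))) ≫ π (F.obj b) ▷ F.obj (X (F.obj x)) =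
          F.obj a ◁ π (F.obj x) ≫ f ≫ F.obj b ◁ i (F.obj x) := by
        simp only [← tensorHom_id, ← id_tensorHom, Category.assoc, tensorHom_comp_tensorHom,
          tensorHom_comp_tensorHom_assoc, Category.id_comp, Category.comp_id, hπ]
      rw [e, ← trF_sliding, Category.assoc, ← MonoidalCategory.whiskerLeft_comp, hπ,
        MonoidalCategory.whiskerLeft_id, Category.comp_id]
  have tight_right : ∀ {A B B' X : D} (f : A ⊗ X ⟶ B ⊗ X) (h : B ⟶ B'),
      tr X (f ≫ h ▷ X) = tr X f ≫ h := fun f h => by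
    simpa using tight (𝟙 _) f h
  have tight_left : ∀ {A A' B X : D} (g : A' ⟶ A) (f : A ⊗ X ⟶ B ⊗ X),
      tr X (g ▷ X ≫ f) = g ≫ tr X f := fun g f => by
    simpa using tight g f (𝟙 _)
  have htr_unit : ∀ {a b : C} (f : F.obj a ⊗ 𝟙_ D ⟶ F.obj b ⊗ 𝟙_ D),
      tr (𝟙_ D) f = (ρ_ _).inv ≫ f ≫ (ρ_ _).hom := fun {a b} f => by
    obtain ⟨x, i, π, hi⟩ := exists_retract F (𝟙_ D)
    obtain ⟨j, rfl⟩ := (oneV_bijective r.one).2 π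
    obtain ⟨j', rfl⟩ := (oneRV_bijective r.oneR).2 i
    -- The presentation speaks of loops labelled by `C`, so `f` is conjugated to `Fx`, of which the
    -- unit object is a retract via `j'` and `j`. The label `p₀` is chosen so that the unitor
    -- condition becomes `j' ≫ j = 1`.
    obtain ⟨c, p, k, h⟩ := exists_ring r.mul r.mulR
      (F.obj a ◁ oneV r.one j ≫ f ≫ F.obj b ◁ oneRV r.oneR j')
    obtain ⟨p₀, h₀⟩ := (mulV_bijective r.mul).2 ((ρ_ _).inv ≫ F.obj a ◁ oneRV r.oneR j')
    have e₀ : I.runit j p₀ = 𝟙 a := by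
      apply F.map_injective
      rw [r.rightUnit, h₀]
      simp [← MonoidalCategory.whiskerLeft_comp_assoc, hi]
    have e := congrArg F.map (hunit j p k j' j p₀ e₀)
    have e' := mulRV_pull r.mulR (𝟙 a) (I.oneAdj.eval j' j) k
    rw [htr, e', F.map_comp, r.mul_counit, mulV_pushSnd, r.rightUnit, h₀, r.one_counit, F.map_id,
      id_tensorHom] at e
    simp only [Category.assoc] at e
    rw [h, reassoc_of% h] at e
    have hi' : ∀ (Y Z : D) (u : Y ⊗ 𝟙_ D ⟶ Z),
        Y ◁ oneRV r.oneR j' ≫ Y ◁ oneV r.one j ≫ u = u := fun Y Z u => by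
      rw [← MonoidalCategory.whiskerLeft_comp_assoc, hi, MonoidalCategory.whiskerLeft_id,
        Category.id_comp]
    simp only [MonoidalCategory.whiskerLeft_comp, Category.assoc, hi'] at e
    rw [← e, ← slide]
    have := hi' (F.obj b) _ (𝟙 _)
    simp only [Category.comp_id] at this
    simp only [Category.assoc, this, Category.comp_id]
  have htr_tensor : ∀ {a b x y : C}
      (f : F.obj a ⊗ (F.obj x ⊗ F.obj y) ⟶ F.obj b ⊗ (F.obj x ⊗ F.obj y)),
      tr (F.obj x ⊗ F.obj y) f =
        tr (F.obj x) (tr (F.obj y) ((α_ _ _ _).hom ≫ f ≫ (α_ _ _ _).inv)) := fun {a b x y} f => by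
    -- The inner trace runs between tensor products, so these are routed through values of `F`. One
    -- half of each retract supplies the labels `l` and `p`, and the other halves are absorbed into
    -- the morphism labelled by `q` and `k`.
    obtain ⟨w, i, π, hi⟩ := exists_retract F (F.obj a ⊗ F.obj x)
    obtain ⟨l, rfl⟩ := (mulRV_bijective r.mulR).2 i
    obtain ⟨z, s, π', hs⟩ := exists_retract F (F.obj b ⊗ F.obj x)
    obtain ⟨p, rfl⟩ := (mulV_bijective r.mul).2 π'
    obtain ⟨c, q, k, hqk⟩ := exists_ring r.mul r.mulR
      (π ▷ F.obj y ≫ (α_ _ _ _).hom ≫ f ≫ (α_ _ _ _).inv ≫ s ▷ F.obj y)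
    obtain ⟨v, q', p', h₁⟩ := exists_assoc p q
    obtain ⟨e, g, h, h₂⟩ := exists_unitRep I.mulAdj (a, v)
    obtain ⟨t, g₁, g₂, h₃⟩ := r.exists_assoc_inv q' g
    have key := congrArg F.map (hmul p q k l q' p' g h g₁ g₂ h₁ h₂ h₃)
    rw [r.assoc] at h₁ h₃
    rw [r.unitRep_iff] at h₂
    have h₃' := congrArg (· ≫ (α_ _ _ _).inv) h₃
    simp only [Category.assoc, Iso.hom_inv_id, Category.comp_id] at h₃'
    simp only [htr, mulV_pull, mulRV_push, r.mul_counit, mulV_pushFst, Category.assoc,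
      comp_whiskerRight] at key
    rw [← tight, reassoc_of% h₃', reassoc_of% h₂, ← slide] at key
    simp only [Category.assoc] at key
    have hi' := congrArg (· ▷ F.obj y) hi
    have hs' := congrArg (· ▷ F.obj y) hs
    simp only [comp_whiskerRight, id_whiskerRight] at hi' hs'
    rw [← h₁] at key
    simp only [reassoc_of% hqk, reassoc_of% hi', hs', reassoc_of% hs', Category.comp_id,
      Iso.inv_hom_id, Iso.inv_hom_id_assoc] at key
    exact key.symm
  have htr_sup : ∀ {w a b x : C} (f : F.obj a ⊗ F.obj x ⟶ F.obj b ⊗ F.obj x),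
      tr (F.obj x) ((α_ _ _ _).hom ≫ F.obj w ◁ f ≫ (α_ _ _ _).inv) =
        F.obj w ◁ tr (F.obj x) f := fun {w a b x} f => by
    -- The retraction onto `Fw ⊗ Fa` is the label `m`; after the presentation has been applied,
    -- composing with the section `s` cancels it.
    obtain ⟨d, s, π, hs⟩ := exists_retract F (F.obj w ⊗ F.obj a)
    obtain ⟨m, rfl⟩ := (mulV_bijective r.mul).2 π
    obtain ⟨c, p, k, rfl⟩ := exists_ring r.mul r.mulR f
    obtain ⟨e, g, h, h₁⟩ := exists_unitRep I.mulAdj (d, x)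
    obtain ⟨v, g₁, m₁, h₂⟩ := exists_assoc m g
    obtain ⟨z, m₂, g₂, h₃⟩ := r.exists_assoc_inv p (I.pushSnd (I.mulAdj.eval k g₁) m₁)
    have key := congrArg (mulV r.mul) (hsup m p k g h g₁ m₁ m₂ g₂ h₁ h₂ h₃)
    rw [r.assoc] at h₂ h₃
    rw [r.unitRep_iff] at h₁
    have h₃' := congrArg (· ≫ (α_ _ _ _).inv) h₃
    simp only [Category.assoc, Iso.hom_inv_id, Category.comp_id, mulV_pushSnd, r.mul_counit,
      MonoidalCategory.whiskerLeft_comp] at h₃'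
    rw [← reassoc_of% h₂] at h₃'
    rw [mulV_pull, htr, mulV_pushSnd, htr, ← tight_right, Category.assoc, h₃',
      reassoc_of% h₁, tight_left] at key
    have key' := congrArg (s ≫ ·) key
    simp only [reassoc_of% hs] at key'
    rw [← key']
    simp
  have htr_tensor' : ∀ {a b : C} {X Y : D}
      (f : F.obj a ⊗ (X ⊗ Y) ⟶ F.obj b ⊗ (X ⊗ Y)),
      tr (X ⊗ Y) f = tr X (tr Y ((α_ _ _ _).hom ≫ f ≫ (α_ _ _ _).inv)) := fun {a b X Y} f => by
    -- Sliding a retract around the loop leaves the trace unchanged. It replaces `X ⊗ Y` by a tensor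
    -- product of values of `F`, and afterwards undoes this in each nested trace separately.
    obtain ⟨x, i, π, hi⟩ := exists_retract F X
    obtain ⟨y, j, ϖ, hj⟩ := exists_retract F Y
    have hij : (i ⊗ₘ j) ≫ (π ⊗ₘ ϖ) = 𝟙 _ := by
      rw [tensorHom_comp_tensorHom, hi, hj, id_tensorHom_id]
    have e₁ := slide (F.obj a ◁ (π ⊗ₘ ϖ) ≫ f) (i ⊗ₘ j)
    have e₂ := slide (f ≫ F.obj b ◁ (i ⊗ₘ j)) (π ⊗ₘ ϖ)
    simp only [Category.assoc, ← MonoidalCategory.whiskerLeft_comp, hij,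
      MonoidalCategory.whiskerLeft_id, Category.comp_id] at e₂
    rw [e₂, htr_tensor]
    have e₃ : (α_ _ _ _).hom ≫ (F.obj a ◁ (π ⊗ₘ ϖ) ≫ f ≫ F.obj b ◁ (i ⊗ₘ j)) ≫ (α_ _ _ _).inv =
        (F.obj a ◁ π) ▷ F.obj y ≫ ((F.obj a ⊗ X) ◁ ϖ ≫
          ((α_ _ _ _).hom ≫ f ≫ (α_ _ _ _).inv) ≫ (F.obj b ⊗ X) ◁ j) ≫
            (F.obj b ◁ i) ▷ F.obj y := by
      rw [MonoidalCategory.tensorHom_def π, MonoidalCategory.tensorHom_def' i]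
      simp
    have slide' : ∀ {A B Z Z' : D} (g : A ⊗ Z ⟶ B ⊗ Z) (m : Z ⟶ Z') (m' : Z' ⟶ Z),
        m ≫ m' = 𝟙 Z → tr Z' (A ◁ m' ≫ g ≫ B ◁ m) = tr Z g := fun g m m' hm => by
      rw [← slide, Category.assoc, ← MonoidalCategory.whiskerLeft_comp, hm,
        MonoidalCategory.whiskerLeft_id, Category.comp_id]
    rw [e₃, tight, slide' _ j ϖ hj, slide' _ i π hi]
  have htr_sup' : ∀ {w a b : C} {X : D} (f : F.obj a ⊗ X ⟶ F.obj b ⊗ X),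
      tr X ((α_ _ _ _).hom ≫ F.obj w ◁ f ≫ (α_ _ _ _).inv) =
        F.obj w ◁ tr X f := fun {w a b X} f => by
    obtain ⟨x, i, π, hi⟩ := exists_retract F X
    have e₁ : tr X f = tr (F.obj x) (F.obj a ◁ π ≫ f ≫ F.obj b ◁ i) := by
      rw [← slide]
      simp only [Category.assoc, ← MonoidalCategory.whiskerLeft_comp, hi,
        MonoidalCategory.whiskerLeft_id, Category.comp_id]
    have e₂ : (α_ _ _ _).hom ≫ F.obj w ◁ (F.obj a ◁ π ≫ f ≫ F.obj b ◁ i) ≫ (α_ _ _ _).inv =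
        (F.obj w ⊗ F.obj a) ◁ π ≫ ((α_ _ _ _).hom ≫ F.obj w ◁ f ≫ (α_ _ _ _).inv) ≫
          (F.obj w ⊗ F.obj b) ◁ i := by
      simp
    rw [e₁, ← htr_sup, e₂, ← slide]
    simp only [Category.assoc, ← MonoidalCategory.whiskerLeft_comp, hi,
      MonoidalCategory.whiskerLeft_id, Category.comp_id]
  refine ⟨
    { tr := tr
      tightening := tight
      sliding := slide
      vanishing_unit := fun {A B} f => ?_
      vanishing_tensor := fun {A B X Y} f => ?_
      superposing := fun {A B X} W f => ?_ }, htr⟩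
  · refine dense_hom_ext F fun a u => dense_hom_ext' F fun b v => ?_
    rw [← tight_left, ← tight_right, htr_unit]
    simp
  -- Test morphisms on both sides reduce the source and target to values of `F`; tightening takes
  -- them into all of the traces.
  · refine dense_hom_ext F fun a u => dense_hom_ext' F fun b v => ?_
    have e : (α_ _ X Y).hom ≫ (u ▷ (X ⊗ Y) ≫ f ≫ v ▷ (X ⊗ Y)) ≫ (α_ _ X Y).inv =
        (u ▷ X) ▷ Y ≫ ((α_ _ _ _).hom ≫ f ≫ (α_ _ _ _).inv) ≫ (v ▷ X) ▷ Y := by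
      simp
    rw [Category.assoc, Category.assoc, ← tight, ← tight, ← tight, ← e]
    exact htr_tensor' _
  · obtain ⟨w, s, ϖ, hs⟩ := exists_retract F W
    obtain ⟨a, i, π, hi⟩ := exists_retract F A
    obtain ⟨b, j, π', hj⟩ := exists_retract F B
    -- First `A` and `B` are freed by tightening with `W` still a value of `F`. Then `W` is freed by
    -- the interchange law: whiskering by `W` is whiskering by `Fw` conjugated with the retract.
    have key : F.obj w ◁ tr X f =
        tr X ((α_ (F.obj w) A X).hom ≫ F.obj w ◁ f ≫ (α_ (F.obj w) B X).inv) := by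
      have e₁ : tr X f = i ≫ tr X (π ▷ X ≫ f ≫ j ▷ X) ≫ π' := by
        rw [tight]
        simp only [Category.assoc, reassoc_of% hi, hj, Category.comp_id]
      have hi' := congrArg (fun t => t ▷ X) hi
      have hj' := congrArg (fun t => t ▷ X) hj
      simp only [comp_whiskerRight, id_whiskerRight] at hi' hj'
      have e₂ : f = i ▷ X ≫ (π ▷ X ≫ f ≫ j ▷ X) ≫ π' ▷ X := by
        simp only [Category.assoc, reassoc_of% hi', hj', Category.comp_id]
      rw [e₁, MonoidalCategory.whiskerLeft_comp, MonoidalCategory.whiskerLeft_comp,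
        ← htr_sup', ← tight]
      conv_rhs => rw [e₂]
      congr 1
      simp
    have hs' := congrArg (· ▷ B) hs
    simp only [comp_whiskerRight, id_whiskerRight] at hs'
    have e := congrArg (· ≫ ϖ ▷ B) (whisker_exchange s (tr X f))
    simp only [Category.assoc, hs', Category.comp_id] at e
    rw [e, key, ← tight_right, ← tight_left]
    have hs'' := congrArg (· ▷ (B ⊗ X)) hs
    simp only [comp_whiskerRight, id_whiskerRight] at hs''
    have e' := congrArg (· ≫ ϖ ▷ (B ⊗ X)) (whisker_exchange s f)
    simp only [Category.assoc, hs'', Category.comp_id] at e'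
    rw [e']
    congr 1
    simp

end Trace

end Realization

/-! ### Bundled structures and realizations -/

section

variable {C D : Type u} [SmallCategory C] [SmallCategory D] (F : C ⥤ D)
  (S : BalancedTraceStruct D)

instance [h : F.Full] : (S.lift F).Full := h

instance [h : F.Faithful] : (S.lift F).Faithful := h

instance [h : RetractDense F] : RetractDense (S.lift F) := h

end

section

variable {C D : Type u} [SmallCategory C] [SmallCategory D] {F : C ⥤ D}
  {S : BalancedTraceStruct D} {I : BalancedTracePseudomonoid C}

/-- A realization that is compatible with the braiding, the twist and the trace. -/
def Realization.toRealizes (r : Realization (S.lift F) I.toRAPseudomonoid)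
    (hσ : ∀ {a b c : C} (p : El I.mul (a, b) c),
      mulV r.mul (swapEv I.braid p) = mulV r.mul p ≫ (β_ _ _).hom)
    (hθ : ∀ a : C, (S.lift F).map (wireEv I.twist.hom (𝟙 a)) =
      (BalancedCategory.twist ((S.lift F).obj a)).hom)
    (hτ : ∀ {a b c x : C} (p : El I.mul (b, x) c) (k : El I.mulR c (a, x)),
      (S.lift F).map (I.ringEv I.trace p k) =
        RightTrace.tr ((S.lift F).obj x) (mulRV r.mulR k ≫ mulV r.mul p)) :
    Realizes F S I where
  mul := r.mul
  one := r.one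
  mulR := r.mulR
  oneR := r.oneR
  mul_counit := r.mul_counit
  one_counit := r.one_counit
  assoc p q p' q' h := (r.assoc p q p' q').1 h
  leftUnit := r.leftUnit
  rightUnit := r.rightUnit
  braid := hσ
  twist := hθ
  trace := hτ

/-- The underlying realization of the right-adjoint pseudomonoid presentation. -/
def Realizes.toRealization [F.Full] [F.Faithful] [RetractDense F] (r : Realizes F S I) :
    Realization (S.lift F) I.toRAPseudomonoid where
  mul := r.mul
  one := r.one
  mulR := r.mulR
  oneR := r.oneR
  mul_counit := r.mul_counit
  one_counit := r.one_counit
  assoc p q p' q' := by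
    refine ⟨r.assoc p q p' q', fun h => ?_⟩
    -- Labels of the actual output of the associator satisfy the same equation in `D` as `p', q'`,
    -- hence represent the same element.
    obtain ⟨y, p₁, q₁, h₁⟩ := exists_assoc (I := I.toPseudomonoid) p q
    refine Eq.trans h₁ ((rightMk_eq_iff (F := S.lift F) r.mul _ _ _ _).2 ?_)
    exact (r.assoc p q p₁ q₁ h₁).symm.trans h
  leftUnit := r.leftUnit
  rightUnit := r.rightUnit

end

/-! ### Existence of structures and of interpretations -/

section Existence

variable {C D : Type u} [SmallCategory C] [SmallCategory D] (F : C ⥤ D) [F.Full] [F.Faithful]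
  [RetractDense F]

lemma exists_struct [IsIdempotentComplete D] (I : BalancedTracePseudomonoid C) :
    ∃ S : BalancedTraceStruct D, Nonempty (Realizes F S I) := by
  obtain ⟨_, ⟨r⟩⟩ := exists_realization F I.toRAPseudomonoid
  obtain ⟨_, hσ⟩ := r.exists_braided I.braid I.hexagon_forward I.hexagon_reverse
  obtain ⟨_, hθ⟩ := r.exists_balanced hσ I.twist I.twist_mul I.twist_one
  obtain ⟨_, hτ⟩ := r.exists_trace I.trace I.vanishing_unit I.vanishing_mul I.superposing
  exact ⟨⟨inferInstance, inferInstance, inferInstance, inferInstance⟩,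
    ⟨Realization.toRealizes (S := ⟨_, _, _, _⟩) r hσ hθ hτ⟩⟩

lemma exists_interpretation (S : BalancedTraceStruct D) :
    ∃ I : BalancedTracePseudomonoid C, Nonempty (Realizes F S I) :=
  ⟨interpRep (S.lift F), ⟨Realization.toRealizes (realizationRep (S.lift F))
    (mulV_swapEv_braidRep (S.lift F)) (map_wireEv_twistRep (S.lift F))
    (map_ringEv_traceRep (S.lift F) (realizationRep (S.lift F)))⟩⟩

end Existence

/-! ### Comparison of the equations on the twist -/

namespace Realizes

variable {C D : Type u} [SmallCategory C] [SmallCategory D] {F : C ⥤ D} [F.Full] [F.Faithful]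
  [RetractDense F] {S : BalancedTraceStruct D} {I : BalancedTracePseudomonoid C}
  (r : Realizes F S I)

include r

omit [F.Full] [F.Faithful] [RetractDense F] in
lemma map_wireEv_hom {a b : C} (f : a ⟶ b) : (S.lift F).map (wireEv I.twist.hom f) =
    (S.lift F).map f ≫ (BalancedCategory.twist ((S.lift F).obj b)).hom := by
  rw [← r.twist, ← Functor.map_comp]
  congr 1
  have h := ev_pull I.twist.hom f (𝟙 b : El (wire C) b b)
  have e : pull (wire C) f (𝟙 b : El (wire C) b b) = f := Category.comp_id f
  rw [e] at h
  exact h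

omit [F.Full] [F.Faithful] [RetractDense F] in
lemma map_wireEv_inv {a b : C} (f : a ⟶ b) : (S.lift F).map (wireEv I.twist.inv f) =
    (S.lift F).map f ≫ (BalancedCategory.twist ((S.lift F).obj b)).inv := by
  rw [Iso.eq_comp_inv, ← r.map_wireEv_hom]
  exact congrArg _ (ev_hom_inv I.twist _)

omit [F.Full] [F.Faithful] [RetractDense F] in
lemma onMul_swapInvEv {a b c : C} (p : El I.mul (b, a) c) :
    onMul r.mul (swapInvEv I.braid p) = onMul r.mul p ≫ (β_ _ _).inv := by
  rw [Iso.eq_comp_inv, ← r.braid]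
  exact congrArg _ (ev_hom_inv I.braid _)

omit [F.Full] in
lemma twist_eq_refl_iff : I.twist = Iso.refl _ ↔ S.TrivialTwist := by
  constructor
  · intro h X
    ext
    refine dense_hom_ext (S.lift F) fun c f => ?_
    rw [BalancedCategory.twist_naturality, ← r.twist, h]
    change (S.lift F).map (𝟙 c) ≫ f = f ≫ 𝟙 X
    simp
  · intro h
    apply iso_ext_ev
    intro a b p
    apply (S.lift F).map_injective
    refine (r.map_wireEv_hom (show b ⟶ a from p)).trans ?_
    rw [h]
    exact Category.comp_id _

/-- A general natural family `γ` and natural endomorphism `t` cover the braiding and its inverse at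
once. The unit labels compose to `Ff ⊗ 1`, so the left side traces `Ff ▷ Fb ≫ γ`, which is `Ff`
followed by the trace of `γ` by tightening. -/
lemma yanking_iff (γ : ∀ X Y : S.On, X ⊗ Y ⟶ Y ⊗ X)
    (hγ : ∀ {X X' Y Y' : S.On} (f : X ⟶ X') (g : Y ⟶ Y'),
      (f ⊗ₘ g) ≫ γ X' Y' = γ X Y ≫ (g ⊗ₘ f))
    (t : ∀ X : S.On, X ⟶ X) (ht : ∀ {X Y : S.On} (f : X ⟶ Y), f ≫ t Y = t X ≫ f)
    (sw : ∀ {b c : C}, El I.mul (b, b) c → El I.mul (b, b) c)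
    (hsw : ∀ {b c : C} (p : El I.mul (b, b) c), onMul r.mul (sw p) = onMul r.mul p ≫ γ _ _)
    (w : ∀ {a b : C}, (a ⟶ b) → (a ⟶ b))
    (hw : ∀ {a b : C} (f : a ⟶ b), (S.lift F).map (w f) = (S.lift F).map f ≫ t _) :
    (∀ {a b c : C} (f : a ⟶ b) (p : El I.mul (b, b) c) (k : El I.mulR c (a, b)),
      ev I.mulAdj.unit (show El (Profunctor.id (C := C × C)) (b, b) (a, b) from (f, 𝟙 b)) =
        rep I.mul I.mulR p k → I.tr (sw p) k = w f) ↔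
      ∀ X : S.On, RightTrace.tr X (γ X X) = t X := by
  have e : ∀ {a b c : C} (f : a ⟶ b) (p : El I.mul (b, b) c) (k : El I.mulR c (a, b)),
      ev I.mulAdj.unit (show El (Profunctor.id (C := C × C)) (b, b) (a, b) from (f, 𝟙 b)) =
        rep I.mul I.mulR p k → (S.lift F).map (I.tr (sw p) k) = (S.lift F).map f ≫
          RightTrace.tr ((S.lift F).obj b) (γ ((S.lift F).obj b) ((S.lift F).obj b)) := by
    intro a b c f p k h
    have h' : onMulR r.mulR k ≫ onMul r.mul p = _ :=
      (r.toRealization.unit_eq_rep_iff f (𝟙 b) p k).1 h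
    rw [CategoryTheory.Functor.map_id, tensorHom_id] at h'
    rw [r.trace, hsw, reassoc_of% h']
    simpa using RightTrace.tightening ((S.lift F).map f)
      (γ ((S.lift F).obj b) ((S.lift F).obj b)) (𝟙 _)
  constructor
  · intro h X
    obtain ⟨b, i, π, hi⟩ := exists_retract (S.lift F) X
    have hb : RightTrace.tr ((S.lift F).obj b) (γ ((S.lift F).obj b) ((S.lift F).obj b)) =
        t ((S.lift F).obj b) := by
      obtain ⟨c, p, k, hpk⟩ := rep_surjective _ _
        (ev I.mulAdj.unit (show El (Profunctor.id (C := C × C)) (b, b) (b, b) from (𝟙 b, 𝟙 b)))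
      have h' := congrArg (S.lift F).map (h (𝟙 b) p k hpk)
      rw [e _ _ _ hpk, hw, CategoryTheory.Functor.map_id, Category.id_comp, Category.id_comp] at h'
      exact h'
    -- From values of `F` to `X`: the traced family is natural along `i`, which is a split
    -- monomorphism. Both composites with `i` are slid forms of one trace of `γ` between `X` and
    -- `Fb`, by tightening and naturality of `γ`.
    have hi' : Mono i := mono_of_mono_fac hi
    rw [← cancel_mono i, ← ht, ← hb]
    have e₁ := RightTrace.tightening (𝟙 X) (γ X X) i
    have e₂ := RightTrace.tightening i (γ ((S.lift F).obj b) ((S.lift F).obj b)) (𝟙 _)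
    rw [id_whiskerRight, Category.id_comp, Category.id_comp] at e₁
    rw [id_whiskerRight, Category.comp_id, Category.comp_id] at e₂
    have e₃ := hγ (𝟙 X) i
    have e₄ := hγ i (𝟙 ((S.lift F).obj b))
    rw [id_tensorHom, tensorHom_id] at e₃ e₄
    rw [← e₁, ← e₂, ← e₃, e₄, RightTrace.sliding]
  · intro h a b c f p k hpk
    apply (S.lift F).map_injective
    rw [e _ _ _ hpk, hw, h]

lemma yankingPos_iff : I.YankingPos ↔ S.YankingPos :=
  r.yanking_iff (fun X Y => (β_ X Y).hom) (fun f g => BraidedCategory.braiding_naturality f g)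
    (fun X => (BalancedCategory.twist X).hom) (fun f => BalancedCategory.twist_naturality f)
    (fun p => swapEv I.braid p) (fun p => r.braid p) (fun f => wireEv I.twist.hom f)
    (fun f => r.map_wireEv_hom f)

lemma yankingNeg_iff : I.YankingNeg ↔ S.YankingNeg :=
  r.yanking_iff (fun X Y => (β_ Y X).inv)
    (fun f g => by
      rw [Iso.comp_inv_eq, Category.assoc, Iso.eq_inv_comp]
      exact (BraidedCategory.braiding_naturality g f).symm)
    (fun X => (BalancedCategory.twist X).inv)
    (fun f => by
      rw [Iso.comp_inv_eq, Category.assoc, Iso.eq_inv_comp]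
      exact (BalancedCategory.twist_naturality f).symm)
    (fun p => swapInvEv I.braid p) (fun p => r.onMul_swapInvEv p)
    (fun f => wireEv I.twist.inv f) (fun f => r.map_wireEv_inv f)

end Realizes

/-! ### Trivial twist and symmetry -/

section Symmetric

variable {D : Type u} [SmallCategory D]

/-- With identity twists, the formula for the twist of a tensor product says that the double
braiding is trivial, and yanking says that the traced braiding is the identity. The rest of the
structure is retained unchanged. -/
lemma trivialTwist_iff (S : BalancedTraced D) :
    S.TrivialTwist ↔ ∃ T : SymmetricTraced D, T.toBalancedTraced = S := by
  constructor
  · intro h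
    obtain ⟨⟨m, br, ba, tr⟩, hp, hn⟩ := S
    have e : BalancedCategory.twist (D := D) = fun X => Iso.refl X := funext h
    have hsym : ∀ X Y : D, (β_ X Y).hom ≫ (β_ Y X).hom = 𝟙 (X ⊗ Y) := fun X Y => by
      have := BalancedCategory.twist_tensor X Y
      rw [e] at this
      simpa using this.symm
    refine ⟨⟨m, { br with symmetry := hsym }, tr, fun X => (hp X).trans ?_⟩, ?_⟩
    · exact congrArg Iso.hom (h X)
    · obtain ⟨tw, h₁, h₂, h₃⟩ := ba
      obtain rfl : tw = fun X => Iso.refl X := e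
      rfl
  · rintro ⟨T, rfl⟩ X
    rfl

end Symmetric

/-! ### Comparing representations along a fully faithful functor -/

section Post

variable {A C D D' : Type u} [SmallCategory A] [SmallCategory C] [SmallCategory D]
  [SmallCategory D'] {P P' : Profunctor.{u} A C} (J : D ⥤ D') [J.Full] [J.Faithful]

/-- Profunctors represented by functors that correspond to each other under a fully faithful functor
are isomorphic. -/
noncomputable def conjIso {G : C ⥤ D} {T : A ⥤ D} {G' : C ⥤ D'} {T' : A ⥤ D'} (t : P ≅ Rep G T)
    (t' : P' ≅ Rep G' T') (φ : G ⋙ J ≅ G') (ψ : T ⋙ J ≅ T') : P ≅ P' :=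
  isoMk (fun {a c} p => vr t' (φ.inv.app c ≫ J.map (rv t p) ≫ ψ.hom.app a))
    (fun a c => by
      have h₁ := ev_hom_bijective t'.symm (a := a) (b := c)
      have h₂ : Function.Bijective (fun f : J.obj (G.obj c) ⟶ J.obj (T.obj a) =>
          φ.inv.app c ≫ f ≫ ψ.hom.app a) := ((φ.app c).homCongr (ψ.app a)).bijective
      have h₃ : Function.Bijective (fun f : G.obj c ⟶ T.obj a => J.map f) :=
        ⟨J.map_injective, J.map_surjective⟩
      exact h₁.comp (h₂.comp (h₃.comp (rv_bijective t))))
    (fun g p => by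
      apply rv_injective t'
      rw [rv_push t', rv_vr, rv_vr, rv_push, J.map_comp, Category.assoc, Category.assoc,
        Category.assoc, ← ψ.hom.naturality]
      rfl)
    (fun g p => by
      apply rv_injective t'
      rw [rv_pull t', rv_vr, rv_vr, rv_pull, J.map_comp, Category.assoc, φ.inv.naturality_assoc]
      rfl)

lemma rv_conjIso {G : C ⥤ D} {T : A ⥤ D} {G' : C ⥤ D'} {T' : A ⥤ D'} (t : P ≅ Rep G T)
    (t' : P' ≅ Rep G' T') (φ : G ⋙ J ≅ G') (ψ : T ⋙ J ≅ T') {a : A} {c : C} (p : El P a c) :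
    rv t' (ev (conjIso J t t' φ ψ).hom p) = φ.inv.app c ≫ J.map (rv t p) ≫ ψ.hom.app a :=
  rv_vr _ _

variable {F : C ⥤ D} [F.Full] [RetractDense (F ⋙ J)]

/-- Isomorphic profunctors are represented by isomorphic functors. -/
noncomputable def transport {T : A ⥤ D} {T' : A ⥤ D'} (t : P ≅ Rep F T)
    (t' : P' ≅ Rep (F ⋙ J) T') (φ : P ≅ P') : T ⋙ J ≅ T' :=
  liftIso (F ⋙ J) ((conjIso J t (Iso.refl (Rep (F ⋙ J) (T ⋙ J))) (Iso.refl _) (Iso.refl _)).symm ≪≫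
    φ ≪≫ t')

lemma map_comp_transport {T : A ⥤ D} {T' : A ⥤ D'} (t : P ≅ Rep F T)
    (t' : P' ≅ Rep (F ⋙ J) T') (φ : P ≅ P') {a : A} {c : C} (p : El P a c) :
    J.map (rv t p) ≫ (transport J t t' φ).hom.app a = rv t' (ev φ.hom p) := by
  have h := rv_conjIso J t (Iso.refl (Rep (F ⋙ J) (T ⋙ J))) (Iso.refl _) (Iso.refl _) p
  have h' : J.map (rv t p) = ev (conjIso J t (Iso.refl (Rep (F ⋙ J) (T ⋙ J))) (Iso.refl _)
      (Iso.refl _)).hom p := by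
    refine Eq.trans ?_ h.symm
    exact ((Category.id_comp _).trans (Category.comp_id _)).symm
  rw [h']
  refine (comp_liftIso_hom (F ⋙ J) _ _).trans ?_
  change ev t'.hom (ev φ.hom (ev (conjIso J t _ _ _).inv _)) = _
  rw [ev_inv_hom]
  rfl

-- The functor `J` preserves retracts, so test morphisms from values of `F` still suffice after
-- applying it.
omit [J.Full] [J.Faithful] in
lemma map_hom_ext (F : C ⥤ D) [RetractDense F] {Y : D} {Z : D'} {g h : J.obj Y ⟶ Z}
    (e : ∀ (c : C) (f : F.obj c ⟶ Y), J.map f ≫ g = J.map f ≫ h) : g = h := by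
  obtain ⟨X, i, r, hr⟩ := exists_retract F Y
  have e' := congrArg (J.map i ≫ ·) (e X r)
  simpa [← Functor.map_comp_assoc, hr] using e'

end Post

/-- A realization that is compatible with the braiding, the twist and the trace. -/
structure BalancedRealization {C D : Type u} [SmallCategory C] [SmallCategory D]
    [MonoidalCategory D] [BraidedCategory D] [BalancedCategory D] [RightTrace D]
    (F : C ⥤ D) (I : BalancedTracePseudomonoid C) extends Realization F I.toRAPseudomonoid where
  braid : ∀ {a b c : C} (p : El I.mul (a, b) c),
    mulV mul (swapEv I.braid p) = mulV mul p ≫ (β_ _ _).hom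
  twist : ∀ a : C, F.map (wireEv I.twist.hom (𝟙 a)) = (BalancedCategory.twist (F.obj a)).hom
  trace : ∀ {a b c x : C} (p : El I.mul (b, x) c) (k : El I.mulR c (a, x)),
    F.map (I.tr p k) = RightTrace.tr (F.obj x) (mulRV mulR k ≫ mulV mul p)

/-! ### Strong monoidal functors from isomorphisms of interpretations -/

section

variable {C D D' : Type u} [SmallCategory C] [SmallCategory D] [SmallCategory D']
  [MonoidalCategory D] [MonoidalCategory D'] {F : C ⥤ D} {J : D ⥤ D'} [F.Full]
  [F.Faithful] [RetractDense F] [J.Full] [J.Faithful] [RetractDense (F ⋙ J)]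

omit [MonoidalCategory D'] [J.Full] [J.Faithful] in
lemma map_hom_ext_tensor (F : C ⥤ D) [RetractDense F] {X Y : D} {W : D'}
    {f g : J.obj (X ⊗ Y) ⟶ W}
    (h : ∀ (a b : C) (x : F.obj a ⟶ X) (y : F.obj b ⟶ Y),
      J.map (x ⊗ₘ y) ≫ f = J.map (x ⊗ₘ y) ≫ g) : f = g := by
  obtain ⟨a, i, p, hp⟩ := exists_retract F X
  obtain ⟨b, j, q, hq⟩ := exists_retract F Y
  have e := congrArg (J.map (i ⊗ₘ j) ≫ ·) (h a b p q)
  simpa [← Functor.map_comp_assoc, hp, hq] using e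

omit [MonoidalCategory D'] [J.Full] [J.Faithful] in
lemma map_hom_ext_left (F : C ⥤ D) [RetractDense F] {X Y Z : D} {W : D'}
    {f g : J.obj ((X ⊗ Y) ⊗ Z) ⟶ W}
    (h : ∀ (a b c : C) (x : F.obj a ⟶ X) (y : F.obj b ⟶ Y) (z : F.obj c ⟶ Z),
      J.map ((x ⊗ₘ y) ⊗ₘ z) ≫ f = J.map ((x ⊗ₘ y) ⊗ₘ z) ≫ g) : f = g := by
  obtain ⟨a, i, p, hp⟩ := exists_retract F X
  obtain ⟨b, j, q, hq⟩ := exists_retract F Y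
  obtain ⟨c, k, r, hr⟩ := exists_retract F Z
  have e := congrArg (J.map ((i ⊗ₘ j) ⊗ₘ k) ≫ ·) (h a b c p q r)
  have e' : ((i ⊗ₘ j) ⊗ₘ k) ≫ ((p ⊗ₘ q) ⊗ₘ r) = 𝟙 _ := by
    rw [tensorHom_comp_tensorHom, tensorHom_comp_tensorHom, hp, hq, hr, id_tensorHom_id,
      id_tensorHom_id]
  simpa only [← Functor.map_comp_assoc, e', CategoryTheory.Functor.map_id, Category.id_comp]
    using e

variable {I I' : BalancedTracePseudomonoid C} (g : InterpIso I I')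

namespace Realization

section

variable {I' : RAPseudomonoid C} (r' : Realization (F ⋙ J) I')

/-- The morphism that corresponds to an element of the multiplication. -/
def mulJ {a b c : C} (p : El I'.mul (a, b) c) :
    J.obj (F.obj c) ⟶ J.obj (F.obj a) ⊗ J.obj (F.obj b) := mulV r'.mul p

/-- The morphism that corresponds to an element of the right adjoint of the multiplication. -/
def mulRJ {a b c : C} (k : El I'.mulR c (a, b)) :
    J.obj (F.obj a) ⊗ J.obj (F.obj b) ⟶ J.obj (F.obj c) := mulRV r'.mulR k

/-- The morphism that corresponds to an element of the unit. -/
def oneJ {x : C} (j : El I'.one pt x) : J.obj (F.obj x) ⟶ 𝟙_ D' := oneV r'.one j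

/-- The morphism that corresponds to an element of the right adjoint of the unit. -/
def oneRJ {x : C} (j : El I'.oneR x pt) : 𝟙_ D' ⟶ J.obj (F.obj x) := oneRV r'.oneR j

end

variable (r : Realization F I.toRAPseudomonoid) (r' : Realization (F ⋙ J) I'.toRAPseudomonoid)

-- Both multiplications are represented, so their isomorphism is one of tensor products on `C × C`
-- by the Yoneda lemma; it extends to `D × D` along retracts.
omit [F.Faithful] in
lemma exists_tensorator_data : ∃ d : ∀ X Y : D, J.obj (X ⊗ Y) ≅ J.obj X ⊗ J.obj Y,
    (∀ {X X' Y Y' : D} (f : X ⟶ X') (h : Y ⟶ Y'),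
      J.map (f ⊗ₘ h) ≫ (d X' Y').hom = (d X Y).hom ≫ (J.map f ⊗ₘ J.map h)) ∧
    ∀ {a b c : C} (p : El I.mul (a, b) c), r'.mulJ (ev g.mul.hom p) =
      J.map (mulV r.mul p) ≫ (d (F.obj a) (F.obj b)).hom := by
  let φ : tensor D ⋙ J ≅ J.prod J ⋙ tensor D' := extIso (F.prod F)
    (transport J (T := F.prod F ⋙ tensor D)
      (T' := (F ⋙ J).prod (F ⋙ J) ⋙ tensor D') r.mul r'.mul g.mul)
  refine ⟨fun X Y => φ.app (X, Y), fun {X X' Y Y'} f h =>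
    φ.hom.naturality ((f, h) : (X, Y) ⟶ (X', Y')), fun {a b c} p => ?_⟩
  have h : φ.hom.app (F.obj a, F.obj b) = (transport J (T := F.prod F ⋙ tensor D)
      (T' := (F ⋙ J).prod (F ⋙ J) ⋙ tensor D') r.mul r'.mul g.mul).hom.app (a, b) :=
    extIso_hom_app_obj (F.prod F) _ (a, b)
  change _ = _ ≫ φ.hom.app (F.obj a, F.obj b)
  rw [h]
  exact (map_comp_transport J (T := F.prod F ⋙ tensor D)
      (T' := (F ⋙ J).prod (F ⋙ J) ⋙ tensor D') r.mul r'.mul g.mul p).symm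

/-- Coherence at values of `F` is the compatibility of `g` with associator and unitors, read on
labels. Naturality of the comparison `d` carries it to all objects. -/
lemma exists_monoidal : ∃ _ : J.Monoidal,
    (∀ {a b c : C} (p : El I.mul (a, b) c), r'.mulJ (ev g.mul.hom p) =
      J.map (mulV r.mul p) ≫ Functor.OplaxMonoidal.δ J (F.obj a) (F.obj b)) ∧
    ∀ {x : C} (j : El I.one pt x), r'.oneJ (ev g.one.hom j) =
      J.map (oneV r.one j) ≫ Functor.OplaxMonoidal.η J := by
  obtain ⟨d, hnat, hd⟩ := exists_tensorator_data g r r'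
  obtain ⟨e, he⟩ : ∃ e : J.obj (𝟙_ D) ≅ 𝟙_ D', ∀ {x : C} (j : El I.one pt x),
      r'.oneJ (ev g.one.hom j) = J.map (oneV r.one j) ≫ e.hom :=
    ⟨(transport J (T := Functor.fromPUnit (𝟙_ D)) (T' := Functor.fromPUnit (𝟙_ D'))
      r.one r'.one g.one).app pt, fun j => (map_comp_transport J (T := Functor.fromPUnit (𝟙_ D))
        (T' := Functor.fromPUnit (𝟙_ D')) r.one r'.one g.one j).symm⟩
  have hl : ∀ {X X' : D} (f : X ⟶ X') (Y : D),
      J.map (f ▷ Y) ≫ (d X' Y).hom = (d X Y).hom ≫ J.map f ▷ J.obj Y := fun f Y => by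
    simpa using hnat f (𝟙 Y)
  have hr : ∀ (X : D) {Y Y' : D} (f : Y ⟶ Y'),
      J.map (X ◁ f) ≫ (d X Y').hom = (d X Y).hom ≫ J.obj X ◁ J.map f := fun X _ _ f => by
    simpa using hnat (𝟙 X) f
  have hassoc : ∀ {a b c d x y : C} (p : El I.mul (a, b) x) (q : El I.mul (x, c) d)
      (p' : El I.mul (b, c) y) (q' : El I.mul (a, y) d), I.Assoc p q p' q' →
      r'.mulJ (ev g.mul.hom q) ≫ r'.mulJ (ev g.mul.hom p) ▷ J.obj (F.obj c) ≫ (α_ _ _ _).hom =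
        r'.mulJ (ev g.mul.hom q') ≫ J.obj (F.obj a) ◁ r'.mulJ (ev g.mul.hom p') :=
    fun p q p' q' h => (r'.assoc _ _ _ _).1 (g.assoc p q p' q' h)
  have hleft : ∀ {a c x : C} (j : El I.one pt x) (p : El I.mul (x, a) c),
      J.map (F.map (I.lunit j p)) = r'.mulJ (ev g.mul.hom p) ≫
        r'.oneJ (ev g.one.hom j) ▷ J.obj (F.obj a) ≫ (λ_ _).hom := fun j p => by
    rw [← g.leftUnit]
    exact r'.leftUnit _ _
  have hright : ∀ {a c x : C} (j : El I.one pt x) (p : El I.mul (a, x) c),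
      J.map (F.map (I.runit j p)) = r'.mulJ (ev g.mul.hom p) ≫
        J.obj (F.obj a) ◁ r'.oneJ (ev g.one.hom j) ≫ (ρ_ _).hom := fun j p => by
    rw [← g.rightUnit]
    exact r'.rightUnit _ _
  have kassoc : ∀ a b c : C, (d (F.obj a ⊗ F.obj b) (F.obj c)).hom ≫
      (d (F.obj a) (F.obj b)).hom ▷ J.obj (F.obj c) ≫ (α_ _ _ _).hom =
      J.map (α_ _ _ _).hom ≫ (d (F.obj a) (F.obj b ⊗ F.obj c)).hom ≫
        J.obj (F.obj a) ◁ (d (F.obj b) (F.obj c)).hom := fun a b c => by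
    refine map_hom_ext J F fun w f => ?_
    obtain ⟨x, p, q, rfl⟩ := exists_left r.mul f
    obtain ⟨y, p', q', h⟩ := exists_assoc (I := I.toPseudomonoid) p q
    have h' := hassoc p q p' q' h
    have h'' := congrArg J.map ((r.assoc p q p' q').1 h)
    simp only [Functor.map_comp] at h'' ⊢
    simp only [Category.assoc]
    rw [reassoc_of% h'', reassoc_of% hl, reassoc_of% hr, ← MonoidalCategory.whiskerLeft_comp,
      ← comp_whiskerRight_assoc, ← hd, ← hd, reassoc_of% (hd q).symm, reassoc_of% (hd q').symm, h']
  have kleft : ∀ a : C, (d (𝟙_ D) (F.obj a)).hom ≫ e.hom ▷ J.obj (F.obj a) ≫ (λ_ _).hom =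
      J.map (λ_ _).hom := fun a => by
    -- The retraction onto the unit object is taken as a label `j`, and its section is put into `p`,
    -- so that an arbitrary test morphism is expressed by labels.
    obtain ⟨x, s, π, hs⟩ := exists_retract F (𝟙_ D)
    obtain ⟨j, rfl⟩ := (oneV_bijective r.one).2 π
    refine map_hom_ext J F fun w f => ?_
    obtain ⟨p, hp⟩ := (mulV_bijective r.mul).2 (f ≫ s ▷ F.obj a)
    have hf : f = mulV r.mul p ≫ oneV r.one j ▷ F.obj a := by
      rw [hp, Category.assoc, ← comp_whiskerRight, hs, id_whiskerRight, Category.comp_id]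
    have h := hleft j p
    have h' := r.leftUnit j p
    rw [← Category.assoc, ← hf] at h'
    rw [h', hd, he, comp_whiskerRight] at h
    rw [← Functor.map_comp, h, hf, J.map_comp]
    simp only [Category.assoc]
    rw [reassoc_of% hl]
  have kright : ∀ a : C, (d (F.obj a) (𝟙_ D)).hom ≫ J.obj (F.obj a) ◁ e.hom ≫ (ρ_ _).hom =
      J.map (ρ_ _).hom := fun a => by
    obtain ⟨x, s, π, hs⟩ := exists_retract F (𝟙_ D)
    obtain ⟨j, rfl⟩ := (oneV_bijective r.one).2 π
    refine map_hom_ext J F fun w f => ?_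
    obtain ⟨p, hp⟩ := (mulV_bijective r.mul).2 (f ≫ F.obj a ◁ s)
    have hf : f = mulV r.mul p ≫ F.obj a ◁ oneV r.one j := by
      rw [hp, Category.assoc, ← MonoidalCategory.whiskerLeft_comp, hs,
        MonoidalCategory.whiskerLeft_id, Category.comp_id]
    have h := hright j p
    have h' := r.rightUnit j p
    rw [← Category.assoc, ← hf] at h'
    rw [h', hd, he, MonoidalCategory.whiskerLeft_comp] at h
    rw [← Functor.map_comp, h, hf, J.map_comp]
    simp only [Category.assoc]
    rw [reassoc_of% hr]
  let O : J.OplaxMonoidal :=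
    { η := e.hom
      δ := fun X Y => (d X Y).hom
      δ_natural_left := fun f Y => (hl f Y).symm
      δ_natural_right := fun X f => (hr X f).symm
      oplax_associativity := fun X Y Z => by
        refine map_hom_ext_left F fun a b c x y z => ?_
        rw [reassoc_of% hnat, ← J.map_comp_assoc, associator_naturality, J.map_comp_assoc,
          reassoc_of% hnat, ← tensorHom_id, ← id_tensorHom, tensorHom_comp_tensorHom,
          tensorHom_comp_tensorHom_assoc, hnat, hnat, Category.comp_id, Category.comp_id]
        have e₁ : (((d (F.obj a) (F.obj b)).hom ≫ (J.map x ⊗ₘ J.map y)) ⊗ₘ J.map z) =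
            (d (F.obj a) (F.obj b)).hom ▷ _ ≫ ((J.map x ⊗ₘ J.map y) ⊗ₘ J.map z) := by
          rw [← tensorHom_id, tensorHom_comp_tensorHom, Category.id_comp]
        have e₂ : (J.map x ⊗ₘ ((d (F.obj b) (F.obj c)).hom ≫ (J.map y ⊗ₘ J.map z))) =
            _ ◁ (d (F.obj b) (F.obj c)).hom ≫ (J.map x ⊗ₘ (J.map y ⊗ₘ J.map z)) := by
          rw [← id_tensorHom, tensorHom_comp_tensorHom, Category.id_comp]
        rw [e₁, e₂, Category.assoc, associator_naturality, reassoc_of% kassoc]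
      oplax_left_unitality := fun X => by
        rw [← cancel_epi (J.map (λ_ X).hom), Iso.map_hom_inv_id_assoc, Iso.comp_inv_eq,
          Category.assoc]
        obtain ⟨a, i, π, hi⟩ := exists_retract F X
        -- A split epimorphism from the case of a value of `F`; cancelling it reduces unitality at
        -- `X` to that case.
        have hπ : Epi (J.map (𝟙_ D ◁ π)) :=
          epi_of_epi_fac (f := J.map (𝟙_ D ◁ i)) (h := 𝟙 _) (by
            rw [← J.map_comp, ← MonoidalCategory.whiskerLeft_comp, hi,
              MonoidalCategory.whiskerLeft_id, J.map_id])
        rw [← cancel_epi (J.map (𝟙_ D ◁ π)), ← J.map_comp, leftUnitor_naturality, reassoc_of% hr,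
          whisker_exchange_assoc, leftUnitor_naturality, reassoc_of% kleft, J.map_comp]
      oplax_right_unitality := fun X => by
        rw [← cancel_epi (J.map (ρ_ X).hom), Iso.map_hom_inv_id_assoc, Iso.comp_inv_eq,
          Category.assoc]
        obtain ⟨a, i, π, hi⟩ := exists_retract F X
        have hπ : Epi (J.map (π ▷ 𝟙_ D)) :=
          epi_of_epi_fac (f := J.map (i ▷ 𝟙_ D)) (h := 𝟙 _) (by
            rw [← J.map_comp, ← comp_whiskerRight, hi, id_whiskerRight, J.map_id])
        rw [← cancel_epi (J.map (π ▷ 𝟙_ D)), ← J.map_comp, rightUnitor_naturality, reassoc_of% hl,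
          ← whisker_exchange_assoc, rightUnitor_naturality, reassoc_of% kright, J.map_comp] }
  have : IsIso (Functor.OplaxMonoidal.η J) := inferInstanceAs (IsIso e.hom)
  have : ∀ X Y, IsIso (Functor.OplaxMonoidal.δ J X Y) := fun X Y =>
    inferInstanceAs (IsIso (d X Y).hom)
  exact ⟨Functor.Monoidal.ofOplaxMonoidal J, hd, fun j => he j⟩

end Realization

end

/-- The lax structure maps are inverse to the oplax ones, and being braided is a property. -/
lemma braided_functor_ext {D D' : Type u} [SmallCategory D] [SmallCategory D']
    [MonoidalCategory D] [MonoidalCategory D'] [BraidedCategory D] [BraidedCategory D']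
    {J : D ⥤ D'} (a b : J.Braided)
    (hη : a.toMonoidal.toOplaxMonoidal.η = b.toMonoidal.toOplaxMonoidal.η)
    (hδ : ∀ X Y, a.toMonoidal.toOplaxMonoidal.δ X Y = b.toMonoidal.toOplaxMonoidal.δ X Y) :
    a = b := by
  have h₁ : a.toMonoidal.toOplaxMonoidal = b.toMonoidal.toOplaxMonoidal := by
    ext X Y
    · exact hη
    · exact hδ X Y
  have h₂ : a.toMonoidal.toLaxMonoidal = b.toMonoidal.toLaxMonoidal := by
    ext X Y
    · have e₁ := a.toMonoidal.ε_η
      have e₂ := b.toMonoidal.η_ε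
      rw [hη] at e₁
      rw [← Category.comp_id a.toMonoidal.ε, ← e₂, ← Category.assoc, e₁, Category.id_comp]
    · have e₁ := a.toMonoidal.μ_δ X Y
      have e₂ := b.toMonoidal.δ_μ X Y
      rw [hδ] at e₁
      rw [← Category.comp_id (a.toMonoidal.μ X Y), ← e₂, ← Category.assoc, e₁, Category.id_comp]
  have h₃ : a.toMonoidal = b.toMonoidal := Functor.Monoidal.ext (congrArg (fun t => t.ε) h₂)
    (congrArg (fun t => t.μ) h₂) hη (funext fun X => funext fun Y => hδ X Y)
  obtain ⟨h⟩ := a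
  obtain ⟨h'⟩ := b
  obtain rfl := h₃
  rfl

/-! ### Preservation of braiding, twist and trace -/

section

variable {C D D' : Type u} [SmallCategory C] [SmallCategory D] [SmallCategory D']
  [MonoidalCategory D] [MonoidalCategory D'] [BraidedCategory D] [BraidedCategory D']
  [BalancedCategory D] [BalancedCategory D'] [RightTrace D] [RightTrace D']
  {F : C ⥤ D} {J : D ⥤ D'} [F.Full]
  [F.Faithful] [RetractDense F] [J.Full] [J.Faithful] [RetractDense (F ⋙ J)]
  {I I' : BalancedTracePseudomonoid C}
  (r : BalancedRealization F I) (r' : BalancedRealization (F ⋙ J) I')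

open Functor.OplaxMonoidal Functor.LaxMonoidal

namespace BalancedRealization

section Preserves

variable [J.Monoidal] (g : InterpIso I I')
  (hg : ∀ {a b c : C} (p : El I.mul (a, b) c), r'.mulJ (ev g.mul.hom p) =
      J.map (mulV r.mul p) ≫ δ J (F.obj a) (F.obj b))

include hg

omit [F.Full] [F.Faithful] [J.Full] [J.Faithful] [RetractDense (F ⋙ J)] in
lemma map_braiding_comp_δ (X Y : D) : J.map (β_ X Y).hom ≫ δ J Y X = δ J X Y ≫ (β_ _ _).hom := by
  refine map_hom_ext_tensor F fun a b x y => ?_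
  have key : J.map (β_ (F.obj a) (F.obj b)).hom ≫ δ J (F.obj b) (F.obj a) =
      δ J (F.obj a) (F.obj b) ≫ (β_ _ _).hom := by
    refine map_hom_ext J F fun c f => ?_
    obtain ⟨p, rfl⟩ := (mulV_bijective r.mul).2 f
    have h : r'.mulJ (swapEv I'.braid (ev g.mul.hom p)) = r'.mulJ (ev g.mul.hom p) ≫ (β_ _ _).hom :=
      r'.braid _
    rw [g.braid, hg, hg, r.braid, J.map_comp] at h
    simpa only [Category.assoc] using h
  have e₁ : J.map (x ⊗ₘ y) ≫ J.map (β_ X Y).hom ≫ δ J Y X =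
      (J.map (β_ (F.obj a) (F.obj b)).hom ≫ δ J (F.obj b) (F.obj a)) ≫ (J.map y ⊗ₘ J.map x) := by
    rw [← J.map_comp_assoc, BraidedCategory.braiding_naturality, J.map_comp_assoc,
      ← δ_natural, Category.assoc]
  rw [e₁, key, ← δ_natural_assoc, BraidedCategory.braiding_naturality, Category.assoc]

omit [F.Full] [F.Faithful] [J.Full] [J.Faithful] [RetractDense (F ⋙ J)] in
lemma map_braiding (X Y : D) :
    μ J X Y ≫ J.map (β_ X Y).hom = (β_ (J.obj X) (J.obj Y)).hom ≫ μ J Y X := by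
  have h := r.map_braiding_comp_δ r' g hg X Y
  have h' := congrArg (fun t => μ J X Y ≫ t ≫ μ J Y X) h
  simpa using h'

omit [F.Full] [F.Faithful] [J.Full] [J.Faithful] [RetractDense (F ⋙ J)] in
omit hg [J.Monoidal] in
include r r' g in
lemma map_twist (X : D) :
    J.map (BalancedCategory.twist X).hom = (BalancedCategory.twist (J.obj X)).hom := by
  refine map_hom_ext J F fun a f => ?_
  have h := r'.twist a
  rw [g.twist] at h
  have h' : J.map (BalancedCategory.twist (F.obj a)).hom =
      (BalancedCategory.twist (J.obj (F.obj a))).hom := by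
    rw [← r.twist]
    exact h
  rw [← J.map_comp, BalancedCategory.twist_naturality, BalancedCategory.twist_naturality,
    J.map_comp, h']

-- The counit pairs elements of the multiplication with elements of its right adjoint. As `g`
-- preserves this pairing, its effect on the former forces its effect on the latter.
omit [F.Full] [F.Faithful] [J.Full] [J.Faithful] [RetractDense (F ⋙ J)] in
lemma mulRJ_ev {a b c : C} (k : El I.mulR c (a, b)) :
    r'.mulRJ (ev g.mulR.hom k) = μ J (F.obj a) (F.obj b) ≫ J.map (mulRV r.mulR k) := by
  rw [← cancel_epi (δ J (F.obj a) (F.obj b)), Functor.Monoidal.δ_μ_assoc]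
  refine map_hom_ext J F fun d f => ?_
  obtain ⟨p, rfl⟩ := (mulV_bijective r.mul).2 f
  have h : J.map (F.map (I'.mulAdj.eval (ev g.mulR.hom k) (ev g.mul.hom p))) =
      r'.mulJ (ev g.mul.hom p) ≫ r'.mulRJ (ev g.mulR.hom k) := r'.mul_counit _ _
  rw [g.mul_counit, r.mul_counit, J.map_comp, hg, Category.assoc] at h
  exact h.symm

-- A morphism between tensor products of values of `F` is labelled by a pair `(p, k)`, where `g`
-- preserves the trace. The general case follows by tightening for `A` and `B` and sliding for `X`,
-- carried out in `D` and in `D'`.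
omit [F.Faithful] [J.Full] [J.Faithful] [RetractDense (F ⋙ J)] in
lemma map_tr {A B : D} (X : D) (f : A ⊗ X ⟶ B ⊗ X) :
    J.map (RightTrace.tr X f) = RightTrace.tr (J.obj X) (μ J A X ≫ J.map f ≫ δ J B X) := by
  have slide : ∀ {E : Type u} [SmallCategory E] [MonoidalCategory E] [RightTrace E]
      {A B Z Z' : E} (g : A ⊗ Z ⟶ B ⊗ Z) (m : Z ⟶ Z') (m' : Z' ⟶ Z), m ≫ m' = 𝟙 Z →
      RightTrace.tr Z' (A ◁ m' ≫ g ≫ B ◁ m) = RightTrace.tr Z g := fun g m m' hm => by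
    rw [← Category.assoc, RightTrace.sliding, ← MonoidalCategory.whiskerLeft_comp_assoc, hm,
      MonoidalCategory.whiskerLeft_id, Category.id_comp]
  have key : ∀ {a b x : C} (f : F.obj a ⊗ F.obj x ⟶ F.obj b ⊗ F.obj x),
      J.map (RightTrace.tr (F.obj x) f) =
        RightTrace.tr (J.obj (F.obj x)) (μ J _ _ ≫ J.map f ≫ δ J _ _) := fun f => by
    obtain ⟨c, p, k, rfl⟩ := exists_ring r.mul r.mulR f
    have h : J.map (F.map (I'.tr (ev g.mul.hom p) (ev g.mulR.hom k))) = RightTrace.tr _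
      (r'.mulRJ (ev g.mulR.hom k) ≫ r'.mulJ (ev g.mul.hom p)) := r'.trace _ _
    rw [g.trace, r.trace, r.mulRJ_ev r' g hg, hg] at h
    simpa using h
  obtain ⟨x, i, π, hi⟩ := exists_retract F X
  obtain ⟨a, j, ϖ, hj⟩ := exists_retract F A
  obtain ⟨b, l, ξ, hl⟩ := exists_retract F B
  have hi' : J.map i ≫ J.map π = 𝟙 _ := by rw [← J.map_comp, hi, J.map_id]
  have hj' := congrArg (· ▷ X) hj
  have hl' := congrArg (· ▷ X) hl
  simp only [comp_whiskerRight, id_whiskerRight] at hj' hl'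
  have e : f = j ▷ X ≫ (ϖ ▷ X ≫ f ≫ l ▷ X) ≫ ξ ▷ X := by
    simp only [Category.assoc, reassoc_of% hj', hl', Category.comp_id]
  generalize ϖ ▷ X ≫ f ≫ l ▷ X = f' at e
  subst e
  have e : μ J A X ≫ J.map (j ▷ X ≫ f' ≫ ξ ▷ X) ≫ δ J B X = J.map j ▷ J.obj X ≫
      (μ J _ _ ≫ J.map f' ≫ δ J _ _) ≫ J.map ξ ▷ J.obj X := by
    simp
  rw [e, RightTrace.tightening, RightTrace.tightening, J.map_comp, J.map_comp,
    ← slide f' i π hi, key, ← slide (μ J _ _ ≫ J.map f' ≫ δ J _ _) (J.map i) (J.map π) hi']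
  congr 3
  simp

end Preserves

lemma exists_braided_functor (g : InterpIso I I') : ∃ _ : J.Braided,
    ((∀ {a b c : C} (p : El I.mul (a, b) c), r'.mulJ (ev g.mul.hom p) =
      J.map (mulV r.mul p) ≫ δ J (F.obj a) (F.obj b)) ∧
    ∀ {x : C} (j : El I.one pt x), r'.oneJ (ev g.one.hom j) =
      J.map (oneV r.one j) ≫ η J) ∧
    (∀ X : D, J.map (BalancedCategory.twist X).hom = (BalancedCategory.twist (J.obj X)).hom) ∧
    ∀ {A B : D} (X : D) (f : A ⊗ X ⟶ B ⊗ X),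
      J.map (RightTrace.tr X f) =
        RightTrace.tr (J.obj X) (μ J A X ≫ J.map f ≫ δ J B X) := by
  obtain ⟨_, h₁, h₂⟩ := Realization.exists_monoidal g r.toRealization r'.toRealization
  exact ⟨{ braided := r.map_braiding r' g h₁ }, ⟨h₁, h₂⟩, r.map_twist r' g, r.map_tr r' g h₁⟩

omit [F.Full] [F.Faithful] [J.Full] [J.Faithful] [RetractDense (F ⋙ J)] in
lemma braided_functor_unique (g : InterpIso I I') (e e' : J.Braided)
    (h₁ : ∀ {a b c : C} (p : El I.mul (a, b) c), r'.mulJ (ev g.mul.hom p) =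
      J.map (mulV r.mul p) ≫ e.toMonoidal.toOplaxMonoidal.δ (F.obj a) (F.obj b))
    (h₂ : ∀ {x : C} (j : El I.one pt x), r'.oneJ (ev g.one.hom j) =
      J.map (oneV r.one j) ≫ e.toMonoidal.toOplaxMonoidal.η)
    (h₁' : ∀ {a b c : C} (p : El I.mul (a, b) c), r'.mulJ (ev g.mul.hom p) =
      J.map (mulV r.mul p) ≫ e'.toMonoidal.toOplaxMonoidal.δ (F.obj a) (F.obj b))
    (h₂' : ∀ {x : C} (j : El I.one pt x), r'.oneJ (ev g.one.hom j) =
      J.map (oneV r.one j) ≫ e'.toMonoidal.toOplaxMonoidal.η) : e = e' := by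
  refine braided_functor_ext e e' (map_hom_ext J F fun x f => ?_) fun X Y =>
    map_hom_ext_tensor F fun a b x y => ?_
  · obtain ⟨j, rfl⟩ := (oneV_bijective r.one).2 f
    rw [← h₂, ← h₂']
  · have key : e.toMonoidal.toOplaxMonoidal.δ (F.obj a) (F.obj b) =
        e'.toMonoidal.toOplaxMonoidal.δ (F.obj a) (F.obj b) := map_hom_ext J F fun c f => by
      obtain ⟨p, rfl⟩ := (mulV_bijective r.mul).2 f
      rw [← h₁, ← h₁']
    have n := @δ_natural _ _ _ _ _ _ J e.toMonoidal.toOplaxMonoidal _ _ _ _ x y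
    have n' := @δ_natural _ _ _ _ _ _ J e'.toMonoidal.toOplaxMonoidal _ _ _ _ x y
    exact n.symm.trans ((congrArg (· ≫ (J.map x ⊗ₘ J.map y)) key).trans n')

end BalancedRealization

end

lemma interpIso_ext {C : Type u} [SmallCategory C] {I I' : BalancedTracePseudomonoid C}
    {g g' : InterpIso I I'} (h₁ : g.mul = g'.mul) (h₂ : g.one = g'.one) (h₃ : g.mulR = g'.mulR)
    (h₄ : g.oneR = g'.oneR) : g = g' := by
  cases g
  cases g'
  subst h₁ h₂ h₃ h₄
  rfl

/-! ### Isomorphisms of interpretations from braided functors -/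

section

variable {C D D' : Type u} [SmallCategory C] [SmallCategory D] [SmallCategory D']
  [MonoidalCategory D] [MonoidalCategory D'] [BraidedCategory D] [BraidedCategory D']
  [BalancedCategory D] [BalancedCategory D'] [RightTrace D] [RightTrace D']
  {F : C ⥤ D} {J : D ⥤ D'} [F.Full]
  [F.Faithful] [RetractDense F] [J.Full] [J.Faithful] [RetractDense (F ⋙ J)]
  {I I' : BalancedTracePseudomonoid C}
  (r : BalancedRealization F I) (r' : BalancedRealization (F ⋙ J) I')

open Functor.OplaxMonoidal Functor.LaxMonoidal

namespace BalancedRealization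

/-- The comparison of the two tensor products on objects of `C`. -/
noncomputable def tensorComparison [J.Monoidal] :
    (F.prod F ⋙ tensor D) ⋙ J ≅ (F ⋙ J).prod (F ⋙ J) ⋙ tensor D' :=
  NatIso.ofComponents (fun a => (Functor.Monoidal.μIso J (F.obj a.1) (F.obj a.2)).symm)
    (fun f => (δ_natural J (F.map f.1) (F.map f.2)).symm)

/-- The comparison of the two unit objects. -/
noncomputable def unitComparison [J.Monoidal] :
    Functor.fromPUnit (𝟙_ D) ⋙ J ≅ Functor.fromPUnit (𝟙_ D') :=
  NatIso.ofComponents (fun _ => (Functor.Monoidal.εIso J).symm)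
    (fun f => by
      change J.map (𝟙 _) ≫ _ = _ ≫ 𝟙 _
      simp)

-- The realizations transport `δ`, `μ`, `η` and `ε` to the four generating 1-morphisms. Counits are
-- preserved because lax and oplax structure maps cancel, and the other conditions are the monoidal
-- functor axioms and the hypotheses.
omit [F.Full] [RetractDense F] [RetractDense (F ⋙ J)] in
lemma exists_interpIso [J.Braided]
    (hθ : ∀ X : D, J.map (BalancedCategory.twist X).hom = (BalancedCategory.twist (J.obj X)).hom)
    (hτ : ∀ {A B : D} (X : D) (f : A ⊗ X ⟶ B ⊗ X), J.map (RightTrace.tr X f) =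
      RightTrace.tr (J.obj X) (μ J A X ≫ J.map f ≫ δ J B X)) :
    ∃ g : InterpIso I I',
      (∀ {a b c : C} (p : El I.mul (a, b) c), r'.mulJ (ev g.mul.hom p) =
        J.map (mulV r.mul p) ≫ δ J (F.obj a) (F.obj b)) ∧
      ∀ {x : C} (j : El I.one pt x), r'.oneJ (ev g.one.hom j) = J.map (oneV r.one j) ≫ η J := by
  let m : I.mul ≅ I'.mul := conjIso J (T := F.prod F ⋙ tensor D)
    (T' := (F ⋙ J).prod (F ⋙ J) ⋙ tensor D') r.mul r'.mul (Iso.refl _) tensorComparison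
  let mR : I.mulR ≅ I'.mulR := conjIso J (G := F.prod F ⋙ tensor D)
    (G' := (F ⋙ J).prod (F ⋙ J) ⋙ tensor D') r.mulR r'.mulR tensorComparison (Iso.refl _)
  let u : I.one ≅ I'.one := conjIso J (T := Functor.fromPUnit (𝟙_ D))
    (T' := Functor.fromPUnit (𝟙_ D')) r.one r'.one (Iso.refl _) unitComparison
  let uR : I.oneR ≅ I'.oneR := conjIso J (G := Functor.fromPUnit (𝟙_ D))
    (G' := Functor.fromPUnit (𝟙_ D')) r.oneR r'.oneR unitComparison (Iso.refl _)
  have hm : ∀ {a b c : C} (p : El I.mul (a, b) c), r'.mulJ (ev m.hom p) =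
      J.map (mulV r.mul p) ≫ δ J (F.obj a) (F.obj b) := fun p =>
    (rv_conjIso J (T := F.prod F ⋙ tensor D) (T' := (F ⋙ J).prod (F ⋙ J) ⋙ tensor D')
      r.mul r'.mul (Iso.refl _) tensorComparison p).trans (Category.id_comp _)
  have hmR : ∀ {a b c : C} (k : El I.mulR c (a, b)), r'.mulRJ (ev mR.hom k) =
      μ J (F.obj a) (F.obj b) ≫ J.map (mulRV r.mulR k) := fun k =>
    (rv_conjIso J (G := F.prod F ⋙ tensor D) (G' := (F ⋙ J).prod (F ⋙ J) ⋙ tensor D')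
      r.mulR r'.mulR tensorComparison (Iso.refl _) k).trans
        (congrArg _ (Category.comp_id _))
  have hu : ∀ {x : C} (j : El I.one pt x), r'.oneJ (ev u.hom j) =
      J.map (oneV r.one j) ≫ η J := fun j =>
    (rv_conjIso J (T := Functor.fromPUnit (𝟙_ D)) (T' := Functor.fromPUnit (𝟙_ D'))
      r.one r'.one (Iso.refl _) unitComparison j).trans (Category.id_comp _)
  have huR : ∀ {x : C} (j : El I.oneR x pt), r'.oneRJ (ev uR.hom j) =
      ε J ≫ J.map (oneRV r.oneR j) := fun j =>
    (rv_conjIso J (G := Functor.fromPUnit (𝟙_ D)) (G' := Functor.fromPUnit (𝟙_ D'))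
      r.oneR r'.oneR unitComparison (Iso.refl _) j).trans (congrArg _ (Category.comp_id _))
  refine ⟨{
    mul := m
    one := u
    mulR := mR
    oneR := uR
    mul_counit := fun {a b c d} k p => ?_
    one_counit := fun {x y} j' j => ?_
    assoc := fun {a b c d x y} p q p' q' h => ?_
    leftUnit := fun {a c x} j p => ?_
    rightUnit := fun {a c x} j p => ?_
    braid := fun {a b c} p => ?_
    twist := ?_
    trace := fun {a b c x} p k => ?_ }, hm, hu⟩
  · apply (F ⋙ J).map_injective
    have h : (F ⋙ J).map (I'.mulAdj.eval (ev mR.hom k) (ev m.hom p)) =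
        r'.mulJ (ev m.hom p) ≫ r'.mulRJ (ev mR.hom k) := r'.mul_counit _ _
    rw [h, hm, hmR, Functor.comp_map, r.mul_counit]
    simp
  · apply (F ⋙ J).map_injective
    have h : (F ⋙ J).map (I'.oneAdj.eval (ev uR.hom j') (ev u.hom j)) =
        r'.oneJ (ev u.hom j) ≫ r'.oneRJ (ev uR.hom j') := r'.one_counit _ _
    rw [h, hu, huR, Functor.comp_map, r.one_counit]
    simp
  · rw [r.assoc] at h
    refine (r'.assoc _ _ _ _).2 ?_
    change r'.mulJ (ev m.hom q) ≫ r'.mulJ (ev m.hom p) ▷ J.obj (F.obj c) ≫ (α_ _ _ _).hom =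
      r'.mulJ (ev m.hom q') ≫ J.obj (F.obj a) ◁ r'.mulJ (ev m.hom p')
    rw [hm, hm, hm, hm]
    have h' := congrArg J.map h
    simp only [J.map_comp] at h'
    simp only [Category.assoc, comp_whiskerRight, MonoidalCategory.whiskerLeft_comp,
      δ_natural_left_assoc, δ_natural_right_assoc, Functor.OplaxMonoidal.associativity]
    rw [reassoc_of% h']
  · apply (F ⋙ J).map_injective
    have h : (F ⋙ J).map (I'.lunit (ev u.hom j) (ev m.hom p)) = r'.mulJ (ev m.hom p) ≫
        r'.oneJ (ev u.hom j) ▷ J.obj (F.obj a) ≫ (λ_ _).hom := r'.leftUnit _ _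
    rw [h, hm, hu, Functor.comp_map, r.leftUnit]
    simp
  · apply (F ⋙ J).map_injective
    have h : (F ⋙ J).map (I'.runit (ev u.hom j) (ev m.hom p)) = r'.mulJ (ev m.hom p) ≫
        J.obj (F.obj a) ◁ r'.oneJ (ev u.hom j) ≫ (ρ_ _).hom := r'.rightUnit _ _
    rw [h, hm, hu, Functor.comp_map, r.rightUnit]
    simp
  · apply mulV_injective r'.mul
    change r'.mulJ (swapEv I'.braid (ev m.hom p)) = r'.mulJ (ev m.hom (swapEv I.braid p))
    have h : r'.mulJ (swapEv I'.braid (ev m.hom p)) = r'.mulJ (ev m.hom p) ≫ (β_ _ _).hom :=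
      r'.braid _
    rw [h, hm, hm, r.braid]
    simp
  · apply iso_ext_ev
    intro a b f
    -- By naturality a 2-endomorphism of the identity wire is determined by its values on
    -- identities, where the twists can be compared.
    have e : ∀ t : wire C ⟶ wire C, ev t f = f ≫ wireEv t (𝟙 a) := fun t => by
      have h := ev_pull t (show b ⟶ a from f) (𝟙 a : El (wire C) a a)
      have e : pull (wire C) (show b ⟶ a from f) (𝟙 a : El (wire C) a a) = f := Category.comp_id f
      rw [e] at h
      exact h
    rw [e, e]
    congr 1
    apply (F ⋙ J).map_injective
    rw [r'.twist, Functor.comp_map, r.twist]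
    exact (hθ _).symm
  · apply (F ⋙ J).map_injective
    have h : (F ⋙ J).map (I'.tr (ev m.hom p) (ev mR.hom k)) = RightTrace.tr _
      (r'.mulRJ (ev mR.hom k) ≫ r'.mulJ (ev m.hom p)) := r'.trace _ _
    rw [h, hm, hmR, Functor.comp_map, r.trace, hτ]
    simp

-- The components on multiplication and unit are read off from the hypotheses. Those on the right
-- adjoints are then forced, since the counit pairing separates elements.
omit [F.Full] [F.Faithful] [RetractDense F] [J.Full] [J.Faithful] in
include r' in
lemma interpIso_unique [J.Monoidal] (g g' : InterpIso I I')
    (h₁ : ∀ {a b c : C} (p : El I.mul (a, b) c), r'.mulJ (ev g.mul.hom p) =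
        J.map (mulV r.mul p) ≫ δ J (F.obj a) (F.obj b))
    (h₂ : ∀ {x : C} (j : El I.one pt x), r'.oneJ (ev g.one.hom j) = J.map (oneV r.one j) ≫ η J)
    (h₁' : ∀ {a b c : C} (p : El I.mul (a, b) c), r'.mulJ (ev g'.mul.hom p) =
        J.map (mulV r.mul p) ≫ δ J (F.obj a) (F.obj b))
    (h₂' : ∀ {x : C} (j : El I.one pt x), r'.oneJ (ev g'.one.hom j) =
        J.map (oneV r.one j) ≫ η J) : g = g' := by
  have hm : g.mul = g'.mul := iso_ext_ev fun {a c} p => by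
    apply mulV_injective r'.mul
    exact (h₁ p).trans (h₁' p).symm
  have hu : g.one = g'.one := iso_ext_ev fun {a c} j => by
    apply (oneV_bijective r'.one).1
    exact (h₂ j).trans (h₂' j).symm
  refine interpIso_ext hm hu (iso_ext_ev fun {c a} k => ?_) (iso_ext_ev fun {y a} j' => ?_)
  · apply (mulRV_bijective r'.mulR).1
    refine dense_hom_ext (F ⋙ J) fun d f => ?_
    obtain ⟨p', rfl⟩ := (mulV_bijective r'.mul).2 f
    obtain ⟨p, rfl⟩ := (ev_hom_bijective g.mul).2 p'
    dsimp only
    rw [← r'.mul_counit, ← r'.mul_counit, g.mul_counit, hm, g'.mul_counit]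
  · apply (oneRV_bijective r'.oneR).1
    refine dense_hom_ext (F ⋙ J) fun d f => ?_
    obtain ⟨p', rfl⟩ := (oneV_bijective r'.one).2 f
    obtain ⟨p, rfl⟩ := (ev_hom_bijective g.one).2 p'
    dsimp only
    rw [← r'.one_counit, ← r'.one_counit, g.one_counit, hu, g'.one_counit]

end BalancedRealization

end

/-! ### The correspondence between isomorphisms -/

section

variable {C D : Type u} [SmallCategory C] [SmallCategory D] {F : C ⥤ D} [F.Full] [F.Faithful]
  [RetractDense F] {S S' : BalancedTraceStruct D} {I I' : BalancedTracePseudomonoid C}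

/-- The underlying realization. -/
def Realizes.toBalancedRealization (r : Realizes F S I) : BalancedRealization (S.lift F) I where
  toRealization := r.toRealization
  braid := r.braid
  twist := r.twist
  trace := r.trace

instance : (S.idFunctor S').Full := inferInstanceAs (𝟭 D).Full

instance : (S.idFunctor S').Faithful := inferInstanceAs (𝟭 D).Faithful

instance : RetractDense (S.lift F ⋙ S.idFunctor S') := inferInstanceAs (RetractDense F)

lemma balancedTraceIso_ext {e e' : BalancedTraceIso S S'} (h : e.braided = e'.braided) :
    e = e' := by
  cases e
  cases e'
  subst h
  rfl

lemma existsUnique_structIso (r : Realizes F S I) (r' : Realizes F S' I') (g : InterpIso I I') :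
    ∃! e : BalancedTraceIso S S', Intertwines r r' g e := by
  -- On underlying categories the composite with the identity functor is `F` itself, so the second
  -- realization is one along the composite.
  let q' : BalancedRealization (S.lift F ⋙ S.idFunctor S') I' := r'.toBalancedRealization
  obtain ⟨b, ⟨h₁, h₂⟩, h₃, h₄⟩ := r.toBalancedRealization.exists_braided_functor q' g
  refine ⟨⟨b, h₃, h₄⟩, ⟨h₁, h₂⟩, fun e' h' => balancedTraceIso_ext ?_⟩
  exact r.toBalancedRealization.braided_functor_unique q' g e'.braided b h'.mul h'.one h₁ h₂

lemma existsUnique_interpIso (r : Realizes F S I) (r' : Realizes F S' I')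
    (e : BalancedTraceIso S S') : ∃! g : InterpIso I I', Intertwines r r' g e := by
  let q' : BalancedRealization (S.lift F ⋙ S.idFunctor S') I' := r'.toBalancedRealization
  let _ := e.braided
  obtain ⟨g, h₁, h₂⟩ := r.toBalancedRealization.exists_interpIso q' e.twist e.trace
  refine ⟨g, ⟨h₁, h₂⟩, fun g' h' => ?_⟩
  exact r.toBalancedRealization.interpIso_unique q' g' g h'.mul h'.one h₁ h₂

end

end TracedProf

theorem theorem3 {C D : Type u} [SmallCategory C] [SmallCategory D] (F : C ⥤ D)
    (hF : TracedProf.IsCauchyCompletion F) :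
    -- interpretations of the balanced traced presentation are balanced traced categories
    (∀ I : TracedProf.BalancedTracedPseudomonoid C, ∃ S : TracedProf.BalancedTraced D,
      Nonempty (TracedProf.Realizes F S.toBalancedTraceStruct I.toBalancedTracePseudomonoid)) ∧
    (∀ S : TracedProf.BalancedTraced D, ∃ I : TracedProf.BalancedTracedPseudomonoid C,
      Nonempty (TracedProf.Realizes F S.toBalancedTraceStruct I.toBalancedTracePseudomonoid)) ∧
    -- the same without the yanking equation
    (∀ I : TracedProf.BalancedTracePseudomonoid C, ∃ S : TracedProf.BalancedTraceStruct D,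
      Nonempty (TracedProf.Realizes F S I)) ∧
    (∀ S : TracedProf.BalancedTraceStruct D, ∃ I : TracedProf.BalancedTracePseudomonoid C,
      Nonempty (TracedProf.Realizes F S I)) ∧
    -- each of the equations on the twist holds on one side if and only if it holds on the other
    (∀ (I : TracedProf.BalancedTracePseudomonoid C) (S : TracedProf.BalancedTraceStruct D),
      TracedProf.Realizes F S I →
        (I.YankingPos ↔ S.YankingPos) ∧ (I.YankingNeg ↔ S.YankingNeg) ∧
        (I.twist = Iso.refl _ ↔ S.TrivialTwist)) ∧
    -- isomorphisms correspond bijectively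
    (∀ (I I' : TracedProf.BalancedTracePseudomonoid C) (S S' : TracedProf.BalancedTraceStruct D)
      (r : TracedProf.Realizes F S I) (r' : TracedProf.Realizes F S' I'),
      (∀ g : TracedProf.InterpIso I I', ∃! e : TracedProf.BalancedTraceIso S S',
        TracedProf.Intertwines r r' g e) ∧
      (∀ e : TracedProf.BalancedTraceIso S S', ∃! g : TracedProf.InterpIso I I',
        TracedProf.Intertwines r r' g e)) ∧
    -- the symmetric case is the case of the trivial twist
    (∀ S : TracedProf.BalancedTraced D, S.TrivialTwist ↔
      ∃ T : TracedProf.SymmetricTraced D, T.toBalancedTraced = S) := by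
  have := hF.full
  have := hF.faithful
  have := hF.cauchyComplete
  have : TracedProf.RetractDense F := ⟨hF.retract⟩
  refine ⟨fun I => ?_, fun S => ?_, TracedProf.exists_struct F, TracedProf.exists_interpretation F,
    fun I S r => ⟨r.yankingPos_iff, r.yankingNeg_iff, r.twist_eq_refl_iff⟩,
    fun I I' S S' r r' => ⟨TracedProf.existsUnique_structIso r r',
      TracedProf.existsUnique_interpIso r r'⟩, TracedProf.trivialTwist_iff⟩
  -- Yanking is transferred along the realization already constructed without it; the same happens
  -- in the other direction.
  · obtain ⟨S, ⟨r⟩⟩ := TracedProf.exists_struct F I.toBalancedTracePseudomonoid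
    exact ⟨⟨S, r.yankingPos_iff.1 I.yanking_pos, r.yankingNeg_iff.1 I.yanking_neg⟩, ⟨r⟩⟩
  · obtain ⟨I, ⟨r⟩⟩ := TracedProf.exists_interpretation F S.toBalancedTraceStruct
    exact ⟨⟨I, r.yankingPos_iff.2 S.yanking_pos, r.yankingNeg_iff.2 S.yanking_neg⟩, ⟨r⟩⟩
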